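/- Let $p$ be a prime, $\overline{\mathbb Q}_p$ an algebraic closure of $\mathbb Q_p$, $\iota_p:\overline{\mathbb Q}\hookrightarrow\overline{\mathbb Q}_p$ an embedding and $\log_p$ the $p$-adic logarithm with $\log_p(p)=0$. Assume the $p$-adic Schanuel conjecture: if $\alpha_1,\dots,\alpha_n\in\overline{\mathbb Q}^\times$ and the numbers $\log_p(\iota_p\alpha_i)$ are linearly independent over $\mathbb Q$, then they generate a field of transcendence degree $n$ over $\mathbb Q$. **Setting.** Let $F\subset\overline{\mathbb Q}$ be a totally real number field of degree $d$ and $K\subset\overline{\mathbb Q}$ a totally complex quadratic extension of $F$. Let $\varrho:G_F\to\mathrm{GL}_2(\overline{\mathbb Q})$ be a continuous representation with open kernel and non-abelian projective image, let $\chi$ be a character of $G_K$ and $\sigma\in G_F\setminus G_K$, such that $\varrho|_{G_K}=\mathrm{diag}(\chi,\chi^\sigma)$, where $\chi^\sigma(c)=\chi(\sigma c\sigma^{-1})$, and $\varrho(\sigma)$ is a multiple of $\begin{pmatrix}0&1\\1&0\end{pmatrix}$. For every prime $\mathfrak p\mid p$ of $F$ fix an embedding $\iota(\mathfrak p):\overline{\mathbb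 Q}\hookrightarrow\overline{\mathbb Q}_p$ inducing $\mathfrak p$, with decomposition group $G_{F_\mathfrak p}\subset G_F$, and assume that $\varrho|_{G_{F_\mathfrak p}}\simeq\psi'_\mathfrak p\oplus\psi''_\mathfrak p$ with $\psi'_\mathfrak p\ne\psi''_\mathfrak p$ and $\psi''_\mathfrak p$ unramified; fix such $\psi''_\mathfrak p$. (For the Galois representation of a $p$-regular CM Hilbert eigenform of parallel weight one, $\psi''_{\mathfrak p}$ is given by a $p$-stabilization of finite slope.) Let $H$ be the normal closure over $\mathbb Q$ of the field fixed by $\ker\mathrm{ad}\,\varrho$, $G=\mathrm{Gal}(H/F)$, $C=\mathrm{Gal}(H/K)$, and let $h_1,\dots,h_d\in\mathrm{Gal}(H/\mathbb Q)$ be lifts of the $d$ embeddings of $F$ into $H$ such that, for every $i$, $\iota_p\circ h_i$ and $\iota(\mathfrak p_i)$ induce the same prime of $H$ for some prime $\mathfrak p_i\mid p$ of $F$. Put $L_{i,g}=\log_p(\iota_p\circ h_i\circ g^{-1}(\cdot))$, a function on $(\mathcal O_H\otimes\mathbb Z_p)^\times$. Let $I_1$ (resp. $I_2$) be the set of $i$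 such that $\mathfrak p_i$ splits in $K$ and $\chi^\sigma$ (resp. $\chi$) restricts to $\psi''_{\mathfrak p_i}$ on $G_{F_{\mathfrak p_i}}$, and let $I_3$ be the set of $i$ such that $\mathfrak p_i$ is inert or ramified in $K$. Assume that some prime of $F$ above $p$ splits in $K$. **The spaces.** Let $\mathcal H_i(X,Y)$, $i\in I_3$, be arbitrary homogeneous linear polynomials over $\overline{\mathbb Q}_p$. For $a,b\in\overline{\mathbb Q}_p^{\,d}$ put $$A_i=\begin{pmatrix}a_i&b_i\\0&-a_i\end{pmatrix}\ (i\in I_1),\quad B_i=\begin{pmatrix}a_i&0\\b_i&-a_i\end{pmatrix}\ (i\in I_2),\quad C_i=\begin{pmatrix}\mathcal H_i(b_i,a_i)&b_i\\a_i&-\mathcal H_i(b_i,a_i)\end{pmatrix}\ (i\in I_3),$$ let $X_i$ be $A_i$, $B_i$ or $C_i$ accordingly, and let $$t(a,b)=\sum_{i=1}^d\sum_{g\in G}\varrho(g)X_i\varrho(g)^{-1}L_{i,g},\qquad W=\{t(a,b): a,b\in\overline{\mathbb Q}_p^{\,d}\},$$ where $\varrho(g)X\varrho(g)^{-1}$ is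 computed in $\mathrm{GL}_2(\overline{\mathbb Q}_p)$ through $\iota_p$ and any lift of $g$ to $G_F$. View $\mathrm{Hom}(G_H,\overline{\mathbb Q}_p)$, by global class field theory, as the space of continuous homomorphisms $\mathbb A_H^\times/H^\times\to\overline{\mathbb Q}_p$, and inside $\mathrm{Hom}((\mathcal O_H\otimes\mathbb Z_p)^\times,\overline{\mathbb Q}_p)$ by restriction to $(\mathcal O_H\otimes\mathbb Z_p)^\times=\prod_{v\mid p}\mathcal O_{H,v}^\times\subset\mathbb A_H^\times$. Let $$V=W\cap(\mathrm{Hom}(G_H,\overline{\mathbb Q}_p)\otimes\mathrm{ad}^0\varrho)^G,$$ and let $V_1\subseteq V$ be the subspace of the elements $t(a,b)\in V$ for which all $A_i,B_i,C_i$ are diagonal. **The elements $t_j$.** Put $\psi=\chi/\chi^\sigma$, a character of $C$, and $\delta(i)=1$ if $i\in I_2$, $\delta(i)=0$ otherwise. For $u_1,\dots,u_d\in\mathcal O_H^\times$ such that the elements $\sum_{c\in C}\psi(c)\otimes c^{-1}(u_k)$, $1\le k\le d$, form a basis of the $\psi$-isotypical component of the $C$-representation $\mathcal O_H^\times\otimes\overline{\mathbb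 Q}$, put $$A=\Big(\sum_{c\in C}\psi(c)L_{i,c\sigma^{\delta(i)}}(u_k)\Big)_{1\le k,i\le d}.$$ For $j\in I_3$ let $(b_{i,j})_{1\le i\le d}$ be a solution of $$A\,(b_{i,j})_{i}=-\Big(\sum_{c\in C}\psi(c)L_{j,c\sigma}(u_k)\Big)_{k},$$ and let $t_j=t(e_j,(b_{i,j})_i)$, with $e_j$ the $j$-th unit vector. For $j\in I_1\cup I_2$ let $t_j=\sum_{g\in G}\varrho(g)\begin{pmatrix}1&0\\0&-1\end{pmatrix}\varrho(g)^{-1}L_{j,g}$. Let $V_2$ be the linear span of $(t_j)_{j\in I_3}$. **Proposition.** Units $u_1,\dots,u_d$ as above exist. For every such choice, the matrix $A$ is invertible (so the $b_{i,j}$ exist and are unique), the elements $t_1,\dots,t_d$ form a basis of $V$, $V=V_1\oplus V_2$, and $\dim_{\overline{\mathbb Q}_p}V=d$. -/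

import Mathlib

open scoped NumberField TensorProduct
open IsDedekindDomain

noncomputable section

namespace HilbertCM

/-! ### The `p`-adic logarithm and the `p`-adic Schanuel conjecture -/

/-- The field of algebraic numbers. -/
abbrev Qbar : Type := AlgebraicClosure ℚ

instance : Algebra.IsAlgebraic ℚ Qbar := by
  have h : (DivisionRing.toRatAlgebra : Algebra ℚ Qbar) = AlgebraicClosure.instAlgebra ℚ :=
    Subsingleton.elim _ _
  rw [h]
  exact AlgebraicClosure.isAlgebraic ℚ

instance : IsAlgClosure ℚ Qbar := ⟨inferInstance, inferInstance⟩

instance : Normal ℚ Qbar := IsAlgClosure.normal ℚ Qbar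

instance : IsGalois ℚ Qbar := IsAlgClosure.isGalois ℚ Qbar

/-- The absolute Galois group of `ℚ`, with its Krull topology. -/
abbrev GalQ : Type := Qbar ≃ₐ[ℚ] Qbar

section Log

variable (p : ℕ) [Fact p.Prime]

/-- The Mercator series `log y = ∑ (-1)^k (y - 1)^(k+1) / (k+1)`, for `‖y - 1‖ < 1`. -/
def logSeries (y : PadicAlgCl p) : PadicAlgCl p :=
  ∑' k : ℕ, (-1) ^ k * (y - 1) ^ (k + 1) / ((k : PadicAlgCl p) + 1)

/-- The `p`-adic logarithm on the nonzero elements of an algebraic closure of `ℚ_[p]`, normalised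
by `log p = 0`. For every `x ≠ 0` some power `x ^ n`, `0 < n`, has the form `p ^ m * y` with
`‖y - 1‖ < 1`, and then `log x = log y / n`, which does not depend on the choice of `n` and `m`. -/
def padicLog (x : PadicAlgCl p) : PadicAlgCl p :=
  open Classical in
  if h : ∃ nm : ℕ × ℤ, 0 < nm.1 ∧ ‖x ^ nm.1 / (p : PadicAlgCl p) ^ nm.2 - 1‖ < 1 then
    logSeries p (x ^ h.choose.1 / (p : PadicAlgCl p) ^ h.choose.2) / (h.choose.1 : PadicAlgCl p)
  else 0

/-- The `p`-adic Schanuel conjecture, relative to an embedding `ι` of the algebraic numbers: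
if the `p`-adic logarithms of `n` nonzero algebraic numbers are linearly independent over `ℚ`, they
generate a field of transcendence degree `n` over `ℚ`. -/
def PadicSchanuel (ι : Qbar →+* PadicAlgCl p) : Prop :=
  ∀ (n : ℕ) (α : Fin n → Qbar), (∀ i, α i ≠ 0) →
    LinearIndependent ℚ (fun i => padicLog p (ι (α i))) →
    Algebra.trdeg ℚ
      (IntermediateField.adjoin ℚ (Set.range fun i => padicLog p (ι (α i)))) = n

end Log

/-! ### The fields `F ⊆ K` -/

/-- A totally real number field `F` and a totally complex quadratic extension `K` of `F`. -/
structure CMPair where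
  F : IntermediateField ℚ Qbar
  K : IntermediateField ℚ Qbar
  [finF : FiniteDimensional ℚ F]
  [finK : FiniteDimensional ℚ K]
  totallyReal : NumberField.IsTotallyReal F
  totallyComplex : NumberField.IsTotallyComplex K
  le : F ≤ K
  quadratic : Module.finrank ℚ K = 2 * Module.finrank ℚ F

attribute [instance] CMPair.finF CMPair.finK

namespace CMPair

variable (E : CMPair)

/-- The degree `d = [F : ℚ]`. -/
def d : ℕ := Module.finrank ℚ E.F

/-- The absolute Galois group of `F`. -/
abbrev GF : Subgroup GalQ := E.F.fixingSubgroup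

/-- The absolute Galois group of `K`, as a subgroup of that of `F`. -/
def GK : Subgroup E.GF := E.K.fixingSubgroup.subgroupOf E.F.fixingSubgroup

theorem GK_index : E.GK.index = 2 := by
  have h1 := IntermediateField.finrank_eq_fixingSubgroup_index (F := ℚ) (E' := Qbar) E.F
  have h2 := IntermediateField.finrank_eq_fixingSubgroup_index (F := ℚ) (E' := Qbar) E.K
  have h3 : E.K.fixingSubgroup ≤ E.F.fixingSubgroup :=
    IntermediateField.fixingSubgroup_le E.le
  have h4 := Subgroup.relIndex_mul_index h3
  rw [← h1, ← h2, E.quadratic] at h4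
  exact Nat.eq_of_mul_eq_mul_right Module.finrank_pos h4

instance : E.GK.Normal := Subgroup.normal_of_index_eq_two E.GK_index

/-- The character `χ^σ = χ(σ · σ⁻¹)` of the absolute Galois group of `K`. -/
def twist (σ : E.GF) (χ : E.GK →* Qbarˣ) : E.GK →* Qbarˣ :=
  χ.comp (MulAut.conjNormal σ : E.GK ≃* E.GK).toMonoidHom

/-- The inclusion of the ring of integers of `F` into that of `K`. -/
def inclInt : 𝓞 E.F →+* 𝓞 E.K :=
  NumberField.RingOfIntegers.mapRingHom
    ((IntermediateField.inclusion E.le : E.F →ₐ[ℚ] E.K) : E.F →+* E.K)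

/-- The prime `v` of `F` splits in `K`: there are exactly two primes of `K` above `v`. -/
def SplitsInK (v : HeightOneSpectrum (𝓞 E.F)) : Prop :=
  {w : HeightOneSpectrum (𝓞 E.K) | w.asIdeal.comap E.inclInt = v.asIdeal}.ncard = 2

variable (p : ℕ) [Fact p.Prime]

/-- The primes of `F` above `p`. -/
abbrev PrimesAbove : Type :=
  {v : HeightOneSpectrum (𝓞 E.F) // (p : 𝓞 E.F) ∈ v.asIdeal}

variable {p}

/-- The decomposition group in the absolute Galois group of `F` that belongs to an embedding `e` of
the algebraic numbers into an algebraic closure of `ℚ_[p]`: the automorphisms that preserve the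
absolute value pulled back along `e`. -/
def decomp (e : Qbar →+* PadicAlgCl p) : Subgroup E.GF where
  carrier := {g | ∀ x : Qbar, ‖e (g.1 x)‖ = ‖e x‖}
  mul_mem' := by
    intro g h hg hh x
    exact (hg (h.1 x)).trans (hh x)
  one_mem' := fun _ => rfl
  inv_mem' := by
    intro g hg x
    have h := hg (g.1.symm x)
    rw [AlgEquiv.apply_symm_apply] at h
    exact h.symm

/-- `g` lies in the inertia group: it acts trivially on the residue field. -/
def IsInertial (e : Qbar →+* PadicAlgCl p) (g : E.decomp e) : Prop :=
  ∀ x : Qbar, ‖e x‖ ≤ 1 → ‖e (g.1.1 x) - e x‖ < 1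

end CMPair

/-! ### The dihedral representation and its `p`-stabilization -/

/-- The adjoint action of a group on `2 × 2` matrices through `ρ : Γ → GL₂(R)`. -/
def adRep {Γ R : Type*} [Group Γ] [CommRing R] (ρ : Γ →* GL (Fin 2) R) :
    Representation R Γ (Matrix (Fin 2) (Fin 2) R) where
  toFun g :=
    { toFun := fun X => (ρ g : Matrix (Fin 2) (Fin 2) R) * X * ((ρ g)⁻¹ : GL (Fin 2) R)
      map_add' := fun X Y => by rw [mul_add, add_mul]
      map_smul' := fun a X => by simp }
  map_one' := by ext1 X; simp
  map_mul' g h := by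
    apply LinearMap.ext
    intro X
    simp [mul_assoc]

/-- A dihedral representation `ρ` of the absolute Galois group of `F` with CM by `K`, in a basis
in which its restriction to the absolute Galois group of `K` is `χ ⊕ χ^σ` and the image of `σ` is
proportional to the antidiagonal matrix with entries `1`. -/
structure CMRep extends CMPair where
  χ : toCMPair.GK →* Qbarˣ
  σ : toCMPair.GF
  σ_notMem : σ ∉ toCMPair.GK
  ρ : toCMPair.GF →* GL (Fin 2) Qbar
  ρ_continuous : IsOpen (ρ.ker : Set toCMPair.GF)
  ρ_restrict : ∀ c : toCMPair.GK, (ρ c : Matrix (Fin 2) (Fin 2) Qbar) =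
    !![(χ c : Qbar), 0; 0, (toCMPair.twist σ χ c : Qbar)]
  ρ_σ : ∃ s : Qbar, (ρ σ : Matrix (Fin 2) (Fin 2) Qbar) = s • !![0, 1; 1, 0]
  /-- The projective image of `ρ` is not abelian. -/
  nonabelian : ∃ g h : toCMPair.GF, ∀ s : Qbar,
    ((ρ g * ρ h : GL (Fin 2) Qbar) : Matrix (Fin 2) (Fin 2) Qbar) ≠
      s • ((ρ h * ρ g : GL (Fin 2) Qbar) : Matrix (Fin 2) (Fin 2) Qbar)

namespace CMRep

variable (E : CMRep)

/-- The kernel of the adjoint representation, as a subgroup of the absolute Galois group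
of `ℚ`. -/
def adKer : Subgroup GalQ := ((adRep E.ρ).ker).map E.GF.subtype

/-- The field `H`: the normal closure over `ℚ` of the field fixed by the kernel of the adjoint
representation. -/
def H : IntermediateField ℚ Qbar :=
  IntermediateField.normalClosure ℚ (IntermediateField.fixedField E.adKer) Qbar

theorem adRep_eq_one {g : E.GF} (hg : g ∈ (adRep E.ρ).ker) (X : Matrix (Fin 2) (Fin 2) Qbar) :
    (E.ρ g : Matrix (Fin 2) (Fin 2) Qbar) * X = X * (E.ρ g : Matrix (Fin 2) (Fin 2) Qbar) := by
  have h : adRep E.ρ g X = X := by rw [MonoidHom.mem_ker.mp hg]; rfl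
  have h2 : (E.ρ g : Matrix (Fin 2) (Fin 2) Qbar) * X * ((E.ρ g)⁻¹ : GL (Fin 2) Qbar) = X := h
  have h3 : (((E.ρ g)⁻¹ : GL (Fin 2) Qbar) : Matrix (Fin 2) (Fin 2) Qbar) *
      (E.ρ g : Matrix (Fin 2) (Fin 2) Qbar) = 1 := by
    rw [← Units.val_mul, inv_mul_cancel, Units.val_one]
  calc (E.ρ g : Matrix (Fin 2) (Fin 2) Qbar) * X
      = (E.ρ g : Matrix (Fin 2) (Fin 2) Qbar) * X * (((E.ρ g)⁻¹ : GL (Fin 2) Qbar) *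
        (E.ρ g : Matrix (Fin 2) (Fin 2) Qbar)) := by rw [h3, mul_one]
    _ = X * (E.ρ g : Matrix (Fin 2) (Fin 2) Qbar) := by rw [← mul_assoc, h2]

theorem adKer_le : E.adKer ≤ E.K.fixingSubgroup := by
  rintro _ ⟨g, hg, rfl⟩
  by_contra hgK
  have hg' : g ∉ E.GK := hgK
  have hprod : g * E.σ⁻¹ ∈ E.GK := by
    rw [Subgroup.mul_mem_iff_of_index_two E.GK_index]
    simp [hg', E.σ_notMem]
  have hρ : E.ρ g = E.ρ (⟨g * E.σ⁻¹, hprod⟩ : E.GK) * E.ρ E.σ := by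
    rw [← map_mul]; simp
  obtain ⟨s, hs⟩ := E.ρ_σ
  have hmat : (E.ρ g : Matrix (Fin 2) (Fin 2) Qbar) =
      !![(E.χ ⟨g * E.σ⁻¹, hprod⟩ : Qbar), 0;
        0, (E.twist E.σ E.χ ⟨g * E.σ⁻¹, hprod⟩ : Qbar)] * (s • !![0, 1; 1, 0]) := by
    rw [hρ, Units.val_mul, hs, ← E.ρ_restrict]
  have hcomm := E.adRep_eq_one hg !![1, 0; 0, 0]
  have h01 := congrFun (congrFun hcomm 0) 1
  have hs0 : s ≠ 0 := by
    rintro rfl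
    have hu : IsUnit (E.ρ E.σ : Matrix (Fin 2) (Fin 2) Qbar) := (E.ρ E.σ).isUnit
    rw [hs, zero_smul] at hu
    exact not_isUnit_zero hu
  rw [hmat] at h01
  simp [Matrix.mul_apply, Fin.sum_univ_two, hs0] at h01

theorem adKer_isOpen : IsOpen (E.adKer : Set GalQ) := by
  have h1 : IsOpen ((adRep E.ρ).ker : Set E.GF) := by
    refine Subgroup.isOpen_mono (H₁ := E.ρ.ker) ?_ E.ρ_continuous
    intro g hg
    rw [MonoidHom.mem_ker] at hg ⊢
    apply LinearMap.ext
    intro X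
    simp [adRep, hg]
  have h2 : IsOpen (E.GF : Set GalQ) := IntermediateField.fixingSubgroup_isOpen E.F
  exact h2.isOpenMap_subtype_val _ h1

theorem finiteDimensional_fixedField :
    FiniteDimensional ℚ (IntermediateField.fixedField E.adKer) := by
  rw [← InfiniteGalois.isOpen_iff_finite]
  exact Subgroup.isOpen_mono ((IntermediateField.le_iff_le _ _).mp le_rfl) E.adKer_isOpen

instance : FiniteDimensional ℚ E.H :=
  haveI := E.finiteDimensional_fixedField
  normalClosure.is_finiteDimensional ℚ _ Qbar

instance : NumberField E.H where
  to_charZero := inferInstance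
  to_finiteDimensional := by
    convert (inferInstance : FiniteDimensional ℚ E.H)

instance : Normal ℚ E.H := normalClosure.normal ℚ _ Qbar

theorem K_le_H : E.K ≤ E.H := by
  refine le_trans ?_ (IntermediateField.le_normalClosure _)
  rw [IntermediateField.le_iff_le]
  exact E.adKer_le

theorem F_le_H : E.F ≤ E.H := E.le.trans E.K_le_H

/-- The group `Gal(H/ℚ)`. -/
abbrev GalH : Type := E.H ≃ₐ[ℚ] E.H

/-- The subgroup `G = Gal(H/F)` of `Gal(H/ℚ)`. -/
def G : Subgroup E.GalH where
  carrier := {g | ∀ x : E.H, (x : Qbar) ∈ E.F → g x = x}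
  mul_mem' := by
    intro g h hg hh x hx
    rw [AlgEquiv.mul_apply, hh x hx, hg x hx]
  one_mem' := fun _ _ => rfl
  inv_mem' := by
    intro g hg x hx
    have h := congrArg g.symm (hg x hx)
    rw [AlgEquiv.symm_apply_apply] at h
    exact h.symm

/-- The subgroup `C = Gal(H/K)` of `G = Gal(H/F)`. -/
def C : Subgroup E.G where
  carrier := {g | ∀ x : E.H, (x : Qbar) ∈ E.K → g.1 x = x}
  mul_mem' := by
    intro g h hg hh x hx
    change g.1 (h.1 x) = x
    rw [hh x hx, hg x hx]
  one_mem' := fun _ _ => rfl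
  inv_mem' := by
    intro g hg x hx
    have h := congrArg g.1.symm (hg x hx)
    rw [AlgEquiv.symm_apply_apply] at h
    exact h.symm

instance : Finite E.GalH := inferInstance
instance : Fintype E.G := Fintype.ofFinite _
instance : Fintype E.C := Fintype.ofFinite _

/-- A lift of an element of `G = Gal(H/F)` to the absolute Galois group of `F`. -/
def lift (g : E.G) : E.GF :=
  ⟨AlgEquiv.liftNormal g.1 Qbar, by
    rw [IntermediateField.mem_fixingSubgroup_iff]
    intro x hx
    have h := AlgEquiv.liftNormal_commutes g.1 Qbar (⟨x, E.F_le_H hx⟩ : E.H)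
    rw [g.2 _ hx] at h
    exact h⟩

theorem lift_mem (c : E.C) : E.lift c.1 ∈ E.GK := by
  change AlgEquiv.liftNormal c.1.1 Qbar ∈ E.K.fixingSubgroup
  rw [IntermediateField.mem_fixingSubgroup_iff]
  intro x hx
  have h := AlgEquiv.liftNormal_commutes c.1.1 Qbar (⟨x, E.K_le_H hx⟩ : E.H)
  rw [c.2 _ hx] at h
  exact h

/-- The character `χ/χ^σ` of `C = Gal(H/K)`; its value does not depend on the chosen lift. -/
def psi (c : E.C) : Qbar :=
  (E.χ ⟨E.lift c.1, E.lift_mem c⟩ : Qbar) /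
    (E.twist E.σ E.χ ⟨E.lift c.1, E.lift_mem c⟩ : Qbar)

/-- The image of `σ` in `Gal(H/ℚ)`. -/
def σH : E.GalH := AlgEquiv.restrictNormalHom E.H E.σ.1

/-- The action of `Gal(H/ℚ)` on the units of `H`. -/
def unitAct (g : E.GalH) : (𝓞 E.H)ˣ →* (𝓞 E.H)ˣ :=
  Units.map (NumberField.RingOfIntegers.mapRingHom (g : E.H →+* E.H) : 𝓞 E.H →* 𝓞 E.H)

/-- The space of units `𝓞_H^× ⊗ ℚbar`. -/
abbrev UnitSpace : Type := Qbar ⊗[ℤ] Additive (𝓞 E.H)ˣ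

/-- The action of `C = Gal(H/K)` on `𝓞_H^× ⊗ ℚbar`. -/
def unitSpaceAct (c : E.C) : E.UnitSpace →ₗ[Qbar] E.UnitSpace :=
  LinearMap.baseChange Qbar (E.unitAct c.1.1).toAdditive.toIntLinearMap

/-- The `χ/χ^σ`-isotypical component of `𝓞_H^× ⊗ ℚbar`, as a representation of `C`. -/
def isotypic : Submodule Qbar E.UnitSpace where
  carrier := {x | ∀ c : E.C, E.unitSpaceAct c x = E.psi c • x}
  add_mem' := by
    intro x y hx hy c
    rw [map_add, hx c, hy c, smul_add]
  zero_mem' := fun c => by rw [map_zero, smul_zero]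
  smul_mem' := by
    intro a x hx c
    rw [map_smul, hx c, smul_comm]

/-- The element `∑_{c ∈ C} (χ/χ^σ)(c) ⊗ c⁻¹(u)`. -/
def unitProj (u : (𝓞 E.H)ˣ) : E.UnitSpace :=
  ∑ c : E.C, E.psi c ⊗ₜ[ℤ] Additive.ofMul (E.unitAct c.1.1⁻¹ u)

/-- The units `u_1, …, u_d` give a basis of the `χ/χ^σ`-isotypical component. -/
def IsUnitBasis (u : Fin E.d → (𝓞 E.H)ˣ) : Prop :=
  LinearIndependent Qbar (fun k => E.unitProj (u k)) ∧
    Submodule.span Qbar (Set.range fun k => E.unitProj (u k)) = E.isotypic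

end CMRep

/-! ### `p`-adic data: embeddings, `p`-stabilization, `p`-adic logarithms -/

/-- A dihedral representation with CM together with the `p`-adic choices: the embedding `ι` of the
algebraic numbers, an embedding `emb v` for each prime `v ∣ p` of `F` that induces `v`, the
unramified character `ψ'' v` of the decomposition group at `v` picked out by a `p`-stabilization
(which is one of two distinct characters that make up `ρ` there), and elements
`h_1, …, h_d` of `Gal(H/ℚ)` lifting the `d` embeddings of `F` into `H`. -/
structure CMPoint (p : ℕ) [Fact p.Prime] extends CMRep where
  ι : Qbar →+* PadicAlgCl p
  emb : toCMRep.PrimesAbove p → (Qbar →+* PadicAlgCl p)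
  emb_induces : ∀ (v : toCMRep.PrimesAbove p) (x : 𝓞 toCMRep.F),
    x ∈ v.1.asIdeal ↔ ‖emb v ((x : toCMRep.F) : Qbar)‖ < 1
  ψ'' : ∀ v : toCMRep.PrimesAbove p, toCMRep.decomp (emb v) →* Qbarˣ
  ψ''_unramified : ∀ (v : toCMRep.PrimesAbove p) (g : toCMRep.decomp (emb v)),
    toCMRep.IsInertial (emb v) g → ψ'' v g = 1
  local_split : ∀ v : toCMRep.PrimesAbove p,
    ∃ (ψ' : toCMRep.decomp (emb v) →* Qbarˣ) (M : GL (Fin 2) Qbar), ψ' ≠ ψ'' v ∧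
      ∀ g : toCMRep.decomp (emb v), (ρ g.1 : Matrix (Fin 2) (Fin 2) Qbar) =
        (M : Matrix (Fin 2) (Fin 2) Qbar) * !![(ψ' g : Qbar), 0; 0, (ψ'' v g : Qbar)] *
          ((M⁻¹ : GL (Fin 2) Qbar) : Matrix (Fin 2) (Fin 2) Qbar)
  h : Fin toCMRep.d → toCMRep.GalH
  /-- The restrictions of the `h i` to `F` are distinct, so they are all `d` embeddings. -/
  h_distinct : ∀ i j, (∀ x : toCMRep.H, (x : Qbar) ∈ toCMRep.F → h i x = h j x) → i = j
  /-- The prime of `F` below the prime of `H` attached to `h i`. -/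
  place : Fin toCMRep.d → toCMRep.PrimesAbove p
  /-- `ι ∘ h i` and `emb (place i)` induce the same absolute value, hence the same prime,
  of `H`. -/
  h_place : ∀ (i : Fin toCMRep.d) (x : toCMRep.H),
    ‖ι (h i x : Qbar)‖ = ‖emb (place i) (x : Qbar)‖

namespace CMPoint

variable {p : ℕ} [Fact p.Prime] (E : CMPoint p)

/-- The indices `i` whose prime splits in `K` and where `χ^σ` is the character `ψ''`. -/
def I₁ : Set (Fin E.d) :=
  {i | E.SplitsInK (E.place i).1 ∧ ∀ g : E.decomp (E.emb (E.place i)),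
    ∃ hg : g.1 ∈ E.GK, E.twist E.σ E.χ ⟨g.1, hg⟩ = E.ψ'' (E.place i) g}

/-- The indices `i` whose prime splits in `K` and where `χ` is the character `ψ''`. -/
def I₂ : Set (Fin E.d) :=
  {i | E.SplitsInK (E.place i).1 ∧ ∀ g : E.decomp (E.emb (E.place i)),
    ∃ hg : g.1 ∈ E.GK, E.χ ⟨g.1, hg⟩ = E.ψ'' (E.place i) g}

/-- The indices `i` whose prime is inert or ramified in `K`. -/
def I₃ : Set (Fin E.d) := {i | ¬ E.SplitsInK (E.place i).1}

/-- The ring `𝓞_H ⊗ ℤ_p`. -/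
abbrev LocalInt : Type := 𝓞 E.H ⊗[ℤ] ℤ_[p]

/-- The group `(𝓞_H ⊗ ℤ_p)^×`. -/
abbrev LocalUnits : Type := E.LocalIntˣ

/-- The diagonal map `𝓞_H^× → (𝓞_H ⊗ ℤ_p)^×`. -/
def diag : (𝓞 E.H)ˣ →* E.LocalUnits :=
  Units.map ((Algebra.TensorProduct.includeLeft : 𝓞 E.H →ₐ[ℤ] E.LocalInt) : 𝓞 E.H →* E.LocalInt)

/-- The ring homomorphism `𝓞_H ⊗ ℤ_p → ℚbar_p`, `x ⊗ z ↦ ι (h_i (g⁻¹ x)) z`. -/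
def embInt (i : Fin E.d) (g : E.GalH) : E.LocalInt →ₐ[ℤ] PadicAlgCl p :=
  Algebra.TensorProduct.productMap
    ((E.ι.comp ((E.H.val : E.H →+* Qbar).comp
      (((E.h i * g⁻¹ : E.GalH) : E.H →+* E.H).comp (algebraMap (𝓞 E.H) E.H)))).toIntAlgHom)
    (((algebraMap ℚ_[p] (PadicAlgCl p)).comp PadicInt.Coe.ringHom).toIntAlgHom)

/-- The homomorphism `L_{i,g} = log_p (ι ∘ h_i ∘ g⁻¹ (·))` on `(𝓞_H ⊗ ℤ_p)^×`. -/
def L (i : Fin E.d) (g : E.GalH) (u : E.LocalUnits) : PadicAlgCl p :=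
  padicLog p (E.embInt i g u)

/-- The action of `Gal(H/ℚ)` on `(𝓞_H ⊗ ℤ_p)^×`. -/
def localUnitAct (g : E.GalH) : E.LocalUnits →* E.LocalUnits :=
  Units.map ((Algebra.TensorProduct.map
    (NumberField.RingOfIntegers.mapRingHom (g : E.H →+* E.H)).toIntAlgHom
    (AlgHom.id ℤ ℤ_[p]) : E.LocalInt →ₐ[ℤ] E.LocalInt) : E.LocalInt →* E.LocalInt)

/-! ### `Hom(G_H, ℚbar_p)` inside `Hom((𝓞_H ⊗ ℤ_p)^×, ℚbar_p)` -/

/-- The ideles of `H`. -/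
abbrev Ideles : Type := (NumberField.AdeleRing (𝓞 E.H) E.H)ˣ

/-- The idele `z` is the image of `u` under the inclusion
`(𝓞_H ⊗ ℤ_p)^× = ∏_{v ∣ p} 𝓞_v^× ⊆ 𝔸_H^×`: it is `1` at the infinite places and at the finite places
prime to `p`, and at the places `v ∣ p` it has the same approximations modulo all powers of `p`
by elements of `𝓞_H` as `u`. -/
def IsIdeleOf (u : E.LocalUnits) (z : E.Ideles) : Prop :=
  (z : NumberField.AdeleRing (𝓞 E.H) E.H).1 = 1 ∧
  (∀ v : HeightOneSpectrum (𝓞 E.H), (p : 𝓞 E.H) ∉ v.asIdeal →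
    (z : NumberField.AdeleRing (𝓞 E.H) E.H).2 v = 1) ∧
  ∀ N : ℕ, ∃ (α : 𝓞 E.H) (y : E.LocalInt),
    (u : E.LocalInt) = α ⊗ₜ[ℤ] (1 : ℤ_[p]) + (p : E.LocalInt) ^ N * y ∧
    ∀ v : HeightOneSpectrum (𝓞 E.H), (p : 𝓞 E.H) ∈ v.asIdeal →
      Valued.v ((z : NumberField.AdeleRing (𝓞 E.H) E.H).2 v -
        (((α : E.H) : v.adicCompletion E.H))) ≤
      Valued.v (((p : E.H) ^ N : E.H) : v.adicCompletion E.H)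

/-- The homomorphisms `G_H → ℚbar_p` inside the functions on `(𝓞_H ⊗ ℤ_p)^×`. By the reciprocity map of
global class field theory, the continuous homomorphisms from the absolute Galois group of `H` to
`ℚbar_p` are the continuous homomorphisms from the idele group of `H` that are trivial on principal
ideles; `φ` belongs to this space if it is the restriction to `(𝓞_H ⊗ ℤ_p)^×` of such a
homomorphism. -/
def galoisHom : Submodule (PadicAlgCl p) (E.LocalUnits → PadicAlgCl p) where
  carrier := {φ | ∃ Φ : Additive E.Ideles →+ PadicAlgCl p,
    Continuous (fun z : E.Ideles => Φ (Additive.ofMul z)) ∧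
    (∀ x : E.Hˣ, Φ (Additive.ofMul
      (Units.map (algebraMap E.H (NumberField.AdeleRing (𝓞 E.H) E.H) : _ →* _) x)) = 0) ∧
    ∀ u z, E.IsIdeleOf u z → φ u = Φ (Additive.ofMul z)}
  add_mem' := by
    rintro φ φ' ⟨Φ, h1, h2, h3⟩ ⟨Φ', h1', h2', h3'⟩
    refine ⟨Φ + Φ', h1.add h1', fun x => ?_, fun u z hz => ?_⟩
    · rw [AddMonoidHom.add_apply, h2, h2', add_zero]
    · rw [Pi.add_apply, AddMonoidHom.add_apply, h3 u z hz, h3' u z hz]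
  zero_mem' := ⟨0, continuous_const, fun _ => rfl, fun _ _ _ => rfl⟩
  smul_mem' := by
    rintro a φ ⟨Φ, h1, h2, h3⟩
    refine ⟨(AddMonoidHom.mulLeft a).comp Φ, continuous_const.mul h1, fun x => ?_,
      fun u z hz => ?_⟩
    · rw [AddMonoidHom.comp_apply, h2, map_zero]
    · rw [Pi.smul_apply, h3 u z hz]; rfl

/-! ### The spaces `W`, `V`, `V₁` and `V₂` -/

/-- `2 × 2` matrices over an algebraic closure of `ℚ_[p]`. -/
abbrev Mat (p : ℕ) [Fact p.Prime] : Type := Matrix (Fin 2) (Fin 2) (PadicAlgCl p)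

/-- Matrix valued functions on `(𝓞_H ⊗ ℤ_p)^×`, that is, matrices of functions. The space
`Hom((𝓞_H ⊗ ℤ_p)^×, ℚbar_p) ⊗ ad` is a subspace. -/
abbrev MatFun : Type := E.LocalUnits → Mat p

/-- The representation `ρ` with coefficients in `ℚbar_p`. -/
def ρp : E.GF →* GL (Fin 2) (PadicAlgCl p) :=
  (Matrix.GeneralLinearGroup.map E.ι).comp E.ρ

/-- `X ↦ ρ(g) X ρ(g)⁻¹` for `g ∈ G = Gal(H/F)`, which does not depend on the lift of `g`. -/
def Ad (g : E.G) : Mat p →ₗ[PadicAlgCl p] Mat p := adRep E.ρp (E.lift g)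

/-- The space `(Hom(G_H, ℚbar_p) ⊗ ad⁰ρ)^G`, where `g ∈ G` acts by
`(g t)(u) = ρ(g) t(g⁻¹ u) ρ(g)⁻¹`. -/
def invariants : Submodule (PadicAlgCl p) E.MatFun where
  carrier := {t | (∀ a b, (fun u => t u a b) ∈ E.galoisHom) ∧ (∀ u, (t u).trace = 0) ∧
    ∀ (g : E.G) (u : E.LocalUnits), E.Ad g (t (E.localUnitAct g.1⁻¹ u)) = t u}
  add_mem' := by
    rintro t t' ⟨h1, h2, h3⟩ ⟨h1', h2', h3'⟩
    refine ⟨fun a b => E.galoisHom.add_mem (h1 a b) (h1' a b), fun u => ?_, fun g u => ?_⟩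
    · rw [Pi.add_apply, Matrix.trace_add, h2, h2', add_zero]
    · rw [Pi.add_apply, Pi.add_apply, map_add, h3, h3']
  zero_mem' := ⟨fun _ _ => E.galoisHom.zero_mem, fun _ => Matrix.trace_zero _ _,
    fun _ _ => map_zero _⟩
  smul_mem' := by
    rintro a t ⟨h1, h2, h3⟩
    refine ⟨fun i j => E.galoisHom.smul_mem a (h1 i j), fun u => ?_, fun g u => ?_⟩
    · rw [Pi.smul_apply, Matrix.trace_smul, h2, smul_zero]
    · rw [Pi.smul_apply, Pi.smul_apply, map_smul, h3]

/-- The element `∑_{g ∈ G} ρ(g) X ρ(g)⁻¹ L_{i,g}`. -/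
def orbit (i : Fin E.d) (X : Mat p) : E.MatFun :=
  fun u => ∑ g : E.G, E.L i g.1 u • E.Ad g X

/-- Homogeneous linear polynomials `ℋ_i(X, Y)`, given as linear forms in `(X, Y)`. -/
abbrev LinForms : Type := Fin E.d → ((Fin 2 → PadicAlgCl p) →ₗ[PadicAlgCl p] PadicAlgCl p)

/-- The matrices `A_i`. -/
def matA (a b : PadicAlgCl p) : Mat p := !![a, b; 0, -a]

/-- The matrices `B_i`. -/
def matB (a b : PadicAlgCl p) : Mat p := !![a, 0; b, -a]

/-- The matrices `C_i`. -/
def matC (ℓ : (Fin 2 → PadicAlgCl p) →ₗ[PadicAlgCl p] PadicAlgCl p) (a b : PadicAlgCl p) : Mat p :=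
  !![ℓ ![b, a], b; a, -ℓ ![b, a]]

open Classical in
/-- The element of `W` with parameters `a_i`, `b_i`. -/
def elt (ℋ : E.LinForms) (a b : Fin E.d → PadicAlgCl p) : E.MatFun :=
  (∑ i with i ∈ E.I₁, E.orbit i (matA (a i) (b i))) +
  (∑ i with i ∈ E.I₂, E.orbit i (matB (a i) (b i))) +
  (∑ i with i ∈ E.I₃, E.orbit i (matC (ℋ i) (a i) (b i)))

theorem orbit_add (i : Fin E.d) (X Y : Mat p) :
    E.orbit i (X + Y) = E.orbit i X + E.orbit i Y := by
  funext u
  simp only [orbit, map_add, smul_add, Finset.sum_add_distrib, Pi.add_apply]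

theorem orbit_smul (i : Fin E.d) (c : PadicAlgCl p) (X : Mat p) :
    E.orbit i (c • X) = c • E.orbit i X := by
  funext u
  simp only [orbit, map_smul, Pi.smul_apply, Finset.smul_sum, smul_comm c]

theorem matA_add (a b a' b' : PadicAlgCl p) :
    matA (a + a') (b + b') = matA a b + matA a' b' := by
  ext i j; fin_cases i <;> fin_cases j <;> simp [matA, add_comm]

theorem matB_add (a b a' b' : PadicAlgCl p) :
    matB (a + a') (b + b') = matB a b + matB a' b' := by
  ext i j; fin_cases i <;> fin_cases j <;> simp [matB, add_comm]

theorem pair_add (a b a' b' : PadicAlgCl p) : ![b + b', a + a'] = ![b, a] + ![b', a'] := by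
  ext i; fin_cases i <;> simp

theorem pair_smul (c a b : PadicAlgCl p) : ![c * b, c * a] = c • ![b, a] := by
  ext i; fin_cases i <;> simp

theorem matC_add (ℓ : (Fin 2 → PadicAlgCl p) →ₗ[PadicAlgCl p] PadicAlgCl p)
    (a b a' b' : PadicAlgCl p) :
    matC ℓ (a + a') (b + b') = matC ℓ a b + matC ℓ a' b' := by
  have key : ℓ ![b + b', a + a'] = ℓ ![b, a] + ℓ ![b', a'] := by rw [pair_add, map_add]
  unfold matC
  rw [key]
  ext i j
  fin_cases i <;> fin_cases j <;> simp [add_comm]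

theorem matA_smul (c a b : PadicAlgCl p) : matA (c * a) (c * b) = c • matA a b := by
  ext i j; fin_cases i <;> fin_cases j <;> simp [matA]

theorem matB_smul (c a b : PadicAlgCl p) : matB (c * a) (c * b) = c • matB a b := by
  ext i j; fin_cases i <;> fin_cases j <;> simp [matB]

theorem matC_smul (ℓ : (Fin 2 → PadicAlgCl p) →ₗ[PadicAlgCl p] PadicAlgCl p)
    (c a b : PadicAlgCl p) : matC ℓ (c * a) (c * b) = c • matC ℓ a b := by
  have key : ℓ ![c * b, c * a] = c • ℓ ![b, a] := by rw [pair_smul, map_smul]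
  unfold matC
  rw [key]
  ext i j
  fin_cases i <;> fin_cases j <;> simp

theorem elt_add (ℋ : E.LinForms) (a b a' b' : Fin E.d → PadicAlgCl p) :
    E.elt ℋ (a + a') (b + b') = E.elt ℋ a b + E.elt ℋ a' b' := by
  simp only [elt, Pi.add_apply, matA_add, matB_add, matC_add, orbit_add, Finset.sum_add_distrib]
  abel

theorem elt_smul (ℋ : E.LinForms) (c : PadicAlgCl p) (a b : Fin E.d → PadicAlgCl p) :
    E.elt ℋ (c • a) (c • b) = c • E.elt ℋ a b := by
  simp only [elt, Pi.smul_apply, smul_eq_mul, matA_smul, matB_smul, matC_smul, orbit_smul,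
    smul_add, Finset.smul_sum]

/-- The space `W` of all elements with parameters `a_i`, `b_i`. -/
def W (ℋ : E.LinForms) : Submodule (PadicAlgCl p) E.MatFun where
  carrier := {t | ∃ a b, t = E.elt ℋ a b}
  add_mem' := by
    rintro _ _ ⟨a, b, rfl⟩ ⟨a', b', rfl⟩
    exact ⟨a + a', b + b', (E.elt_add ℋ a b a' b').symm⟩
  zero_mem' := ⟨0, 0, by simpa using (E.elt_smul ℋ 0 0 0).symm⟩
  smul_mem' := by
    rintro c _ ⟨a, b, rfl⟩
    exact ⟨c • a, c • b, (E.elt_smul ℋ c a b).symm⟩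

/-- The space `V = W ∩ (Hom(G_H, ℚbar_p) ⊗ ad⁰ρ)^G`. -/
def V (ℋ : E.LinForms) : Submodule (PadicAlgCl p) E.MatFun := E.W ℋ ⊓ E.invariants

/-- The matrices `A_i`, `B_i` and `C_i` with parameters `a`, `b` are diagonal. -/
def AllDiag (ℋ : E.LinForms) (a b : Fin E.d → PadicAlgCl p) : Prop :=
  (∀ i ∈ E.I₁, (matA (a i) (b i)).IsDiag) ∧ (∀ i ∈ E.I₂, (matB (a i) (b i)).IsDiag) ∧
    ∀ i ∈ E.I₃, (matC (ℋ i) (a i) (b i)).IsDiag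

/-- The subspace `V₁` of the elements of `V` for which the matrices `A_i`, `B_i` and `C_i` are
diagonal. -/
def V₁ (ℋ : E.LinForms) : Submodule (PadicAlgCl p) E.MatFun where
  carrier := {t | t ∈ E.V ℋ ∧ ∃ a b, t = E.elt ℋ a b ∧ E.AllDiag ℋ a b}
  add_mem' := by
    rintro _ _ ⟨hV, a, b, rfl, h1, h2, h3⟩ ⟨hV', a', b', rfl, h1', h2', h3'⟩
    refine ⟨(E.V ℋ).add_mem hV hV', a + a', b + b', (E.elt_add ℋ a b a' b').symm,
      fun i hi => ?_, fun i hi => ?_, fun i hi => ?_⟩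
    · simpa only [Pi.add_apply, matA_add] using (h1 i hi).add (h1' i hi)
    · simpa only [Pi.add_apply, matB_add] using (h2 i hi).add (h2' i hi)
    · simpa only [Pi.add_apply, matC_add] using (h3 i hi).add (h3' i hi)
  zero_mem' := by
    refine ⟨(E.V ℋ).zero_mem, 0, 0, by simpa using (E.elt_smul ℋ 0 0 0).symm,
      fun i _ => ?_, fun i _ => ?_, fun i _ => ?_⟩
    · intro r s hrs
      fin_cases r <;> fin_cases s <;> simp_all [matA]
    · intro r s hrs
      fin_cases r <;> fin_cases s <;> simp_all [matB]
    · intro r s hrs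
      fin_cases r <;> fin_cases s <;> simp_all [matC]
  smul_mem' := by
    rintro c _ ⟨hV, a, b, rfl, h1, h2, h3⟩
    refine ⟨(E.V ℋ).smul_mem c hV, c • a, c • b, (E.elt_smul ℋ c a b).symm,
      fun i hi => ?_, fun i hi => ?_, fun i hi => ?_⟩
    · simpa only [Pi.smul_apply, smul_eq_mul, matA_smul] using (h1 i hi).smul c
    · simpa only [Pi.smul_apply, smul_eq_mul, matB_smul] using (h2 i hi).smul c
    · simpa only [Pi.smul_apply, smul_eq_mul, matC_smul] using (h3 i hi).smul c

/-! ### The matrix of logarithms of units and the elements `t_j` -/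

open Classical in
/-- The element `σ^{δ(i)}` of `Gal(H/ℚ)`, where `δ(i) = 1` if `i ∈ I₂` and `δ(i) = 0` otherwise. -/
def σδ (i : Fin E.d) : E.GalH := if i ∈ E.I₂ then E.σH else 1

/-- The sum `∑_{c ∈ C} (χ/χ^σ)(c) L_{i, c ∘ s}(u)`. -/
def psiLog (i : Fin E.d) (s : E.GalH) (u : (𝓞 E.H)ˣ) : PadicAlgCl p :=
  ∑ c : E.C, E.ι (E.psi c) * E.L i (c.1.1 * s) (E.diag u)

/-- The matrix `A`, with entries `∑_{c ∈ C} (χ/χ^σ)(c) L_{i, c ∘ σ^{δ(i)}}(u_k)`. -/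
def unitLogMatrix (u : Fin E.d → (𝓞 E.H)ˣ) : Matrix (Fin E.d) (Fin E.d) (PadicAlgCl p) :=
  Matrix.of fun k i => E.psiLog i (E.σδ i) (u k)

/-- For each `j ∈ I₃`, the column `(b_{i,j})_i` solves the linear system
`A (b_{i,j})_i = - (∑_{c ∈ C} (χ/χ^σ)(c) L_{j, c ∘ σ}(u_k))_k`. -/
def IsSolution (u : Fin E.d → (𝓞 E.H)ˣ) (b : Fin E.d → Fin E.d → PadicAlgCl p) : Prop :=
  ∀ j ∈ E.I₃, (E.unitLogMatrix u).mulVec (fun i => b i j) = fun k => -E.psiLog j E.σH (u k)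

open Classical in
/-- The elements `t_j`. For `j ∈ I₃`, this is the element of `W` whose parameters are `a_j = 1`,
`a_i = 0` for `i ≠ j`, and `b_i = b_{i,j}`; for the other `j` it is
`∑_{g ∈ G} ρ(g) diag(1, -1) ρ(g)⁻¹ L_{j,g}`. -/
def t (ℋ : E.LinForms) (b : Fin E.d → Fin E.d → PadicAlgCl p) (j : Fin E.d) : E.MatFun :=
  if j ∈ E.I₃ then E.elt ℋ (Pi.single j 1) (fun i => b i j)
  else E.orbit j !![1, 0; 0, -1]

/-- The space `V₂`, spanned by the `t_j` with `j ∈ I₃`. -/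
def V₂ (ℋ : E.LinForms) (b : Fin E.d → Fin E.d → PadicAlgCl p) :
    Submodule (PadicAlgCl p) E.MatFun :=
  Submodule.span (PadicAlgCl p) (E.t ℋ b '' E.I₃)

end CMPoint

end HilbertCM

end

noncomputable section

namespace HilbertCM

open Filter Topology

section LogTheory

variable {p : ℕ} [Fact p.Prime]

/-! ### The `p`-adic logarithm -/

/-! Two facts carry the proof: membership in V is a linear system with matrix A, and A is
invertible.

The functions L_{i,g} are linearly independent over ℚ̄_p (`eq_zero_of_sum_L`), so t(a,b) determines
the matrices X_i, and in particular a. Every t(a,b) is trace free and G-equivariant by construction.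
It therefore lies in V exactly when its entries come from continuous homomorphisms on the idele
class group, and this holds exactly when they vanish on global units. In one direction, such a
homomorphism into ℚ̄_p kills the archimedean ideles and the part of a unit away from p
(`apply_diag_of_mem_galoisHom`). In the other, a sum of logarithms that kills global units extends,
because ℚ̄_p is divisible (`sum_L_mem_galoisHom`). On global units the diagonal entries vanish
automatically, since complex conjugation exchanges the two cosets of C in G. The two off-diagonal
entries are exchanged by σ. What remains is one equation per unit (`total_mem_invariants_iff`),
which depends only on the projection of the unit to the ψ-isotypical component. Testing it on u_1,
…, u_d gives A b = -∑_{j ∈ I₃} a_j (∑_c ψ(c) L_{j,cσ}(u_k))_k (`elt_mem_V_iff`).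

The entries of A are ℚ̄-linear forms in the p-adic logarithms of a fundamental system of units.
These logarithms are linearly independent over ℚ, hence algebraically independent by the Schanuel
conjecture. So det A ≠ 0 follows once the same determinant is nonzero at a single specialisation of
the variables, and the archimedean logarithms provide one (`det_padicPsi_ne_zero`). There
invertibility is Dirichlet's unit theorem: up to complex conjugation and translation by C, the d
elements h_i represent all embeddings of H (`row_eq_zero`). The same archimedean matrix shows that
the ψ-component has dimension d (`exists_isUnitBasis`).

Once A is invertible, V is the graph of a linear map a ↦ b. The t_j are the points of this graph
over the unit vectors e_j, hence a basis. A matrix C_j is diagonal only if a_j = 0, so V₁ is spanned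
by the t_j with j ∉ I₃ and is complementary to V₂. -/

theorem norm_natCast_inv_le (k : ℕ) (hk : k ≠ 0) : ‖(k : PadicAlgCl p)‖⁻¹ ≤ k := by
  have hp : p.Prime := Fact.out
  have h0 : (k : ℚ_[p]) ≠ 0 := by exact_mod_cast hk
  have h1 : ‖(k : PadicAlgCl p)‖ = ‖(k : ℚ_[p])‖ := by
    rw [← PadicAlgCl.norm_extends]
    simp
  rw [h1, Padic.norm_eq_zpow_neg_valuation h0, Padic.valuation_natCast, zpow_neg, inv_inv,
    zpow_natCast]
  exact_mod_cast Nat.le_of_dvd (Nat.pos_of_ne_zero hk) pow_padicValNat_dvd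

theorem norm_natCast_le_one (k : ℕ) : ‖(k : PadicAlgCl p)‖ ≤ 1 :=
  IsUltrametricDist.norm_natCast_le_one _ k

theorem norm_prime : ‖(p : PadicAlgCl p)‖ = (p : ℝ)⁻¹ := by
  have h1 : ‖(p : PadicAlgCl p)‖ = ‖(p : ℚ_[p])‖ := by
    rw [← PadicAlgCl.norm_extends]
    simp
  rw [h1, Padic.norm_p]

theorem norm_prime_lt_one : ‖(p : PadicAlgCl p)‖ < 1 := by
  rw [norm_prime]
  exact inv_lt_one_of_one_lt₀ (by exact_mod_cast (Fact.out : p.Prime).one_lt)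

theorem prime_ne_zero' : (p : PadicAlgCl p) ≠ 0 :=
  Nat.cast_ne_zero.mpr (Fact.out : p.Prime).ne_zero

theorem norm_eq_one_of_coprime {m : ℕ} (hm : ¬ p ∣ m) : ‖(m : PadicAlgCl p)‖ = 1 := by
  have h1 : ‖(m : PadicAlgCl p)‖ = ‖(m : ℚ_[p])‖ := by
    rw [← PadicAlgCl.norm_extends]
    simp
  rw [h1]
  exact Padic.norm_natCast_eq_one_iff.mpr ((Nat.Prime.coprime_iff_not_dvd Fact.out).mpr hm)

theorem norm_eq_one_of_norm_sub_one_lt {y : PadicAlgCl p} (hy : ‖y - 1‖ < 1) : ‖y‖ = 1 := by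
  have := IsUltrametricDist.norm_add_eq_max_of_norm_ne_norm (x := y - 1) (y := 1)
    (by rw [norm_one]; exact hy.ne)
  rw [sub_add_cancel, norm_one, max_eq_right hy.le] at this
  exact this

theorem norm_mul_sub_one_lt {x y : PadicAlgCl p} (hx : ‖x - 1‖ < 1) (hy : ‖y - 1‖ < 1) :
    ‖x * y - 1‖ < 1 := by
  have h : x * y - 1 = x * (y - 1) + (x - 1) := by ring
  rw [h]
  refine (IsUltrametricDist.norm_add_le_max _ _).trans_lt (max_lt ?_ hx)
  rw [norm_mul, norm_eq_one_of_norm_sub_one_lt hx, one_mul]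
  exact hy

theorem norm_pow_sub_one_lt {x : PadicAlgCl p} (hx : ‖x - 1‖ < 1) (n : ℕ) :
    ‖x ^ n - 1‖ < 1 := by
  induction n with
  | zero => simp
  | succ n ih => rw [pow_succ]; exact norm_mul_sub_one_lt ih hx

/-- A sequence of elements of a finite extension of `ℚ_[p]` with a summable bound is summable
and dominated convergence holds. -/
theorem tendsto_tsum_of_mem {L : IntermediateField ℚ_[p] (PadicAlgCl p)}
    [FiniteDimensional ℚ_[p] L] {f : ℕ → ℕ → PadicAlgCl p} {g : ℕ → PadicAlgCl p} {bound : ℕ → ℝ}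
    (hf : ∀ n k, f n k ∈ L) (hg : ∀ k, g k ∈ L) (hb : Summable bound)
    (hfg : ∀ k, Tendsto (fun n => f n k) atTop (𝓝 (g k)))
    (h : ∀ n k, ‖f n k‖ ≤ bound k) :
    Summable g ∧ Tendsto (fun n => ∑' k, f n k) atTop (𝓝 (∑' k, g k)) := by
  -- The field `PadicAlgCl p` is not complete. Summation takes place in the finite extension `L` of
  -- ℚ_p, which is.
  have : CompleteSpace L := FiniteDimensional.complete ℚ_[p] L
  let f' : ℕ → ℕ → L := fun n k => ⟨f n k, hf n k⟩
  let g' : ℕ → L := fun k => ⟨g k, hg k⟩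
  have hfg' : ∀ k, Tendsto (fun n => f' n k) atTop (𝓝 (g' k)) := fun k =>
    tendsto_subtype_rng.mpr (hfg k)
  have hgb : ∀ k, ‖g k‖ ≤ bound k := fun k =>
    le_of_tendsto (hfg k).norm (Eventually.of_forall fun n => h n k)
  have hsg : Summable g' := Summable.of_norm_bounded hb hgb
  have hsf : ∀ n, Summable (f' n) := fun n => Summable.of_norm_bounded hb (h n)
  have key := tendsto_tsum_of_dominated_convergence hb hfg' (Eventually.of_forall fun n k => h n k)
  have hc : Continuous (L.val : L → PadicAlgCl p) := continuous_subtype_val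
  have hmap : ∀ {s : ℕ → L}, Summable s →
      HasSum (fun k => (s k : PadicAlgCl p)) ((∑' k, s k : L) : PadicAlgCl p) := fun hs =>
    hs.hasSum.map L.val hc
  refine ⟨(hmap hsg).summable, ?_⟩
  have e1 : ∑' k, g k = ((∑' k, g' k : L) : PadicAlgCl p) := (hmap hsg).tsum_eq
  have e2 : ∀ n, ∑' k, f n k = ((∑' k, f' n k : L) : PadicAlgCl p) := fun n =>
    (hmap (hsf n)).tsum_eq
  simp_rw [e1, e2]
  exact (hc.tendsto _).comp key

theorem tendsto_prime_pow : Tendsto (fun n : ℕ => ((p : PadicAlgCl p) ^ n)) atTop (𝓝 0) :=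
  tendsto_pow_atTop_nhds_zero_of_norm_lt_one norm_prime_lt_one

/-- Pascal's rule gives C(p^n-1, k+1) = C(p^n, k+1) - C(p^n-1, k), and C(p^n, k+1) = p^n/(k+1) ·
C(p^n-1, k) tends to 0 p-adically. Each step thus changes the sign of the limit. -/
theorem tendsto_choose (k : ℕ) :
    Tendsto (fun n : ℕ => (((p ^ n - 1).choose k : ℕ) : PadicAlgCl p)) atTop (𝓝 ((-1) ^ k)) := by
  induction k with
  | zero => simp
  | succ k ih =>
    have hp : p.Prime := Fact.out
    have h1 : ∀ n : ℕ, (((p ^ n - 1).choose (k + 1) : ℕ) : PadicAlgCl p) =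
        (p : PadicAlgCl p) ^ n * ((((p ^ n - 1).choose k : ℕ) : PadicAlgCl p) / (k + 1)) -
          (((p ^ n - 1).choose k : ℕ) : PadicAlgCl p) := by
      intro n
      obtain ⟨N, hN⟩ : ∃ N, p ^ n = N + 1 :=
        ⟨p ^ n - 1, (Nat.sub_add_cancel (Nat.one_le_pow _ _ hp.pos)).symm⟩
      have h2 := Nat.add_one_mul_choose_eq N k
      have h3 := Nat.choose_succ_succ N k
      have hk : ((k : PadicAlgCl p) + 1) ≠ 0 := by exact_mod_cast Nat.succ_ne_zero k
      have h4 : (p : PadicAlgCl p) ^ n = (N : PadicAlgCl p) + 1 := by exact_mod_cast hN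
      rw [h4, hN, Nat.add_sub_cancel, eq_sub_iff_add_eq, ← mul_div_assoc, eq_div_iff hk]
      have h5 : ((N : PadicAlgCl p) + 1) * (N.choose k : PadicAlgCl p) =
        ((N + 1).choose (k + 1) : PadicAlgCl p) * ((k : PadicAlgCl p) + 1) := by exact_mod_cast h2
      rw [h5, h3]
      push_cast
      ring
    simp_rw [h1]
    have := (tendsto_prime_pow (p := p)).mul (ih.div_const ((k : PadicAlgCl p) + 1)) |>.sub ih
    convert this using 2
    rw [zero_mul, zero_sub, pow_succ, mul_neg_one]

theorem summable_bound {r : ℝ} (h0 : 0 ≤ r) (h1 : r < 1) :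
    Summable fun k : ℕ => ((k + 1 : ℕ) : ℝ) * r ^ (k + 1) := by
  have h := summable_pow_mul_geometric_of_norm_lt_one 1 (r := r)
    (by rwa [Real.norm_of_nonneg h0])
  simpa using (summable_nat_add_iff (f := fun n : ℕ => (n : ℝ) ^ 1 * r ^ n) 1).mpr h

/-- The binomial theorem writes (y^(p^n) - 1)/p^n as ∑ C(p^n-1, k) (y-1)^(k+1)/(k+1), which tends
termwise to the Mercator series. The majorant (k+1)‖y-1‖^(k+1) is uniform in n because ‖k+1‖⁻¹ ≤
k+1. The description as a limit makes the functional equation elementary. -/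
theorem logSeries_spec {y : PadicAlgCl p} (hy : ‖y - 1‖ < 1) :
    (Summable fun k : ℕ => (-1) ^ k * (y - 1) ^ (k + 1) / ((k : PadicAlgCl p) + 1)) ∧
    Tendsto (fun n : ℕ => (y ^ (p ^ n) - 1) / (p : PadicAlgCl p) ^ n) atTop
      (𝓝 (logSeries p y)) := by
  have hp : p.Prime := Fact.out
  let L := IntermediateField.adjoin ℚ_[p] {y}
  have : FiniteDimensional ℚ_[p] L := IntermediateField.adjoin.finiteDimensional
    (Algebra.IsIntegral.isIntegral y)
  have hyL : y ∈ L := IntermediateField.mem_adjoin_simple_self _ y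
  have hL : y - 1 ∈ L := sub_mem hyL (one_mem L)
  have h := tendsto_tsum_of_mem (L := L)
    (f := fun n k => (((p ^ n - 1).choose k : ℕ) : PadicAlgCl p) * (y - 1) ^ (k + 1) /
      ((k : PadicAlgCl p) + 1))
    (g := fun k => (-1) ^ k * (y - 1) ^ (k + 1) / ((k : PadicAlgCl p) + 1))
    (bound := fun k => ((k + 1 : ℕ) : ℝ) * ‖y - 1‖ ^ (k + 1))
    (fun n k => div_mem (mul_mem (natCast_mem L _) (pow_mem hL _))
      (add_mem (natCast_mem L _) (one_mem L)))
    (fun k => div_mem (mul_mem (pow_mem (neg_mem (one_mem L)) _) (pow_mem hL _))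
      (add_mem (natCast_mem L _) (one_mem L)))
    (summable_bound (norm_nonneg _) hy)
    (fun k => ((tendsto_choose k).mul_const _).div_const _)
    (fun n k => by
      rw [norm_div, norm_mul, norm_pow, div_eq_mul_inv, mul_comm]
      have h1 := norm_natCast_inv_le (p := p) (k + 1) (Nat.succ_ne_zero k)
      rw [Nat.cast_add, Nat.cast_one] at h1
      refine mul_le_mul h1 ?_ (by positivity) (by positivity)
      exact mul_le_of_le_one_left (by positivity) (norm_natCast_le_one _))
  refine ⟨h.1, ?_⟩
  have h2 := h.2
  refine h2.congr fun n => ?_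
  obtain ⟨N, hN⟩ : ∃ N, p ^ n = N + 1 :=
    ⟨p ^ n - 1, (Nat.sub_add_cancel (Nat.one_le_pow _ _ hp.pos)).symm⟩
  have h4 : (p : PadicAlgCl p) ^ n = (N : PadicAlgCl p) + 1 := by exact_mod_cast hN
  have hN0 : ((N : PadicAlgCl p) + 1) ≠ 0 := by exact_mod_cast Nat.succ_ne_zero N
  rw [h4, hN, Nat.add_sub_cancel, tsum_eq_sum (s := Finset.range (N + 1))]
  · rw [eq_div_iff hN0, Finset.sum_mul]
    have hexp : y ^ (N + 1) = ∑ m ∈ Finset.range (N + 1 + 1),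
        (y - 1) ^ m * ((N + 1).choose m : PadicAlgCl p) := by
      conv_lhs => rw [← sub_add_cancel y 1, add_pow]
      simp
    rw [hexp, Finset.sum_range_succ' _ (N + 1)]
    simp only [pow_zero, Nat.choose_zero_right, Nat.cast_one, mul_one, add_sub_cancel_right]
    refine Finset.sum_congr rfl fun k _ => ?_
    have hk : ((k : PadicAlgCl p) + 1) ≠ 0 := by exact_mod_cast Nat.succ_ne_zero k
    have h5 : ((N : PadicAlgCl p) + 1) * (N.choose k : PadicAlgCl p) =
        ((N + 1).choose (k + 1) : PadicAlgCl p) * ((k : PadicAlgCl p) + 1) := by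
      exact_mod_cast Nat.add_one_mul_choose_eq N k
    rw [div_mul_eq_mul_div, div_eq_iff hk]
    linear_combination (y - 1) ^ (k + 1) * h5
  · intro k hk
    rw [Nat.choose_eq_zero_of_lt (by simpa using hk)]
    simp

theorem norm_sub_le_max' (x y : PadicAlgCl p) : ‖x - y‖ ≤ max ‖x‖ ‖y‖ := by
  rw [sub_eq_add_neg, ← norm_neg y]
  exact IsUltrametricDist.norm_add_le_max _ _

/-- With q = p^n, xy-powers satisfy (xy)^q - 1 = (x^q - 1) + (y^q - 1) + (x^q - 1)(y^q - 1). After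
division by q the last term is p^n times a product of convergent sequences. -/
theorem logSeries_mul {x y : PadicAlgCl p} (hx : ‖x - 1‖ < 1) (hy : ‖y - 1‖ < 1) :
    logSeries p (x * y) = logSeries p x + logSeries p y := by
  have h1 := (logSeries_spec hx).2
  have h2 := (logSeries_spec hy).2
  have h3 := (logSeries_spec (norm_mul_sub_one_lt hx hy)).2
  refine tendsto_nhds_unique h3 ?_
  have h4 := (h1.add h2).add ((tendsto_prime_pow (p := p)).mul (h1.mul h2))
  rw [zero_mul, add_zero] at h4
  refine h4.congr fun n => ?_
  have : (p : PadicAlgCl p) ^ n ≠ 0 := pow_ne_zero _ prime_ne_zero'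
  field_simp
  ring

theorem logSeries_one : logSeries p (1 : PadicAlgCl p) = 0 := by
  simp [logSeries]

theorem logSeries_pow {x : PadicAlgCl p} (hx : ‖x - 1‖ < 1) (n : ℕ) :
    logSeries p (x ^ n) = n * logSeries p x := by
  induction n with
  | zero => simp [logSeries_one]
  | succ n ih =>
    rw [pow_succ, logSeries_mul (norm_pow_sub_one_lt hx n) hx, ih]
    push_cast
    ring

/-- By the ultrametric inequality each later term is bounded separately by (k+2)·4^(-k)·‖y-1‖², and
(k+2)·4^(-k) ≤ 2 for all k ≥ 0. The radius 1/4 also makes 2r² < r for 0 < r ≤ 1/4, so the linear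
term dominates and 1 is the only zero of the logarithm in this ball. -/
theorem norm_logSeries_sub_le {y : PadicAlgCl p} (hy : ‖y - 1‖ ≤ 1 / 4) :
    ‖logSeries p y - (y - 1)‖ ≤ 2 * ‖y - 1‖ ^ 2 := by
  have hs := (logSeries_spec (y := y) (by linarith)).1
  have h1 := hs.hasSum
  have h2 := (hasSum_nat_add_iff' 1).mpr h1
  simp only [Finset.range_one, Finset.sum_singleton, pow_zero, zero_add, pow_one, one_mul,
    Nat.cast_zero, div_one] at h2
  have h3 : ‖∑' k : ℕ, (-1) ^ (k + 1) * (y - 1) ^ (k + 1 + 1) /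
      (((k + 1 : ℕ) : PadicAlgCl p) + 1)‖ ≤ 2 * ‖y - 1‖ ^ 2 := by
    refine IsUltrametricDist.norm_tsum_le_of_forall_le_of_nonneg (by positivity) fun k => ?_
    rw [norm_div, norm_mul, norm_pow, norm_pow, norm_neg, norm_one, one_pow, one_mul]
    have h4 := norm_natCast_inv_le (p := p) (k + 1 + 1) (Nat.succ_ne_zero _)
    rw [Nat.cast_add, Nat.cast_one] at h4
    rw [div_eq_mul_inv]
    have h5 : ‖y - 1‖ ^ k ≤ (1 / 4) ^ k := pow_le_pow_left₀ (norm_nonneg _) hy k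
    have h6 : (((k + 1 + 1 : ℕ) : ℝ)) * (1 / 4) ^ k ≤ 2 := by
      induction k with
      | zero => norm_num
      | succ k ih =>
        have h7 : (1 / 4 : ℝ) ^ k ≤ 1 := pow_le_one₀ (by norm_num) (by norm_num)
        have h8 : (0 : ℝ) ≤ (1 / 4 : ℝ) ^ k := by positivity
        have h9 := ih (norm_natCast_inv_le (p := p) (k + 1 + 1) (Nat.succ_ne_zero _) |>.trans_eq'
          (by push_cast; rfl)) (pow_le_pow_left₀ (norm_nonneg _) hy k)
        push_cast at h9 ⊢
        rw [pow_succ]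
        nlinarith [mul_nonneg h8 (Nat.cast_nonneg (α := ℝ) k)]
    calc ‖y - 1‖ ^ (k + 1 + 1) * ‖((k + 1 : ℕ) : PadicAlgCl p) + 1‖⁻¹
        ≤ ‖y - 1‖ ^ (k + 1 + 1) * ((k + 1 : ℕ) + 1 : ℝ) := by
          gcongr
          exact_mod_cast h4
      _ = ‖y - 1‖ ^ 2 * (‖y - 1‖ ^ k * ((k + 1 : ℕ) + 1 : ℝ)) := by ring
      _ ≤ ‖y - 1‖ ^ 2 * ((1 / 4) ^ k * ((k + 1 : ℕ) + 1 : ℝ)) := by gcongr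
      _ ≤ ‖y - 1‖ ^ 2 * 2 := by
          gcongr
          rw [mul_comm]
          exact_mod_cast h6
      _ = 2 * ‖y - 1‖ ^ 2 := by ring
  rw [h2.tsum_eq] at h3
  exact h3

theorem norm_logSeries_le {y : PadicAlgCl p} (hy : ‖y - 1‖ ≤ 1 / 4) :
    ‖logSeries p y‖ ≤ ‖y - 1‖ := by
  have h1 := norm_logSeries_sub_le hy
  have h2 : 2 * ‖y - 1‖ ^ 2 ≤ ‖y - 1‖ := by nlinarith [norm_nonneg (y - 1)]
  calc ‖logSeries p y‖ = ‖(logSeries p y - (y - 1)) + (y - 1)‖ := by rw [sub_add_cancel]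
    _ ≤ max _ _ := IsUltrametricDist.norm_add_le_max _ _
    _ ≤ ‖y - 1‖ := max_le (h1.trans h2) le_rfl

theorem eq_one_of_logSeries_eq_zero {y : PadicAlgCl p} (hy : ‖y - 1‖ ≤ 1 / 4)
    (h : logSeries p y = 0) : y = 1 := by
  have h1 := norm_logSeries_sub_le hy
  rw [h, zero_sub, norm_neg] at h1
  by_contra hne
  have h2 : 0 < ‖y - 1‖ := norm_pos_iff.mpr (sub_ne_zero.mpr hne)
  nlinarith

theorem tendsto_pow_prime_pow {y : PadicAlgCl p} (hy : ‖y - 1‖ < 1) :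
    Tendsto (fun n : ℕ => y ^ (p ^ n)) atTop (𝓝 1) := by
  have h := ((tendsto_prime_pow (p := p)).mul (logSeries_spec hy).2).add_const 1
  rw [zero_mul, zero_add] at h
  refine h.congr fun n => ?_
  rw [mul_div_cancel₀ _ (pow_ne_zero _ prime_ne_zero'), sub_add_cancel]

/-- The powers y^(p^n) tend to 1, so one of them enters the ball of radius 1/4, where the logarithm
vanishes only at 1. -/
theorem exists_pow_eq_one_of_logSeries {y : PadicAlgCl p} (hy : ‖y - 1‖ < 1)
    (h : logSeries p y = 0) : ∃ n : ℕ, 0 < n ∧ y ^ n = 1 := by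
  have h1 := (tendsto_pow_prime_pow hy).sub_const 1 |>.norm
  rw [sub_self, norm_zero] at h1
  obtain ⟨n, hn⟩ := (h1.eventually (gt_mem_nhds (by norm_num : (0 : ℝ) < 1 / 4))).exists
  refine ⟨p ^ n, pow_pos (Fact.out : p.Prime).pos n, eq_one_of_logSeries_eq_zero hn.le ?_⟩
  rw [logSeries_pow hy, h, mul_zero]

/-- The powers of x stay on the unit sphere of a finite, hence locally compact, extension of ℚ_p.
Two of them are therefore at distance less than 1, and the difference of the exponents serves as n.
-/
theorem exists_pow_sub_one_lt {x : PadicAlgCl p} (hx : ‖x‖ = 1) :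
    ∃ n : ℕ, 0 < n ∧ ‖x ^ n - 1‖ < 1 := by
  let L := IntermediateField.adjoin ℚ_[p] {x}
  have : FiniteDimensional ℚ_[p] L := IntermediateField.adjoin.finiteDimensional
    (Algebra.IsIntegral.isIntegral x)
  have : ProperSpace L := FiniteDimensional.proper ℚ_[p] L
  let x' : L := ⟨x, IntermediateField.mem_adjoin_simple_self _ x⟩
  have hx' : ∀ n, ‖x' ^ n‖ = 1 := fun n => by
    rw [norm_pow]
    exact (congrArg (· ^ n) hx).trans (one_pow n)
  obtain ⟨a, -, φ, hφ, ha⟩ := tendsto_subseq_of_bounded (Metric.isBounded_closedBall (x := (0 : L))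
    (r := 1)) (x := fun n => x' ^ n) (fun n => by simp [hx' n])
  obtain ⟨N, hN⟩ := Metric.cauchySeq_iff'.mp ha.cauchySeq 1 one_pos
  have h1 := hN (N + 1) (Nat.le_succ N)
  have hlt : φ N < φ (N + 1) := hφ (Nat.lt_succ_self N)
  refine ⟨φ (N + 1) - φ N, Nat.sub_pos_of_lt hlt, ?_⟩
  have h2 : ‖x ^ φ (N + 1) - x ^ φ N‖ < 1 := by
    rw [dist_eq_norm] at h1
    exact h1
  have h3 : x ^ φ (N + 1) - x ^ φ N = x ^ φ N * (x ^ (φ (N + 1) - φ N) - 1) := by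
    rw [mul_sub, ← pow_add, Nat.add_sub_cancel' hlt.le, mul_one]
  rwa [h3, norm_mul, norm_pow, hx, one_pow, one_mul] at h2

/-- Norm one forces the chosen power of p in the definition to be p^0. Two admissible exponents m
and n are compared through x^(mn). -/
theorem padicLog_eq {x : PadicAlgCl p} (hx : ‖x‖ = 1) {n : ℕ} (hn : 0 < n)
    (h : ‖x ^ n - 1‖ < 1) : padicLog p x = logSeries p (x ^ n) / n := by
  have hex : ∃ nm : ℕ × ℤ, 0 < nm.1 ∧ ‖x ^ nm.1 / (p : PadicAlgCl p) ^ nm.2 - 1‖ < 1 :=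
    ⟨(n, 0), hn, by simpa using h⟩
  have hp1 : (1 : ℝ) < p := by exact_mod_cast (Fact.out : p.Prime).one_lt
  rw [padicLog, dif_pos hex]
  obtain ⟨h1, h2⟩ := hex.choose_spec
  set m := hex.choose.1
  have h3 := norm_eq_one_of_norm_sub_one_lt h2
  have h4 : hex.choose.2 = 0 := by
    rw [norm_div, norm_pow, hx, one_pow, norm_zpow, norm_prime, inv_zpow, one_div, inv_inv] at h3
    exact (zpow_eq_one_iff_right₀ (by linarith) hp1.ne').mp h3
  rw [h4, zpow_zero, div_one] at h2 ⊢
  have hm0 : (m : PadicAlgCl p) ≠ 0 := Nat.cast_ne_zero.mpr h1.ne'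
  have hn0 : (n : PadicAlgCl p) ≠ 0 := Nat.cast_ne_zero.mpr hn.ne'
  rw [div_eq_div_iff hm0 hn0, mul_comm, mul_comm (logSeries p (x ^ n)), ← logSeries_pow h2,
    ← logSeries_pow h, ← pow_mul, ← pow_mul, mul_comm]

theorem padicLog_eq_logSeries {x : PadicAlgCl p} (h : ‖x - 1‖ < 1) :
    padicLog p x = logSeries p x := by
  rw [padicLog_eq (norm_eq_one_of_norm_sub_one_lt h) one_pos (by rwa [pow_one]), pow_one,
    Nat.cast_one, div_one]

theorem padicLog_one : padicLog p 1 = 0 := by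
  rw [padicLog_eq_logSeries (by simp), logSeries_one]

theorem padicLog_mul {x y : PadicAlgCl p} (hx : ‖x‖ = 1) (hy : ‖y‖ = 1) :
    padicLog p (x * y) = padicLog p x + padicLog p y := by
  obtain ⟨n, hn, hxn⟩ := exists_pow_sub_one_lt hx
  obtain ⟨m, hm, hym⟩ := exists_pow_sub_one_lt hy
  have h1 : ‖x ^ (n * m) - 1‖ < 1 := by rw [pow_mul]; exact norm_pow_sub_one_lt hxn m
  have h2 : ‖y ^ (n * m) - 1‖ < 1 := by
    rw [mul_comm, pow_mul]; exact norm_pow_sub_one_lt hym n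
  have hnm := Nat.mul_pos hn hm
  rw [padicLog_eq hx hnm h1, padicLog_eq hy hnm h2,
    padicLog_eq (by rw [norm_mul, hx, hy, one_mul]) hnm
      (by rw [mul_pow]; exact norm_mul_sub_one_lt h1 h2), mul_pow, logSeries_mul h1 h2, add_div]

theorem exists_pow_eq_one_of_padicLog {x : PadicAlgCl p} (hx : ‖x‖ = 1) (h : padicLog p x = 0) :
    ∃ n : ℕ, 0 < n ∧ x ^ n = 1 := by
  obtain ⟨n, hn, hxn⟩ := exists_pow_sub_one_lt hx
  have hn0 : (n : PadicAlgCl p) ≠ 0 := Nat.cast_ne_zero.mpr hn.ne'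
  rw [padicLog_eq hx hn hxn, div_eq_zero_iff, or_iff_left hn0] at h
  obtain ⟨m, hm, hxm⟩ := exists_pow_eq_one_of_logSeries hxn h
  exact ⟨n * m, Nat.mul_pos hn hm, by rw [pow_mul, hxm]⟩

theorem norm_padicLog_le {y : PadicAlgCl p} (hy : ‖y - 1‖ ≤ 1 / 4) :
    ‖padicLog p y‖ ≤ ‖y - 1‖ := by
  rw [padicLog_eq_logSeries (by linarith)]
  exact norm_logSeries_le hy

/-- The derivative of the logarithm at `1` is `1`. -/
theorem tendsto_padicLog_one_add (y : PadicAlgCl p) :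
    Tendsto (fun k : ℕ => padicLog p (1 + (p : PadicAlgCl p) ^ k * y) / (p : PadicAlgCl p) ^ k)
      atTop (𝓝 y) := by
  have h0 : Tendsto (fun k : ℕ => (p : PadicAlgCl p) ^ k * y) atTop (𝓝 0) := by
    simpa using (tendsto_prime_pow (p := p)).mul_const y
  have h1 : ∀ᶠ k : ℕ in atTop, ‖(p : PadicAlgCl p) ^ k * y‖ < 1 / 4 := by
    have := h0.norm
    rw [norm_zero] at this
    exact this.eventually (gt_mem_nhds (by norm_num))
  rw [tendsto_iff_norm_sub_tendsto_zero]
  refine squeeze_zero' (Eventually.of_forall fun _ => norm_nonneg _)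
    (g := fun k : ℕ => 2 * ‖(p : PadicAlgCl p) ^ k * y‖ * ‖y‖) ?_ ?_
  · filter_upwards [h1] with k hk
    have hpk : (p : PadicAlgCl p) ^ k ≠ 0 := pow_ne_zero _ prime_ne_zero'
    have h2 := norm_logSeries_sub_le (y := 1 + (p : PadicAlgCl p) ^ k * y)
      (by rw [add_sub_cancel_left]; exact hk.le)
    rw [add_sub_cancel_left] at h2
    rw [padicLog_eq_logSeries (by rw [add_sub_cancel_left]; linarith)]
    have h3 : logSeries p (1 + (p : PadicAlgCl p) ^ k * y) / (p : PadicAlgCl p) ^ k - y =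
        (logSeries p (1 + (p : PadicAlgCl p) ^ k * y) - (p : PadicAlgCl p) ^ k * y) /
          (p : PadicAlgCl p) ^ k := by
      field_simp
    rw [h3, norm_div, div_le_iff₀ (norm_pos_iff.mpr hpk)]
    refine h2.trans_eq ?_
    rw [norm_mul]
    ring
  · simpa using (h0.norm.const_mul 2).mul_const ‖y‖

end LogTheory

end HilbertCM

namespace HilbertCM

namespace CMRep

variable (E : CMRep)

/-! ### The groups `G = Gal(H/F)` and `C = Gal(H/K)` -/

/-- An open subgroup is closed, so the Galois correspondence recovers `adKer` from its fixed field,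
which lies in H. This is what lets ψ and the adjoint action descend to Gal(H/F). -/
theorem H_fixingSubgroup_le_adKer : E.H.fixingSubgroup ≤ E.adKer := by
  have h1 : IsClosed (E.adKer : Set GalQ) := E.adKer.isClosed_of_isOpen E.adKer_isOpen
  have h2 := InfiniteGalois.fixingSubgroup_fixedField (k := ℚ) (K := Qbar) ⟨E.adKer, h1⟩
  refine le_trans ?_ h2.le
  exact IntermediateField.fixingSubgroup_le (IntermediateField.le_normalClosure _)

theorem coe_restrictNormalHom (g : GalQ) (x : E.H) :
    ((AlgEquiv.restrictNormalHom E.H g x : E.H) : Qbar) = g x :=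
  AlgEquiv.restrictNormal_commutes g E.H x

/-- The restriction of automorphisms to `H`. -/
def res : E.GF →* E.G where
  toFun g := ⟨AlgEquiv.restrictNormalHom E.H g.1, fun x hx => by
    apply Subtype.ext
    rw [coe_restrictNormalHom]
    exact (IntermediateField.mem_fixingSubgroup_iff _ _).mp g.2 _ hx⟩
  map_one' := by
    apply Subtype.ext
    exact map_one _
  map_mul' g h := by
    apply Subtype.ext
    exact map_mul (AlgEquiv.restrictNormalHom E.H) g.1 h.1

theorem coe_res (g : E.GF) (x : E.H) : (((E.res g).1 x : E.H) : Qbar) = g.1 x :=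
  E.coe_restrictNormalHom g.1 x

theorem lift_apply (g : E.G) (x : E.H) : (E.lift g).1 x = ((g.1 x : E.H) : Qbar) :=
  AlgEquiv.liftNormal_commutes g.1 Qbar x

theorem res_lift (g : E.G) : E.res (E.lift g) = g := by
  apply Subtype.ext
  apply AlgEquiv.ext
  intro x
  apply Subtype.ext
  rw [coe_res, lift_apply]

theorem res_mem_C (c : E.GK) : E.res c.1 ∈ E.C := by
  intro x hx
  apply Subtype.ext
  rw [coe_res]
  exact (IntermediateField.mem_fixingSubgroup_iff _ _).mp
    (Subgroup.mem_subgroupOf.mp c.2) _ hx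

theorem mem_GK_of_res_mem {g : E.GF} (hg : E.res g ∈ E.C) : g ∈ E.GK := by
  change g.1 ∈ E.K.fixingSubgroup
  rw [IntermediateField.mem_fixingSubgroup_iff]
  intro x hx
  have h := congrArg Subtype.val (hg ⟨x, E.K_le_H hx⟩ hx)
  rwa [coe_res] at h

theorem res_eq_one_iff {g : E.GF} : E.res g = 1 ↔ g.1 ∈ E.H.fixingSubgroup := by
  rw [IntermediateField.mem_fixingSubgroup_iff]
  constructor
  · intro h x hx
    have := congrArg (fun t : E.G => ((t.1 ⟨x, hx⟩ : E.H) : Qbar)) h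
    rwa [coe_res] at this
  · intro h
    apply Subtype.ext
    apply AlgEquiv.ext
    intro x
    apply Subtype.ext
    rw [coe_res]
    exact h _ x.2

/-- The character `χ/χ^σ` of the absolute Galois group of `K`. -/
def theta : E.GK →* Qbarˣ := E.χ / E.twist E.σ E.χ

theorem theta_apply (c : E.GK) :
    (E.theta c : Qbar) = (E.χ c : Qbar) / (E.twist E.σ E.χ c : Qbar) := by
  simp [theta]

/-- Such an element lies in the kernel of the adjoint representation. Commuting with an elementary
nilpotent matrix then forces χ and χ^σ to agree there. -/
theorem theta_eq_one_of_res {c : E.GK} (hc : E.res c.1 = 1) : E.theta c = 1 := by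
  obtain ⟨g, hg, hgc⟩ := E.H_fixingSubgroup_le_adKer (E.res_eq_one_iff.mp hc)
  have hgc' : g = c.1 := Subtype.ext hgc
  subst hgc'
  have h := E.adRep_eq_one hg !![0, 1; 0, 0]
  rw [E.ρ_restrict] at h
  have h01 := congrFun (congrFun h 0) 1
  simp [Matrix.mul_apply, Fin.sum_univ_two] at h01
  rw [theta, MonoidHom.div_apply, Units.ext h01, div_self']

/-- The image in `C` of an automorphism over `K`. -/
def resC (c : E.GK) : E.C := ⟨E.res c.1, E.res_mem_C c⟩

theorem psi_eq_theta (c : E.C) : E.psi c = E.theta ⟨E.lift c.1, E.lift_mem c⟩ :=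
  (E.theta_apply _).symm

theorem theta_eq_of_res_eq {c c' : E.GK} (h : E.res c.1 = E.res c'.1) :
    E.theta c = E.theta c' := by
  have h1 : E.theta (c * c'⁻¹) = 1 := E.theta_eq_one_of_res (by
    change E.res (c.1 * c'.1⁻¹) = 1
    rw [map_mul, map_inv, h, mul_inv_cancel])
  rwa [map_mul, map_inv, mul_inv_eq_one] at h1

theorem psi_resC (c : E.GK) : E.psi (E.resC c) = E.theta c := by
  rw [psi_eq_theta]
  congr 1
  exact E.theta_eq_of_res_eq (E.res_lift _)

theorem psi_mul (c c' : E.C) : E.psi (c * c') = E.psi c * E.psi c' := by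
  rw [psi_eq_theta E c, psi_eq_theta E c', ← Units.val_mul, ← map_mul, ← psi_resC]
  congr 1
  apply Subtype.ext
  change c.1 * c'.1 = E.res (E.lift c.1 * E.lift c'.1)
  rw [map_mul, res_lift, res_lift]

theorem psi_ne_zero (c : E.C) : E.psi c ≠ 0 := by
  rw [psi_eq_theta]
  exact Units.ne_zero _

theorem psi_one : E.psi 1 = 1 := by
  have h := E.psi_mul 1 1
  rw [mul_one] at h
  exact (mul_eq_left₀ (E.psi_ne_zero 1)).mp h.symm

theorem psi_inv (c : E.C) : E.psi c⁻¹ = (E.psi c)⁻¹ := by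
  rw [← mul_eq_one_iff_eq_inv₀ (E.psi_ne_zero c), ← psi_mul, inv_mul_cancel, psi_one]

/-- The image of `σ` in `G`. -/
def σG : E.G := E.res E.σ

theorem σG_notMem : E.σG ∉ E.C := fun h => E.σ_notMem (E.mem_GK_of_res_mem h)

theorem GK_mul_mem {a b : E.GF} : a * b ∈ E.GK ↔ (a ∈ E.GK ↔ b ∈ E.GK) :=
  Subgroup.mul_mem_iff_of_index_two E.GK_index

theorem C_mul_mem {a b : E.G} : a * b ∈ E.C ↔ (a ∈ E.C ↔ b ∈ E.C) := by
  have h : ∀ g : E.GF, E.res g ∈ E.C ↔ g ∈ E.GK := fun g =>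
    ⟨E.mem_GK_of_res_mem, fun hg => E.res_mem_C ⟨g, hg⟩⟩
  rw [← E.res_lift a, ← E.res_lift b, ← map_mul, h, h, h, GK_mul_mem]

theorem exists_eq_mul_σG {g : E.G} (hg : g ∉ E.C) : ∃ c : E.C, g = c.1 * E.σG := by
  refine ⟨⟨g * E.σG⁻¹, ?_⟩, by simp⟩
  rw [C_mul_mem, inv_mem_iff]
  have := E.σG_notMem
  tauto

theorem sum_G {M : Type*} [AddCommMonoid M] (f : E.G → M) :
    ∑ g : E.G, f g = ∑ c : E.C, f c.1 + ∑ c : E.C, f (c.1 * E.σG) := by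
  have h : Function.Bijective (Sum.elim (fun c : E.C => c.1) (fun c : E.C => c.1 * E.σG)) := by
    constructor
    · rintro (a | a) (b | b) hab
      · exact congrArg Sum.inl (Subtype.ext hab)
      · have hab' : a.1 = b.1 * E.σG := hab
        have := a.2
        rw [hab', C_mul_mem] at this
        exact absurd (this.mp b.2) E.σG_notMem
      · have hab' : a.1 * E.σG = b.1 := hab
        have := b.2
        rw [← hab', C_mul_mem] at this
        exact absurd (this.mp a.2) E.σG_notMem
      · exact congrArg Sum.inr (Subtype.ext (mul_right_cancel (b := E.σG) hab))
    · intro g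
      by_cases hg : g ∈ E.C
      · exact ⟨Sum.inl ⟨g, hg⟩, rfl⟩
      · obtain ⟨c, hc⟩ := E.exists_eq_mul_σG hg
        exact ⟨Sum.inr c, hc.symm⟩
  rw [← Function.Bijective.sum_comp h, Fintype.sum_sum_type]
  rfl

theorem exists_scalar_of_theta {c : E.GK} (h : E.theta c = 1) :
    (E.ρ c.1 : Matrix (Fin 2) (Fin 2) Qbar) = (E.χ c : Qbar) • 1 := by
  rw [theta, MonoidHom.div_apply, div_eq_one] at h
  rw [E.ρ_restrict, ← h]
  ext i j
  fin_cases i <;> fin_cases j <;> simp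

/-- The character `χ/χ^σ` is not trivial, since the projective image is not abelian. -/
theorem exists_psi_ne_one : ∃ c : E.C, E.psi c ≠ 1 := by
  by_contra! hall
  have h1 : ∀ c : E.GK, E.theta c = 1 := fun c => by
    apply Units.ext
    rw [← psi_resC, hall]
    rfl
  -- If ψ were trivial, every ρ(g) would be a scalar or a scalar multiple of ρ(σ). Any two such
  -- matrices commute.
  have h2 : ∀ g : E.GF, ∃ a : Qbar, (E.ρ g : Matrix (Fin 2) (Fin 2) Qbar) = a • 1 ∨
      (E.ρ g : Matrix (Fin 2) (Fin 2) Qbar) = a • (E.ρ E.σ : Matrix (Fin 2) (Fin 2) Qbar) := by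
    intro g
    by_cases hg : g ∈ E.GK
    · exact ⟨_, Or.inl (E.exists_scalar_of_theta (h1 ⟨g, hg⟩))⟩
    · have hg' : g * E.σ⁻¹ ∈ E.GK := by
        rw [GK_mul_mem, inv_mem_iff]
        have := E.σ_notMem
        tauto
      refine ⟨E.χ ⟨_, hg'⟩, Or.inr ?_⟩
      have h3 := E.exists_scalar_of_theta (h1 ⟨_, hg'⟩)
      have h4 : E.ρ g = E.ρ (g * E.σ⁻¹) * E.ρ E.σ := by rw [← map_mul]; simp
      rw [h4, Units.val_mul, h3, smul_mul_assoc, one_mul]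
  obtain ⟨g, h, hne⟩ := E.nonabelian
  apply hne 1
  rw [one_smul, Units.val_mul, Units.val_mul]
  obtain ⟨a, ha | ha⟩ := h2 g <;> obtain ⟨b, hb | hb⟩ := h2 h <;> rw [ha, hb] <;>
    simp [smul_smul, mul_comm]

end CMRep

/-! ### The adjoint action in coordinates, and the cosets of Gal(H/F). -/

namespace CMPoint

variable {p : ℕ} [Fact p.Prime] (E : CMPoint p)

theorem ρp_val (g : E.GF) : (E.ρp g : Mat p) =
    (E.ρ g : Matrix (Fin 2) (Fin 2) Qbar).map E.ι := rfl

theorem ρp_GK (c : E.GK) : (E.ρp c.1 : Mat p) =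
    !![E.ι (E.χ c), 0; 0, E.ι (E.twist E.σ E.χ c)] := by
  rw [ρp_val, E.ρ_restrict]
  ext i j
  fin_cases i <;> fin_cases j <;> simp

theorem adRep_eq_of {Γ R : Type*} [Group Γ] [CommRing R] {ρ : Γ →* GL (Fin 2) R} {g : Γ}
    {X Y : Matrix (Fin 2) (Fin 2) R}
    (h : (ρ g : Matrix (Fin 2) (Fin 2) R) * X = Y * (ρ g : Matrix (Fin 2) (Fin 2) R)) :
    adRep ρ g X = Y := by
  change (ρ g : Matrix (Fin 2) (Fin 2) R) * X * ((ρ g)⁻¹ : GL (Fin 2) R) = Y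
  rw [h, mul_assoc, ← Units.val_mul, mul_inv_cancel, Units.val_one, mul_one]

theorem adRep_GK (c : E.GK) (X : Mat p) : adRep E.ρp c.1 X =
    !![X 0 0, E.ι (E.theta c) * X 0 1; (E.ι (E.theta c))⁻¹ * X 1 0, X 1 1] := by
  apply adRep_eq_of
  have h1 : E.ι (E.χ c) ≠ 0 := (map_ne_zero _).mpr (Units.ne_zero _)
  have h2 : E.ι (E.twist E.σ E.χ c) ≠ 0 := (map_ne_zero _).mpr (Units.ne_zero _)
  rw [ρp_GK, E.theta_apply, map_div₀]
  ext i j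
  fin_cases i <;> fin_cases j <;> simp [Matrix.mul_apply, Fin.sum_univ_two] <;> field_simp

theorem adRep_σ (X : Mat p) : adRep E.ρp E.σ X = !![X 1 1, X 1 0; X 0 1, X 0 0] := by
  apply adRep_eq_of
  obtain ⟨s, hs⟩ := E.ρ_σ
  rw [ρp_val, hs]
  ext i j
  fin_cases i <;> fin_cases j <;> simp [Matrix.mul_apply, Fin.sum_univ_two, mul_comm]

/-- The quotient of g and g' lies over K and has χ/χ^σ = 1, so it acts trivially on matrices. Hence
`Ad` is multiplicative although `lift` need not be. -/
theorem adRep_eq_of_res {g g' : E.GF} (h : E.res g = E.res g') :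
    adRep E.ρp g = adRep E.ρp g' := by
  have h1 : E.res (g * g'⁻¹) = 1 := by rw [map_mul, map_inv, h, mul_inv_cancel]
  have h2 : g * g'⁻¹ ∈ E.GK := E.mem_GK_of_res_mem (by rw [h1]; exact one_mem _)
  have h3 : adRep E.ρp (g * g'⁻¹) = 1 := by
    apply LinearMap.ext
    intro X
    have h4 := E.adRep_GK ⟨_, h2⟩ X
    rw [E.theta_eq_one_of_res (c := ⟨_, h2⟩) h1] at h4
    change _ = X
    rw [h4]
    ext i j
    fin_cases i <;> fin_cases j <;> simp
  calc adRep E.ρp g = adRep E.ρp (g * g'⁻¹ * g') := by rw [inv_mul_cancel_right]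
    _ = adRep E.ρp g' := by rw [map_mul, h3, one_mul]

theorem Ad_mul (g h : E.G) (X : Mat p) : E.Ad (g * h) X = E.Ad g (E.Ad h X) := by
  have h1 : adRep E.ρp (E.lift (g * h)) = adRep E.ρp (E.lift g * E.lift h) :=
    E.adRep_eq_of_res (by rw [map_mul, CMRep.res_lift, CMRep.res_lift, CMRep.res_lift])
  rw [Ad, h1, map_mul]
  rfl

theorem Ad_C (c : E.C) (X : Mat p) : E.Ad c.1 X =
    !![X 0 0, E.ι (E.psi c) * X 0 1; (E.ι (E.psi c))⁻¹ * X 1 0, X 1 1] := by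
  rw [Ad, E.psi_eq_theta]
  exact E.adRep_GK ⟨_, E.lift_mem c⟩ X

theorem Ad_σ (X : Mat p) : E.Ad E.σG X = !![X 1 1, X 1 0; X 0 1, X 0 0] := by
  have h : adRep E.ρp (E.lift E.σG) = adRep E.ρp E.σ := E.adRep_eq_of_res (E.res_lift _)
  rw [Ad, h, adRep_σ]

theorem Ad_C_mul_σ (c : E.C) (X : Mat p) : E.Ad (c.1 * E.σG) X =
    !![X 1 1, E.ι (E.psi c) * X 1 0; (E.ι (E.psi c))⁻¹ * X 0 1, X 0 0] := by
  rw [Ad_mul, Ad_σ, Ad_C]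
  simp

/-- The elements `h i` represent the cosets of `Gal(H/F)` in `Gal(H/ℚ)`. -/
theorem exists_h_mul (g : E.GalH) : ∃ (i : Fin E.d) (g' : E.G), g = E.h i * g'.1 := by
  let r : E.GalH → (E.F →ₐ[ℚ] Qbar) := fun g =>
    (E.H.val.comp g.toAlgHom).comp (IntermediateField.inclusion E.F_le_H)
  have hinj : Function.Injective fun i => r (E.h i) := by
    intro i j hij
    refine E.h_distinct i j fun x hx => Subtype.ext ?_
    exact DFunLike.congr_fun hij (⟨x, hx⟩ : E.F)
  have hcard : Fintype.card (Fin E.d) = Fintype.card (E.F →ₐ[ℚ] Qbar) := by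
    rw [Fintype.card_fin, AlgHom.card ℚ E.F Qbar]
    rfl
  obtain ⟨i, hi⟩ := ((Fintype.bijective_iff_injective_and_card _).mpr ⟨hinj, hcard⟩).2 (r g)
  refine ⟨i, ⟨(E.h i)⁻¹ * g, fun x hx => ?_⟩, by simp⟩
  have h1 : E.h i x = g x := Subtype.ext (DFunLike.congr_fun hi (⟨x, hx⟩ : E.F))
  rw [AlgEquiv.mul_apply, ← h1]
  exact (E.h i).symm_apply_apply x

theorem h_mul_injective {i j : Fin E.d} {g g' : E.G} (h : E.h i * g.1 = E.h j * g'.1) :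
    i = j ∧ g = g' := by
  have hij : i = j := by
    refine E.h_distinct i j fun x hx => ?_
    have h1 := DFunLike.congr_fun h x
    rwa [AlgEquiv.mul_apply, AlgEquiv.mul_apply, g.2 x hx, g'.2 x hx] at h1
  subst hij
  exact ⟨rfl, Subtype.ext (mul_left_cancel h)⟩

end CMPoint

end HilbertCM

namespace HilbertCM

open NumberField NumberField.Units NumberField.Units.dirichletUnitTheorem

section Dirichlet

variable {K : Type*} [Field K] [NumberField K]

/-! ### Consequences of Dirichlet's unit theorem -/

instance moduleUnitsModTorsion : Module ℤ (Additive ((𝓞 K)ˣ ⧸ torsion K)) :=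
  AddCommGroup.toIntModule (Additive ((𝓞 K)ˣ ⧸ torsion K))

/-- The exponents of a unit with respect to the fundamental system of units. -/
def unitCoord (K : Type*) [Field K] [NumberField K] (j : Fin (rank K)) :
    Additive (𝓞 K)ˣ →+ ℤ :=
  ((basisModTorsion K).coord j).toAddMonoidHom.comp
    (MonoidHom.toAdditive (QuotientGroup.mk' (torsion K)))

theorem unitCoord_apply (j : Fin (rank K)) (u : (𝓞 K)ˣ) :
    unitCoord K j (Additive.ofMul u) =
      (basisModTorsion K).repr (Additive.ofMul (QuotientGroup.mk u)) j := rfl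

theorem exists_torsion_mul_prod (u : (𝓞 K)ˣ) : ∃ ζ ∈ torsion K,
    u = ζ * ∏ j, (fundSystem K j) ^ (unitCoord K j (Additive.ofMul u)) := by
  obtain ⟨⟨ζ, f⟩, hu, -⟩ := exist_unique_eq_mul_prod K u
  refine ⟨ζ, ζ.2, ?_⟩
  have h := fun_eq_repr K ζ.2 hu
  conv_lhs => rw [hu]
  simp only
  congr 1
  refine Finset.prod_congr rfl fun j _ => ?_
  rw [unitCoord_apply, ← h]

theorem unitCoord_fundSystem (i j : Fin (rank K)) :
    unitCoord K j (Additive.ofMul (fundSystem K i)) = if i = j then 1 else 0 := by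
  rw [unitCoord_apply, fundSystem_mk, Module.Basis.repr_self, Finsupp.single_apply]

/-- A homomorphism from the units to a torsion free group in terms of the fundamental units. -/
theorem hom_eq_sum_unitCoord {M : Type*} [AddCommGroup M] [IsAddTorsionFree M]
    (φ : Additive (𝓞 K)ˣ →+ M) (u : (𝓞 K)ˣ) :
    φ (Additive.ofMul u) =
      ∑ j, unitCoord K j (Additive.ofMul u) • φ (Additive.ofMul (fundSystem K j)) := by
  obtain ⟨ζ, hζ, hu⟩ := exists_torsion_mul_prod u
  have h0 : φ (Additive.ofMul ζ) = 0 := by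
    rw [torsion, CommGroup.mem_torsion, isOfFinOrder_iff_pow_eq_one] at hζ
    obtain ⟨n, hn, hζn⟩ := hζ
    have h1 : n • φ (Additive.ofMul ζ) = 0 := by
      rw [← map_nsmul, ← ofMul_pow, hζn, ofMul_one, map_zero]
    exact (smul_eq_zero_iff_right hn.ne').mp h1
  conv_lhs => rw [hu]
  rw [ofMul_mul, map_add, h0, zero_add, ofMul_prod, map_sum]
  refine Finset.sum_congr rfl fun j _ => ?_
  rw [ofMul_zpow, map_zsmul]

/-- The fundamental units map to a ℤ-basis of a full lattice in the logarithmic space, so they are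
independent over ℝ and not only over ℤ. Multiplicities of places factor out coordinate by
coordinate. -/
theorem real_eq_zero_of_sum_log_fundSystem {y : Fin (rank K) → ℝ}
    (h : ∀ v : InfinitePlace K, ∑ j, y j * Real.log (v (fundSystem K j : K)) = 0) : y = 0 := by
  classical
  have hb := ((basisUnitLattice K).ofZLatticeBasis ℝ (unitLattice K)).linearIndependent
  rw [Fintype.linearIndependent_iff] at hb
  funext j
  refine hb y ?_ j
  funext w
  rw [Finset.sum_apply]
  simp only [Pi.smul_apply, Module.Basis.ofZLatticeBasis_apply, ← logEmbedding_fundSystem,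
    logEmbedding_component, smul_eq_mul]
  simp_rw [mul_left_comm (y _), ← Finset.mul_sum]
  rw [h, mul_zero, Pi.zero_apply]

theorem eq_zero_of_sum_log_fundSystem {y : Fin (rank K) → ℂ}
    (h : ∀ v : InfinitePlace K,
      ∑ j, y j * ((Real.log (v (fundSystem K j : K)) : ℝ) : ℂ) = 0) : y = 0 := by
  have h1 := real_eq_zero_of_sum_log_fundSystem (y := fun j => (y j).re) fun v => by
    have := congrArg Complex.re (h v)
    simpa using this
  have h2 := real_eq_zero_of_sum_log_fundSystem (y := fun j => (y j).im) fun v => by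
    have := congrArg Complex.im (h v)
    simpa using this
  funext j
  exact Complex.ext (congrFun h1 j) (congrFun h2 j)

/-- The product formula is the only linear relation between the places on units. Eliminating the
place `w₀` with it leaves a functional with coefficients z_w - z_{w₀}, which kills the unit lattice
and hence the whole space that the lattice spans. -/
theorem eq_of_sum_mult_log_eq_zero {z : InfinitePlace K → ℂ}
    (h : ∀ u : (𝓞 K)ˣ,
      ∑ v, z v * ((v.mult * Real.log (v (u : K)) : ℝ) : ℂ) = 0) (v v' : InfinitePlace K) :
    z v = z v' := by
  classical
  suffices key : ∀ v, z v = z w₀ from (key v).trans (key v').symm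
  intro v
  by_cases hv : v = w₀
  · rw [hv]
  let T : logSpace K →ₗ[ℝ] ℂ :=
    ∑ w : {w : InfinitePlace K // w ≠ w₀}, (LinearMap.proj w).smulRight (z w.1 - z w₀)
  have hT : ∀ x, T x = ∑ w : {w : InfinitePlace K // w ≠ w₀}, (x w : ℂ) * (z w.1 - z w₀) := by
    intro x
    simp [T]
  have h0 : T = 0 := by
    refine LinearMap.ext_on (unitLattice_span_eq_top K) ?_
    rintro _ ⟨u, -, rfl⟩
    change T (logEmbedding K (Additive.ofMul (Additive.toMul u))) = 0
    set x := Additive.toMul u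
    have h1 := h x
    have h2 := sum_mult_mul_log x
    rw [Fintype.sum_eq_add_sum_subtype_ne _ w₀] at h1 h2
    rw [hT]
    simp only [logEmbedding_component]
    have h3 : ((w₀ : InfinitePlace K).mult * Real.log ((w₀ : InfinitePlace K) (x : K)) : ℂ) =
        -∑ w : {w : InfinitePlace K // w ≠ w₀},
          ((w.1.mult * Real.log (w.1 (x : K)) : ℝ) : ℂ) := by
      have := congrArg (fun t : ℝ => (t : ℂ)) h2
      push_cast at this ⊢
      linear_combination this
    push_cast at h1 h3 ⊢
    rw [h3] at h1
    simp_rw [mul_sub, Finset.sum_sub_distrib, ← Finset.sum_mul]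
    simp_rw [mul_comm (z _)] at h1
    linear_combination h1
  have h4 := congrArg (fun f => f (Pi.single ⟨v, hv⟩ 1)) h0
  simp only [hT, LinearMap.zero_apply] at h4
  rw [Finset.sum_eq_single ⟨v, hv⟩ (by
    intro b _ hb
    rw [Pi.single_eq_of_ne hb]
    simp) (by simp)] at h4
  rw [Pi.single_eq_same] at h4
  simpa [sub_eq_zero] using h4

end Dirichlet

end HilbertCM

namespace HilbertCM

open NumberField NumberField.Units

/-! ### Linear algebra over two fields -/

/-- A matrix with independent rows has a right inverse, and a ring homomorphism carries a right
inverse to a right inverse. This is used for the passage from ℚ̄ to ℂ. -/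
theorem linearIndependent_map_ringHom {k k' : Type*} [Field k] [Field k'] (f : k →+* k')
    {n r : ℕ} {v : Fin n → Fin r → k} (hv : LinearIndependent k v) {x : Fin n → k'}
    (hx : ∀ j, ∑ i, x i * f (v i j) = 0) : x = 0 := by
  let P : Matrix (Fin n) (Fin r) k := Matrix.of v
  have hrank : P.rank = Fintype.card (Fin n) := LinearIndependent.rank_matrix hv
  have hsurj : Function.Surjective P.mulVec := by
    have h1 : LinearMap.range P.mulVecLin = ⊤ := by
      apply Submodule.eq_top_of_finrank_eq
      rw [Module.finrank_fintype_fun_eq_card]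
      exact hrank
    exact LinearMap.range_eq_top.mp h1
  obtain ⟨B, hB⟩ := Matrix.mulVec_surjective_iff_exists_right_inverse.mp hsurj
  have h1 : (P.map f) * (B.map f) = 1 := by
    rw [← Matrix.map_mul, hB, Matrix.map_one f (map_zero f) (map_one f)]
  have h2 : Matrix.vecMul x (P.map f) = 0 := by
    funext j
    exact hx j
  calc x = Matrix.vecMul x ((P.map f) * (B.map f)) := by rw [h1, Matrix.vecMul_one]
    _ = 0 := by rw [← Matrix.vecMul_vecMul, h2, Matrix.zero_vecMul]

theorem card_le_of_vecMul_injective {k : Type*} [Field k] {n d : ℕ} (A : Fin n → Fin d → k)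
    (h : ∀ x : Fin n → k, (∀ i, ∑ j, x j * A j i = 0) → x = 0) : n ≤ d := by
  have hinj : Function.Injective (Matrix.of A).vecMulLinear := by
    rw [← LinearMap.ker_eq_bot, LinearMap.ker_eq_bot']
    exact fun x hx => h x fun i => congrFun hx i
  simpa using LinearMap.finrank_le_finrank_of_injective hinj

namespace CMRep

variable (E : CMRep)

/-! ### Complex embeddings of `H` -/

/-- A complex embedding of the algebraic numbers. -/
def cplx : Qbar →+* ℂ := (IsAlgClosed.lift : Qbar →ₐ[ℚ] ℂ).toRingHom

/-- Since H is normal over ℚ, all its complex embeddings are Galois translates of one. Embeddings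
can thus be indexed by group elements. -/
theorem exists_cplx_comp (φ : E.H →+* ℂ) : ∃ g : E.GalH, ∀ x : E.H, cplx (g x : Qbar) = φ x := by
  let : Algebra E.H ℂ := (cplx.comp (algebraMap E.H Qbar)).toAlgebra
  let φ' : E.H →ₐ[ℚ] ℂ := φ.toRatAlgHom
  have : IsScalarTower ℚ E.H ℂ := IsScalarTower.of_algebraMap_eq fun x => by simp
  exact ⟨φ'.restrictNormal' E.H, fun x => φ'.restrictNormal_commutes E.H x⟩

theorem exists_conj : ∃ τ : E.GalH, ∀ x : E.H,
    cplx (τ x : Qbar) = (starRingEnd ℂ) (cplx (x : Qbar)) :=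
  E.exists_cplx_comp ((starRingEnd ℂ).comp (cplx.comp (algebraMap E.H Qbar)))

/-- Complex conjugation on `H`. -/
def conj : E.GalH := E.exists_conj.choose

theorem cplx_conj (x : E.H) : cplx (E.conj x : Qbar) = (starRingEnd ℂ) (cplx (x : Qbar)) :=
  E.exists_conj.choose_spec x

/-- F is totally real, so complex conjugation fixes every conjugate of F. The companion
`conj_mul_notMem_C` uses that K has no real embedding. Together they say that conjugation, seen from
any embedding, exchanges the two cosets of C in G. -/
theorem conj_mul_mem_G (g : E.GalH) : g⁻¹ * E.conj * g ∈ E.G := by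
  intro x hx
  have h1 : E.conj (g x) = g x := by
    apply Subtype.ext
    apply cplx.injective
    rw [cplx_conj]
    have := E.totallyReal.complexEmbedding_isReal
      ((cplx.comp (algebraMap E.H Qbar)).comp ((g : E.H →+* E.H).comp
        (IntermediateField.inclusion E.F_le_H : E.F →+* E.H)))
    exact RingHom.congr_fun this ⟨x, hx⟩
  change g⁻¹ (E.conj (g x)) = x
  rw [h1]
  exact g.symm_apply_apply x

theorem conj_mul_notMem_C (g : E.GalH) : (⟨g⁻¹ * E.conj * g, E.conj_mul_mem_G g⟩ : E.G) ∉ E.C := by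
  intro h
  refine E.totallyComplex.complexEmbedding_not_isReal
    ((cplx.comp (algebraMap E.H Qbar)).comp ((g : E.H →+* E.H).comp
      (IntermediateField.inclusion E.K_le_H : E.K →+* E.H))) ?_
  apply RingHom.ext
  rintro ⟨x, hx⟩
  change (starRingEnd ℂ) (cplx (g ⟨x, E.K_le_H hx⟩ : Qbar)) = cplx (g ⟨x, E.K_le_H hx⟩ : Qbar)
  have h1 : g⁻¹ (E.conj (g ⟨x, E.K_le_H hx⟩)) = ⟨x, E.K_le_H hx⟩ := h ⟨x, E.K_le_H hx⟩ hx
  have h2 : E.conj (g ⟨x, E.K_le_H hx⟩) = g ⟨x, E.K_le_H hx⟩ := by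
    conv_rhs => rw [← h1]
    exact (g.apply_symm_apply _).symm
  rw [← cplx_conj, h2]

/-- The complex embedding attached to an element of `Gal(H/ℚ)`. -/
def cplxEmb (g : E.GalH) : E.H →+* ℂ :=
  (cplx.comp (algebraMap E.H Qbar)).comp (g : E.H →+* E.H)

theorem cplxEmb_surjective (φ : E.H →+* ℂ) : ∃ g, E.cplxEmb g = φ := by
  obtain ⟨g, hg⟩ := E.exists_cplx_comp φ
  exact ⟨g, RingHom.ext hg⟩

theorem cplxEmb_injective : Function.Injective E.cplxEmb := by
  intro g g' h
  apply AlgEquiv.ext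
  intro x
  apply Subtype.ext
  exact cplx.injective (RingHom.congr_fun h x)

theorem cplxEmb_conj_mul (g : E.GalH) :
    E.cplxEmb (E.conj * g) = ComplexEmbedding.conjugate (E.cplxEmb g) := by
  apply RingHom.ext
  intro x
  exact E.cplx_conj (g x)

theorem conj_ne_one : E.conj ≠ 1 := by
  intro h
  apply E.conj_mul_notMem_C 1
  have h1 : (⟨1⁻¹ * E.conj * 1, E.conj_mul_mem_G 1⟩ : E.G) = 1 := by
    apply Subtype.ext
    change 1⁻¹ * E.conj * 1 = 1
    rw [h, inv_one, one_mul, one_mul]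
  rw [h1]
  exact one_mem _

instance : IsTotallyComplex E.H := by
  let : Algebra E.K E.H := (IntermediateField.inclusion E.K_le_H).toAlgebra
  have := E.totallyComplex
  exact isTotallyComplex_of_algebra E.K E.H

/-! ### Logarithms of the archimedean absolute values of units -/

/-- `log |g u|` for a unit `u`, as a homomorphism to the complex numbers. -/
def archLog (g : E.GalH) : Additive (𝓞 E.H)ˣ →+ ℂ where
  toFun u := ((Real.log ‖E.cplxEmb g ((u.toMul : 𝓞 E.H) : E.H)‖ : ℝ) : ℂ)
  map_zero' := by simp
  map_add' u v := by
    have h : ∀ u : (𝓞 E.H)ˣ, ‖E.cplxEmb g ((u : 𝓞 E.H) : E.H)‖ ≠ 0 := fun u => by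
      rw [norm_ne_zero_iff, map_ne_zero]
      exact RingOfIntegers.coe_ne_zero_iff.mpr u.ne_zero
    have h' : (((u + v).toMul : 𝓞 E.H) : E.H) =
        ((u.toMul : 𝓞 E.H) : E.H) * ((v.toMul : 𝓞 E.H) : E.H) := rfl
    rw [h', map_mul, norm_mul, Real.log_mul (h _) (h _)]
    push_cast
    rfl

theorem archLog_apply (g : E.GalH) (u : (𝓞 E.H)ˣ) : E.archLog g (Additive.ofMul u) =
    ((Real.log ‖E.cplxEmb g ((u : 𝓞 E.H) : E.H)‖ : ℝ) : ℂ) := rfl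

theorem unitAct_mul (g g' : E.GalH) (u : (𝓞 E.H)ˣ) :
    E.unitAct (g * g') u = E.unitAct g (E.unitAct g' u) := by
  apply Units.ext
  apply RingOfIntegers.ext
  rfl

theorem archLog_unitAct (g g' : E.GalH) (u : (𝓞 E.H)ˣ) :
    E.archLog g (Additive.ofMul (E.unitAct g' u)) = E.archLog (g * g') (Additive.ofMul u) := rfl

theorem archLog_conj_mul (g : E.GalH) : E.archLog (E.conj * g) = E.archLog g := by
  apply AddMonoidHom.ext
  intro u
  change E.archLog _ (Additive.ofMul u.toMul) = E.archLog _ (Additive.ofMul u.toMul)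
  rw [archLog_apply, archLog_apply, cplxEmb_conj_mul, ComplexEmbedding.conjugate_coe_eq,
    RCLike.norm_conj]

theorem archLog_eq_place (g : E.GalH) (u : (𝓞 E.H)ˣ) : E.archLog g (Additive.ofMul u) =
    ((Real.log (InfinitePlace.mk (E.cplxEmb g) ((u : 𝓞 E.H) : E.H)) : ℝ) : ℂ) := rfl

theorem eq_zero_of_sum_archLog {y : Fin (rank E.H) → ℂ}
    (h : ∀ g, ∑ j, y j * E.archLog g (Additive.ofMul (fundSystem E.H j)) = 0) : y = 0 := by
  refine eq_zero_of_sum_log_fundSystem fun v => ?_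
  obtain ⟨g, hg⟩ := E.cplxEmb_surjective v.embedding
  have h1 := h g
  simp only [archLog_eq_place, hg, InfinitePlace.mk_embedding] at h1
  exact h1

theorem mk_cplxEmb_eq_iff (g g' : E.GalH) :
    InfinitePlace.mk (E.cplxEmb g) = InfinitePlace.mk (E.cplxEmb g') ↔
      g' = g ∨ g' = E.conj * g := by
  rw [InfinitePlace.mk_eq_iff, ← cplxEmb_conj_mul, E.cplxEmb_injective.eq_iff,
    E.cplxEmb_injective.eq_iff, eq_comm, @eq_comm _ (E.conj * g)]

/-- The embeddings of the place of g are g and its complex conjugate, which are distinct, so the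
pair sums are the coefficients of the places. All multiplicities equal 2, and the product formula is
the only relation. -/
theorem eq_of_sum_archLog_eq_zero [Fintype E.GalH] {z : E.GalH → ℂ}
    (h : ∀ u : (𝓞 E.H)ˣ, ∑ g, z g * E.archLog g (Additive.ofMul u) = 0) (g g' : E.GalH) :
    z g + z (E.conj * g) = z g' + z (E.conj * g') := by
  classical
  let Z : InfinitePlace E.H → ℂ := fun v =>
    ∑ g : E.GalH with InfinitePlace.mk (E.cplxEmb g) = v, z g
  have hZ : ∀ g, Z (InfinitePlace.mk (E.cplxEmb g)) = z g + z (E.conj * g) := by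
    intro g
    have h1 : ({g' : E.GalH | InfinitePlace.mk (E.cplxEmb g') =
        InfinitePlace.mk (E.cplxEmb g)} : Finset E.GalH) = {g, E.conj * g} := by
      ext g'
      rw [Finset.mem_filter_univ, eq_comm, mk_cplxEmb_eq_iff]
      simp
    have h2 : g ≠ E.conj * g := fun h => E.conj_ne_one (mul_eq_right.mp h.symm)
    simp only [Z]
    rw [h1, Finset.sum_pair h2]
  rw [← hZ, ← hZ]
  refine eq_of_sum_mult_log_eq_zero (z := Z) (fun u => ?_) _ _
  have h1 := h u
  rw [← Finset.sum_fiberwise _ (fun g => InfinitePlace.mk (E.cplxEmb g))] at h1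
  have h2 : ∀ v : InfinitePlace E.H, Z v * ((v.mult * Real.log (v (u : E.H)) : ℝ) : ℂ) =
      2 * ∑ g : E.GalH with InfinitePlace.mk (E.cplxEmb g) = v,
        z g * E.archLog g (Additive.ofMul u) := by
    intro v
    rw [IsTotallyComplex.mult_eq v, Finset.sum_mul, Finset.mul_sum]
    refine Finset.sum_congr rfl fun g hg => ?_
    rw [archLog_eq_place, (Finset.mem_filter.mp hg).2]
    push_cast
    ring
  simp_rw [h2]
  rw [← Finset.mul_sum, h1, mul_zero]

/-! ### Coordinates on the space of units -/

/-- The coordinates of an element of `𝓞_H^× ⊗ ℚbar` with respect to the fundamental units. -/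
def spaceCoord : E.UnitSpace →ₗ[Qbar] (Fin (rank E.H) → Qbar) :=
  LinearMap.pi fun j => TensorProduct.AlgebraTensorModule.lift
    ((LinearMap.toSpanSingleton Qbar (Additive (𝓞 E.H)ˣ →ₗ[ℤ] Qbar)
      ((Int.castAddHom Qbar).comp (unitCoord E.H j)).toIntLinearMap))

theorem spaceCoord_tmul (a : Qbar) (u : (𝓞 E.H)ˣ) (j : Fin (rank E.H)) :
    E.spaceCoord (a ⊗ₜ Additive.ofMul u) j = a * (unitCoord E.H j (Additive.ofMul u) : Qbar) := by
  simp [spaceCoord]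

/-- The tensor product is a ℚ-vector space, hence torsion free, so the root of unity in the
factorisation of u disappears. -/
theorem tmul_eq_sum (a : Qbar) (u : (𝓞 E.H)ˣ) : (a ⊗ₜ[ℤ] Additive.ofMul u : E.UnitSpace) =
    ∑ j, (a * (unitCoord E.H j (Additive.ofMul u) : Qbar)) ⊗ₜ[ℤ]
      Additive.ofMul (fundSystem E.H j) := by
  have : IsAddTorsionFree E.UnitSpace := by
    have : Module ℚ E.UnitSpace := Module.compHom E.UnitSpace (algebraMap ℚ Qbar)
    exact IsAddTorsionFree.of_module_rat E.UnitSpace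
  have h := hom_eq_sum_unitCoord
    ((TensorProduct.mk ℤ Qbar (Additive (𝓞 E.H)ˣ) a).toAddMonoidHom) u
  refine h.trans (Finset.sum_congr rfl fun j _ => ?_)
  change _ • (a ⊗ₜ[ℤ] Additive.ofMul (fundSystem E.H j)) = _
  rw [TensorProduct.smul_tmul', zsmul_eq_mul, mul_comm]

theorem spaceCoord_injective : Function.Injective E.spaceCoord := by
  let T : (Fin (rank E.H) → Qbar) →+ E.UnitSpace :=
    ∑ j, ((TensorProduct.mk ℤ Qbar (Additive (𝓞 E.H)ˣ)).flip
      (Additive.ofMul (fundSystem E.H j))).toAddMonoidHom.comp (Pi.evalAddMonoidHom _ j)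
  have hT : ∀ x, T (E.spaceCoord x) = x := by
    intro x
    induction x using TensorProduct.induction_on with
    | zero => simp
    | add x y hx hy => rw [map_add, map_add, hx, hy]
    | tmul a u =>
      have h := E.tmul_eq_sum a u.toMul
      rw [ofMul_toMul] at h
      rw [h, AddMonoidHom.finsetSum_apply]
      refine Finset.sum_congr rfl fun j _ => ?_
      change E.spaceCoord _ j ⊗ₜ[ℤ] _ = _
      rw [← h]
      exact congrArg (· ⊗ₜ[ℤ] _) (E.spaceCoord_tmul a u.toMul j)
  exact Function.LeftInverse.injective hT

theorem spaceCoord_unitProj (u : (𝓞 E.H)ˣ) (j : Fin (rank E.H)) :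
    E.spaceCoord (E.unitProj u) j =
      ∑ c : E.C, E.psi c * (unitCoord E.H j (Additive.ofMul (E.unitAct c.1.1⁻¹ u)) : Qbar) := by
  rw [unitProj, map_sum, Finset.sum_apply]
  exact Finset.sum_congr rfl fun c _ => E.spaceCoord_tmul _ _ _

instance : FiniteDimensional Qbar E.UnitSpace :=
  Module.Finite.of_injective E.spaceCoord E.spaceCoord_injective

/-! ### The isotypical component is spanned by projections of units -/

theorem unitSpaceAct_tmul (c : E.C) (a : Qbar) (u : (𝓞 E.H)ˣ) :
    E.unitSpaceAct c (a ⊗ₜ Additive.ofMul u) = a ⊗ₜ Additive.ofMul (E.unitAct c.1.1 u) := rfl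

theorem unitProj_mem (u : (𝓞 E.H)ˣ) : E.unitProj u ∈ E.isotypic := by
  intro c
  rw [unitProj, map_sum, Finset.smul_sum]
  refine Fintype.sum_equiv (Equiv.mulRight c⁻¹) _ _ fun c' => ?_
  rw [unitSpaceAct_tmul, ← unitAct_mul, TensorProduct.smul_tmul', Equiv.coe_mulRight, smul_eq_mul,
    psi_mul, psi_inv, mul_comm (E.psi c'), mul_inv_cancel_left₀ (E.psi_ne_zero c)]
  congr 4

theorem span_unitProj : Submodule.span Qbar (Set.range E.unitProj) = E.isotypic := by
  apply le_antisymm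
  · rw [Submodule.span_le]
    rintro _ ⟨u, rfl⟩
    exact E.unitProj_mem u
  · intro x hx
    -- Up to the factor |C|, this is the projector to the isotypical component. It acts as |C| on
    -- that component and sends a ⊗ u to a multiple of the projection of u.
    let T : E.UnitSpace →ₗ[Qbar] E.UnitSpace := ∑ c : E.C, E.psi c • E.unitSpaceAct c⁻¹
    have h1 : T x = (Fintype.card E.C : Qbar) • x := by
      simp only [T, LinearMap.sum_apply, LinearMap.smul_apply]
      rw [Finset.sum_congr rfl (g := fun _ => x), Finset.sum_const, Finset.card_univ,
        Nat.cast_smul_eq_nsmul]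
      intro c _
      rw [hx, psi_inv, smul_smul, mul_inv_cancel₀ (E.psi_ne_zero c), one_smul]
    have h2 : ∀ y, T y ∈ Submodule.span Qbar (Set.range E.unitProj) := by
      intro y
      induction y using TensorProduct.induction_on with
      | zero => rw [map_zero]; exact zero_mem _
      | add x y hx hy => rw [map_add]; exact add_mem hx hy
      | tmul a u =>
        have h3 : T (a ⊗ₜ[ℤ] u) = a • E.unitProj u.toMul := by
          simp only [T, LinearMap.sum_apply, LinearMap.smul_apply, unitProj, Finset.smul_sum]
          refine Finset.sum_congr rfl fun c _ => ?_
          rw [TensorProduct.smul_tmul', smul_eq_mul, mul_comm]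
          change E.psi c • (a ⊗ₜ[ℤ] _) = _
          rw [TensorProduct.smul_tmul', smul_eq_mul]
          rfl
        rw [h3]
        exact Submodule.smul_mem _ _ (Submodule.subset_span ⟨_, rfl⟩)
    have h4 : (Fintype.card E.C : Qbar) ≠ 0 := Nat.cast_ne_zero.mpr Fintype.card_ne_zero
    have h5 : x = (Fintype.card E.C : Qbar)⁻¹ • T x := by
      rw [h1, smul_smul, inv_mul_cancel₀ h4, one_smul]
    rw [h5]
    exact Submodule.smul_mem _ _ (h2 x)

end CMRep

end HilbertCM

namespace HilbertCM

open NumberField NumberField.Units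

/-! ### Determinants of linear forms in algebraically independent numbers -/

/-- The determinant of the generic matrix is a polynomial over k. One nonzero value, in any field
over k, shows that it is not the zero polynomial, and then it cannot vanish at algebraically
independent elements. This carries non-vanishing from the complex to the p-adic side. -/
theorem det_ne_zero_of_algebraicIndependent {k Ω Ω' : Type*} [Field k] [Field Ω] [Field Ω']
    [Algebra k Ω] {r d : ℕ} {l : Fin r → Ω} (hl : AlgebraicIndependent k l)
    (a : Fin d → Fin d → Fin r → k) (f : k →+* Ω') (m : Fin r → Ω')
    (h : (Matrix.of fun s i => ∑ j, f (a s i j) * m j).det ≠ 0) :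
    (Matrix.of fun s i => ∑ j, algebraMap k Ω (a s i j) * l j).det ≠ 0 := by
  let D : Matrix (Fin d) (Fin d) (MvPolynomial (Fin r) k) :=
    Matrix.of fun s i => ∑ j, MvPolynomial.C (a s i j) * MvPolynomial.X j
  have h1 : (MvPolynomial.eval₂Hom f m) D.det =
      (Matrix.of fun s i => ∑ j, f (a s i j) * m j).det := by
    rw [RingHom.map_det]
    congr 1
    ext s i
    simp [D]
  have h2 : (MvPolynomial.aeval l) D.det =
      (Matrix.of fun s i => ∑ j, algebraMap k Ω (a s i j) * l j).det := by
    rw [AlgHom.map_det]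
    congr 1
    ext s i
    simp [D]
  rw [← h2]
  intro h3
  have h4 : D.det = 0 := hl (by rw [h3, map_zero])
  rw [h4, map_zero] at h1
  exact h h1.symm

/-- A field generated by n elements is algebraic over the algebra they generate. If its
transcendence degree is n, the generators form a transcendence basis. -/
theorem algebraicIndependent_of_padicSchanuel {p : ℕ} [Fact p.Prime] {ι : Qbar →+* PadicAlgCl p}
    (schanuel : PadicSchanuel p ι) {n : ℕ} (α : Fin n → Qbar) (hα : ∀ i, α i ≠ 0)
    (hli : LinearIndependent ℚ (fun i => padicLog p (ι (α i)))) :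
    AlgebraicIndependent ℚ (fun i => padicLog p (ι (α i))) := by
  have h := schanuel n α hα hli
  set x : Fin n → PadicAlgCl p := fun i => padicLog p (ι (α i)) with hx
  let L := IntermediateField.adjoin ℚ (Set.range x)
  let x' : Fin n → L := fun i => ⟨x i, IntermediateField.subset_adjoin _ _ ⟨i, rfl⟩⟩
  have halg : Algebra.IsAlgebraic (Algebra.adjoin ℚ (Set.range x')) L := by
    refine ⟨fun y => ?_⟩
    obtain ⟨y, hy⟩ := y
    induction hy using IntermediateField.adjoin_induction with
    | mem y hy =>
      obtain ⟨i, rfl⟩ := hy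
      exact isAlgebraic_algebraMap
        (⟨x' i, Algebra.subset_adjoin ⟨i, rfl⟩⟩ : Algebra.adjoin ℚ (Set.range x'))
    | algebraMap q =>
      exact isAlgebraic_algebraMap (algebraMap ℚ (Algebra.adjoin ℚ (Set.range x')) q)
    | add y z hy hz ihy ihz => exact ihy.add ihz
    | inv y hy ih => exact ih.inv
    | mul y z hy hz ihy ihz => exact ihy.mul ihz
  have htb := Algebra.IsAlgebraic.isTranscendenceBasis_of_lift_le_trdeg_of_finite (R := ℚ) x'
    (by
      rw [h]
      simp)
  exact htb.1.map' (f := L.val) L.val.injective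

/-! ### p-adic logarithms of global units. -/

theorem norm_le_one_of_isIntegral {p : ℕ} [Fact p.Prime] {x : PadicAlgCl p}
    (hx : IsIntegral ℤ x) : ‖x‖ ≤ 1 := by
  have h := (Valuation.integer.integers (NormedField.valuation (K := PadicAlgCl p))).mem_of_integral
    (x := x) (hx.tower_top (A := (NormedField.valuation (K := PadicAlgCl p)).integer))
  exact h

namespace CMPoint

variable {p : ℕ} [Fact p.Prime] (E : CMPoint p)

theorem norm_ι_int_le_one (x : 𝓞 E.H) : ‖E.ι ((x : E.H) : Qbar)‖ ≤ 1 :=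
  norm_le_one_of_isIntegral
    (map_isIntegral_int (E.ι.comp (algebraMap E.H Qbar)) (RingOfIntegers.isIntegral_coe x))

theorem norm_ι_unit (u : (𝓞 E.H)ˣ) : ‖E.ι (((u : 𝓞 E.H) : E.H) : Qbar)‖ = 1 := by
  refine le_antisymm (E.norm_ι_int_le_one _) ?_
  have h1 : E.ι (((u : 𝓞 E.H) : E.H) : Qbar) * E.ι ((((u⁻¹ : (𝓞 E.H)ˣ) : 𝓞 E.H) : E.H) : Qbar) =
      1 := by
    rw [← map_mul]
    have : ((((u : 𝓞 E.H) : E.H) : Qbar) * (((u⁻¹ : (𝓞 E.H)ˣ) : 𝓞 E.H) : E.H) : Qbar) =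
        (((u * u⁻¹ : (𝓞 E.H)ˣ) : 𝓞 E.H) : E.H) := rfl
    rw [this, mul_inv_cancel]
    exact map_one E.ι
  have h2 := congrArg norm h1
  rw [norm_mul, norm_one] at h2
  nlinarith [E.norm_ι_int_le_one (u⁻¹ : (𝓞 E.H)ˣ), norm_nonneg (E.ι (((u : 𝓞 E.H) : E.H) : Qbar))]

/-- The `p`-adic logarithm of units of `H`. -/
def padicUnitLog : Additive (𝓞 E.H)ˣ →+ PadicAlgCl p where
  toFun u := padicLog p (E.ι (((u.toMul : 𝓞 E.H) : E.H) : Qbar))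
  map_zero' := by
    change padicLog p (E.ι 1) = 0
    rw [map_one, padicLog_one]
  map_add' u v := by
    rw [← padicLog_mul (E.norm_ι_unit _) (E.norm_ι_unit _), ← map_mul]
    rfl

theorem padicUnitLog_apply (u : (𝓞 E.H)ˣ) : E.padicUnitLog (Additive.ofMul u) =
    padicLog p (E.ι (((u : 𝓞 E.H) : E.H) : Qbar)) := rfl

theorem mem_torsion_of_padicUnitLog {u : (𝓞 E.H)ˣ} (h : E.padicUnitLog (Additive.ofMul u) = 0) :
    u ∈ torsion E.H := by
  obtain ⟨n, hn, hun⟩ := exists_pow_eq_one_of_padicLog (E.norm_ι_unit u) h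
  rw [torsion, CommGroup.mem_torsion, isOfFinOrder_iff_pow_eq_one]
  refine ⟨n, hn, ?_⟩
  rw [← map_pow, map_eq_one_iff _ E.ι.injective] at hun
  apply Units.ext
  apply RingOfIntegers.ext
  exact Subtype.ext hun

theorem unitCoord_eq_zero_of_torsion {u : (𝓞 E.H)ˣ} (h : u ∈ torsion E.H) (j : Fin (rank E.H)) :
    unitCoord E.H j (Additive.ofMul u) = 0 := by
  rw [torsion, CommGroup.mem_torsion, isOfFinOrder_iff_pow_eq_one] at h
  obtain ⟨n, hn, hu⟩ := h
  have h1 : n • unitCoord E.H j (Additive.ofMul u) = 0 := by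
    rw [← map_nsmul, ← ofMul_pow, hu, ofMul_one, map_zero]
  exact (smul_eq_zero_iff_right hn.ne').mp h1

/-- After clearing denominators, a relation produces a unit with vanishing p-adic logarithm. Such a
unit is a root of unity, so its exponents in the fundamental system are zero. -/
theorem linearIndependent_padicUnitLog : LinearIndependent ℚ
    fun j => E.padicUnitLog (Additive.ofMul (fundSystem E.H j)) := by
  rw [← LinearIndependent.iff_fractionRing ℤ ℚ, Fintype.linearIndependent_iff]
  intro g hg i
  have h1 : E.padicUnitLog (Additive.ofMul (∏ j, fundSystem E.H j ^ g j)) = 0 := by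
    rw [ofMul_prod, map_sum, ← hg]
    refine Finset.sum_congr rfl fun j _ => ?_
    rw [ofMul_zpow, map_zsmul]
  have h2 := E.unitCoord_eq_zero_of_torsion (E.mem_torsion_of_padicUnitLog h1) i
  rw [ofMul_prod, map_sum] at h2
  simp_rw [ofMul_zpow, map_zsmul, unitCoord_fundSystem] at h2
  simpa using h2

theorem algebraicIndependent_padicUnitLog (schanuel : PadicSchanuel p E.ι) :
    AlgebraicIndependent ℚ fun j => E.padicUnitLog (Additive.ofMul (fundSystem E.H j)) :=
  algebraicIndependent_of_padicSchanuel schanuel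
    (fun j => (((fundSystem E.H j : 𝓞 E.H) : E.H) : Qbar))
    (fun j h => by
      have := E.norm_ι_unit (fundSystem E.H j)
      rw [h, map_zero, norm_zero] at this
      exact zero_ne_one this) E.linearIndependent_padicUnitLog

theorem embInt_tmul (i : Fin E.d) (g : E.GalH) (x : 𝓞 E.H) (z : ℤ_[p]) :
    E.embInt i g (x ⊗ₜ[ℤ] z) = E.ι (((E.h i * g⁻¹) (x : E.H) : E.H) : Qbar) *
      algebraMap ℚ_[p] (PadicAlgCl p) z :=
  Algebra.TensorProduct.productMap_apply_tmul _ _ x z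

theorem L_diag (i : Fin E.d) (g : E.GalH) (u : (𝓞 E.H)ˣ) :
    E.L i g (E.diag u) = E.padicUnitLog (Additive.ofMul (E.unitAct (E.h i * g⁻¹) u)) := by
  have h : E.embInt i g (E.diag u : E.LocalInt) =
      E.ι ((((E.unitAct (E.h i * g⁻¹) u : (𝓞 E.H)ˣ) : 𝓞 E.H) : E.H) : Qbar) := by
    refine (E.embInt_tmul i g u 1).trans ?_
    rw [PadicInt.coe_one, map_one, mul_one]
    rfl
  rw [L, h, padicUnitLog_apply]

/-! ### The matrix of logarithms -/

/-- The sum `∑_c (χ/χ^σ)(c) log |k c⁻¹ u|`. -/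
def archPsi (k : E.GalH) (u : (𝓞 E.H)ˣ) : ℂ :=
  ∑ c : E.C, CMRep.cplx (E.psi c) * E.archLog (k * c.1.1⁻¹) (Additive.ofMul u)

/-- With invariance under conjugation, this determines `archPsi` on all of Gal(H/ℚ), up to nonzero
factors, by its values at d representatives. -/
theorem archPsi_mul_inv (k : E.GalH) (c : E.C) (u : (𝓞 E.H)ˣ) :
    E.archPsi (k * c.1.1⁻¹) u = (CMRep.cplx (E.psi c))⁻¹ * E.archPsi k u := by
  have h0 : CMRep.cplx (E.psi c) ≠ 0 := (map_ne_zero _).mpr (E.psi_ne_zero c)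
  rw [eq_inv_mul_iff_mul_eq₀ h0, archPsi, archPsi, Finset.mul_sum]
  refine Fintype.sum_equiv (Equiv.mulRight c) _ _ fun c' => ?_
  rw [Equiv.coe_mulRight, E.psi_mul, map_mul, ← mul_assoc, mul_comm (CMRep.cplx (E.psi c))]
  simp [mul_assoc]

theorem archPsi_conj_mul (k : E.GalH) (u : (𝓞 E.H)ˣ) :
    E.archPsi (E.conj * k) u = E.archPsi k u := by
  simp only [archPsi, mul_assoc, E.archLog_conj_mul]

theorem archPsi_eq_sum (k : E.GalH) (u : (𝓞 E.H)ˣ) : E.archPsi k u =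
    ∑ j, CMRep.cplx (E.spaceCoord (E.unitProj u) j) *
      E.archLog k (Additive.ofMul (fundSystem E.H j)) := by
  simp_rw [E.spaceCoord_unitProj, map_sum, Finset.sum_mul]
  rw [Finset.sum_comm, archPsi]
  refine Finset.sum_congr rfl fun c _ => ?_
  rw [← E.archLog_unitAct, hom_eq_sum_unitCoord (E.archLog k), Finset.mul_sum]
  refine Finset.sum_congr rfl fun j _ => ?_
  rw [zsmul_eq_mul, map_mul, map_intCast, mul_assoc]

variable (s : Fin E.d → E.G)

/-- Gal(H/ℚ) is the union of the cosets h_i G, and if the G-component falls outside C then complex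
conjugation moves it into C. The shifts s_i are left free so that σ^{δ(i)} can be inserted later. -/
theorem exists_eq_or_conj_mul_eq (g : E.GalH) : ∃ (i : Fin E.d) (c : E.C),
    g = E.h i * (s i).1⁻¹ * c.1.1⁻¹ ∨ E.conj * g = E.h i * (s i).1⁻¹ * c.1.1⁻¹ := by
  obtain ⟨i, g', rfl⟩ := E.exists_h_mul g
  by_cases hg : s i * g' ∈ E.C
  · refine ⟨i, ⟨s i * g', hg⟩⁻¹, Or.inl ?_⟩
    simp [mul_assoc]
  · let τ : E.G := ⟨_, E.conj_mul_mem_G (E.h i * (s i).1⁻¹)⟩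
    have hτ : τ ∉ E.C := E.conj_mul_notMem_C _
    have h1 : τ * (s i * g') ∈ E.C := by
      rw [E.C_mul_mem]
      tauto
    refine ⟨i, ⟨_, h1⟩⁻¹, Or.inr ?_⟩
    simp [τ, mul_assoc]

theorem h_mul_mul_injective {i j : Fin E.d} {c c' : E.C}
    (h : E.h i * (s i).1⁻¹ * c.1.1⁻¹ = E.h j * (s j).1⁻¹ * c'.1.1⁻¹) : i = j ∧ c = c' := by
  obtain ⟨rfl, h2⟩ := E.h_mul_injective (g := (s i)⁻¹ * c.1⁻¹) (g' := (s j)⁻¹ * c'.1⁻¹)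
    (by simpa [mul_assoc] using h)
  exact ⟨rfl, Subtype.ext (inv_injective (mul_left_cancel h2))⟩

theorem conj_mul_h_ne {i j : Fin E.d} {c c' : E.C} :
    E.conj * (E.h i * (s i).1⁻¹ * c.1.1⁻¹) ≠ E.h j * (s j).1⁻¹ * c'.1.1⁻¹ := by
  intro h
  let τ : E.G := ⟨_, E.conj_mul_mem_G (E.h i * (s i).1⁻¹)⟩
  have hτ : τ ∉ E.C := E.conj_mul_notMem_C _
  obtain ⟨rfl, h2⟩ := E.h_mul_injective (g := (s i)⁻¹ * τ * c.1⁻¹) (g' := (s j)⁻¹ * c'.1⁻¹)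
    (by
      rw [← mul_assoc] at h
      simpa [τ, mul_assoc] using h : E.h i * ((s i)⁻¹ * τ * c.1⁻¹ : E.G).1 =
        E.h j * ((s j)⁻¹ * c'.1⁻¹ : E.G).1)
  rw [mul_assoc] at h2
  have h3 : τ * c.1⁻¹ ∈ E.C := by
    rw [mul_left_cancel h2]
    exact inv_mem c'.2
  rw [E.C_mul_mem] at h3
  exact hτ (h3.mpr (inv_mem c.2))

/-- The relation at the d representatives spreads to every embedding through C and complex
conjugation. Expanded in fundamental units, it becomes a relation that Dirichlet's theorem excludes
unless all coefficients vanish. -/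
theorem sum_coord_eq_zero {n : ℕ} (u : Fin n → (𝓞 E.H)ˣ) {x : Fin n → ℂ}
    (hx : ∀ i, ∑ k, x k * E.archPsi (E.h i * (s i).1⁻¹) (u k) = 0) (j : Fin (rank E.H)) :
    ∑ k, x k * CMRep.cplx (E.spaceCoord (E.unitProj (u k)) j) = 0 := by
  have hF : ∀ g, ∑ k, x k * E.archPsi g (u k) = 0 := by
    intro g
    have h1 : ∀ (i : Fin E.d) (c : E.C),
        ∑ k, x k * E.archPsi (E.h i * (s i).1⁻¹ * c.1.1⁻¹) (u k) = 0 := by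
      intro i c
      simp_rw [archPsi_mul_inv, mul_left_comm (x _), ← Finset.mul_sum]
      rw [hx, mul_zero]
    obtain ⟨i, c, h | h⟩ := E.exists_eq_or_conj_mul_eq s g
    · rw [h, h1]
    · simp_rw [← E.archPsi_conj_mul g]
      rw [h, h1]
  refine congrFun (E.eq_zero_of_sum_archLog (y := fun j =>
    ∑ k, x k * CMRep.cplx (E.spaceCoord (E.unitProj (u k)) j)) fun g => ?_) j
  rw [← hF g]
  simp_rw [archPsi_eq_sum, Finset.sum_mul, Finset.mul_sum]
  rw [Finset.sum_comm]
  simp_rw [mul_assoc]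

theorem row_eq_zero {n : ℕ} {u : Fin n → (𝓞 E.H)ˣ}
    (hu : LinearIndependent Qbar fun k => E.unitProj (u k)) {x : Fin n → ℂ}
    (hx : ∀ i, ∑ k, x k * E.archPsi (E.h i * (s i).1⁻¹) (u k) = 0) : x = 0 :=
  linearIndependent_map_ringHom CMRep.cplx
    (hu.map' E.spaceCoord (LinearMap.ker_eq_bot.mpr E.spaceCoord_injective))
    (E.sum_coord_eq_zero s u hx)

/-- The coefficients y_i ψ(c) live on one embedding out of each conjugate pair, and z extends them
by zero to the other. By the product formula argument they are independent of (i, c). Comparing c =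
1 with some c where ψ(c) ≠ 1 gives y_i = 0. -/
theorem column_eq_zero {y : Fin E.d → ℂ}
    (hy : ∀ u : (𝓞 E.H)ˣ, ∑ i, y i * E.archPsi (E.h i * (s i).1⁻¹) u = 0) : y = 0 := by
  classical
  have : Fintype E.GalH := Fintype.ofFinite _
  let e : Fin E.d × E.C → E.GalH := fun ic => E.h ic.1 * (s ic.1).1⁻¹ * ic.2.1.1⁻¹
  have he : Function.Injective e := fun a b h =>
    Prod.ext (E.h_mul_mul_injective s h).1 (E.h_mul_mul_injective s h).2
  let z : E.GalH → ℂ := Function.extend e (fun ic => y ic.1 * CMRep.cplx (E.psi ic.2)) 0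
  have hz : ∀ i c, z (e (i, c)) = y i * CMRep.cplx (E.psi c) := fun i c =>
    he.extend_apply _ _ (i, c)
  have hz' : ∀ i c, z (E.conj * e (i, c)) = 0 := fun i c =>
    Function.extend_apply' _ _ _ fun ⟨⟨j, c'⟩, h⟩ => E.conj_mul_h_ne s h.symm
  have h1 : ∀ u : (𝓞 E.H)ˣ, ∑ g, z g * E.archLog g (Additive.ofMul u) = 0 := by
    intro u
    rw [← hy u]
    have h2 : ∑ g, z g * E.archLog g (Additive.ofMul u) =
        ∑ ic : Fin E.d × E.C, z (e ic) * E.archLog (e ic) (Additive.ofMul u) := by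
      rw [← Finset.sum_image (f := fun g => z g * E.archLog g (Additive.ofMul u))
        (fun a _ b _ h => he h)]
      refine (Finset.sum_subset (Finset.subset_univ _) fun g _ hg => ?_).symm
      have : z g = 0 := Function.extend_apply' _ _ _ fun ⟨ic, h⟩ =>
        hg (Finset.mem_image.mpr ⟨ic, Finset.mem_univ _, h⟩)
      rw [this, zero_mul]
    rw [h2, Fintype.sum_prod_type]
    refine Finset.sum_congr rfl fun i _ => ?_
    rw [archPsi, Finset.mul_sum]
    refine Finset.sum_congr rfl fun c _ => ?_
    rw [hz, mul_assoc]
  obtain ⟨c, hc⟩ := E.exists_psi_ne_one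
  funext i
  have h3 := E.eq_of_sum_archLog_eq_zero h1 (e (i, c)) (e (i, 1))
  rw [hz, hz, hz', hz', add_zero, add_zero, E.psi_one, map_one, mul_one] at h3
  by_contra hne
  have h4 : CMRep.cplx (E.psi c) = 1 := mul_left_cancel₀ hne (by rw [h3, mul_one])
  exact hc (CMRep.cplx.injective (by rw [h4, map_one]))

/-- Projections of units span the isotypical component, so some of them form a basis, of size n say.
In the n × d matrix of archimedean logarithms the rows and the columns are independent, whence n =
d. -/
theorem exists_isUnitBasis : ∃ u : Fin E.d → (𝓞 E.H)ˣ, E.IsUnitBasis u := by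
  obtain ⟨f, hf, hspan, hli⟩ := Submodule.exists_fun_fin_finrank_span_eq Qbar
    (Set.range E.unitProj)
  choose u hu using hf
  have hfu : f = fun k => E.unitProj (u k) := funext fun k => (hu k).symm
  rw [hfu] at hspan hli
  generalize Module.finrank Qbar (Submodule.span Qbar (Set.range E.unitProj)) = n at *
  have hn : n ≤ E.d := card_le_of_vecMul_injective
    (fun k i => E.archPsi (E.h i * ((1 : Fin E.d → E.G) i).1⁻¹) (u k))
    (fun x hx => E.row_eq_zero 1 hli hx)
  have hd : E.d ≤ n := by
    refine card_le_of_vecMul_injective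
      (fun i k => E.archPsi (E.h i * ((1 : Fin E.d → E.G) i).1⁻¹) (u k)) (fun y hy => ?_)
    refine E.column_eq_zero 1 fun v => ?_
    have hv : E.unitProj v ∈ Submodule.span Qbar (Set.range fun k => E.unitProj (u k)) := by
      rw [hspan]
      exact Submodule.subset_span ⟨v, rfl⟩
    obtain ⟨a, ha⟩ := (Submodule.mem_span_range_iff_exists_fun Qbar).mp hv
    have h1 : ∀ k, E.archPsi k v = ∑ l, CMRep.cplx (a l) * E.archPsi k (u l) := by
      intro k
      simp_rw [archPsi_eq_sum, ← ha, map_sum, Finset.sum_apply, map_smul, Pi.smul_apply,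
        smul_eq_mul, map_sum, map_mul, Finset.mul_sum, Finset.sum_mul]
      rw [Finset.sum_comm]
      simp_rw [mul_assoc]
    simp_rw [h1, Finset.mul_sum]
    rw [Finset.sum_comm]
    refine Finset.sum_eq_zero fun l _ => ?_
    simp_rw [mul_left_comm (y _), ← Finset.mul_sum]
    rw [hy, mul_zero]
  have hnd : n = E.d := le_antisymm hn hd
  subst hnd
  exact ⟨u, hli, hspan.trans E.span_unitProj⟩

theorem det_archPsi_ne_zero {u : Fin E.d → (𝓞 E.H)ˣ} (hu : E.IsUnitBasis u) :
    (Matrix.of fun k i => E.archPsi (E.h i * (s i).1⁻¹) (u k)).det ≠ 0 := by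
  intro h
  obtain ⟨x, hx0, hx⟩ := Matrix.exists_vecMul_eq_zero_iff.mpr h
  exact hx0 (E.row_eq_zero s hu.1 fun i => congrFun hx i)

/-- The p-adic and the archimedean matrix are the same ℚ̄-linear forms `a` in the logarithms of the
fundamental units, evaluated through `E.ι` and through `cplx`. Algebraic independence over ℚ
persists over the algebraic extension ℚ̄, so the non-vanishing of the archimedean determinant
transfers. -/
theorem det_padicPsi_ne_zero (schanuel : PadicSchanuel p E.ι) {u : Fin E.d → (𝓞 E.H)ˣ}
    (hu : E.IsUnitBasis u) :
    (Matrix.of fun k i => E.psiLog i (s i).1 (u k)).det ≠ 0 := by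
  let : Algebra Qbar (PadicAlgCl p) := E.ι.toAlgebra
  have : IsScalarTower ℚ Qbar (PadicAlgCl p) := IsScalarTower.of_algebraMap_eq fun x => by simp
  have hl : AlgebraicIndependent Qbar
      fun j => E.padicUnitLog (Additive.ofMul (fundSystem E.H j)) :=
    (E.algebraicIndependent_padicUnitLog schanuel).extendScalars Qbar
  let a : Fin E.d → Fin E.d → Fin (rank E.H) → Qbar := fun k i j =>
    ∑ c : E.C, E.psi c * (unitCoord E.H j
      (Additive.ofMul (E.unitAct (E.h i * (s i).1⁻¹ * c.1.1⁻¹) (u k))) : Qbar)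
  have key : ∀ {M : Type} [Field M] [CharZero M] (f : Qbar →+* M) (φ : Additive (𝓞 E.H)ˣ →+ M)
      (k i : Fin E.d), ∑ j, f (a k i j) * φ (Additive.ofMul (fundSystem E.H j)) =
      ∑ c : E.C, f (E.psi c) *
        φ (Additive.ofMul (E.unitAct (E.h i * (s i).1⁻¹ * c.1.1⁻¹) (u k))) := by
    intro M _ _ f φ k i
    simp_rw [a, map_sum, Finset.sum_mul]
    rw [Finset.sum_comm]
    refine Finset.sum_congr rfl fun c _ => ?_
    rw [hom_eq_sum_unitCoord φ, Finset.mul_sum]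
    refine Finset.sum_congr rfl fun j _ => ?_
    rw [zsmul_eq_mul, map_mul, map_intCast, mul_assoc]
  have h1 := det_ne_zero_of_algebraicIndependent hl a CMRep.cplx
    (fun j => E.archLog 1 (Additive.ofMul (fundSystem E.H j))) (by
      simp_rw [key CMRep.cplx (E.archLog 1), E.archLog_unitAct, one_mul]
      exact E.det_archPsi_ne_zero s hu)
  have h2 : ∀ k i, ∑ j, algebraMap Qbar (PadicAlgCl p) (a k i j) *
      E.padicUnitLog (Additive.ofMul (fundSystem E.H j)) = E.psiLog i (s i).1 (u k) := by
    intro k i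
    change ∑ j, E.ι (a k i j) * _ = _
    rw [key E.ι E.padicUnitLog, psiLog]
    refine Finset.sum_congr rfl fun c _ => ?_
    rw [L_diag, mul_inv_rev, mul_assoc]
  simp_rw [h2] at h1
  exact h1

end CMPoint

end HilbertCM

namespace HilbertCM

open NumberField NumberField.Units Filter Topology

namespace CMPoint

variable {p : ℕ} [Fact p.Prime] (E : CMPoint p)

/-! ### The functions `L_{i,g}` on `(𝓞_H ⊗ ℤ_p)^×` -/

theorem norm_embInt_le_one (i : Fin E.d) (g : E.GalH) (y : E.LocalInt) :
    ‖E.embInt i g y‖ ≤ 1 := by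
  induction y using TensorProduct.induction_on with
  | zero => rw [map_zero, norm_zero]; exact zero_le_one
  | add x y hx hy =>
    rw [map_add]
    exact (IsUltrametricDist.norm_add_le_max _ _).trans (max_le hx hy)
  | tmul x z =>
    rw [embInt_tmul, norm_mul, PadicAlgCl.norm_extends]
    refine mul_le_one₀ ?_ (norm_nonneg _) (PadicInt.norm_le_one z)
    exact E.norm_ι_int_le_one (RingOfIntegers.mapRingHom
      ((E.h i * g⁻¹ : E.GalH) : E.H →+* E.H) x)

theorem embInt_localUnitAct (i : Fin E.d) (g h : E.GalH) (u : E.LocalUnits) :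
    E.embInt i h (E.localUnitAct g⁻¹ u : E.LocalUnits) = E.embInt i (g * h) u := by
  change E.embInt i h (Algebra.TensorProduct.map
    (RingOfIntegers.mapRingHom ((g⁻¹ : E.GalH) : E.H →+* E.H)).toIntAlgHom
    (AlgHom.id ℤ ℤ_[p]) (u : E.LocalInt)) = _
  induction (u : E.LocalInt) using TensorProduct.induction_on with
  | zero => simp
  | add x y hx hy => rw [map_add, map_add, map_add, hx, hy]
  | tmul x z =>
    refine (E.embInt_tmul i h _ _).trans ((E.embInt_tmul i (g * h) x z).trans ?_).symm
    rw [mul_inv_rev, ← mul_assoc]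
    rfl

theorem L_localUnitAct (i : Fin E.d) (g h : E.GalH) (u : E.LocalUnits) :
    E.L i h (E.localUnitAct g⁻¹ u) = E.L i (g * h) u := by
  rw [L, L, embInt_localUnitAct]

/-- The ring is integral over the local ring ℤ_p, so every maximal ideal lies over (p) and p is in
the Jacobson radical. This supplies local units close to 1 in every direction. -/
theorem isUnit_prime_mul_add_one (y : E.LocalInt) : IsUnit ((p : E.LocalInt) * y + 1) := by
  let e : E.LocalInt ≃ₐ[ℤ] ℤ_[p] ⊗[ℤ] 𝓞 E.H := Algebra.TensorProduct.comm ℤ _ _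
  have hp : (p : ℤ_[p] ⊗[ℤ] 𝓞 E.H) ∈ (⊥ : Ideal (ℤ_[p] ⊗[ℤ] 𝓞 E.H)).jacobson := by
    rw [Ideal.jacobson, Submodule.mem_sInf]
    rintro (M : Ideal _) ⟨-, hM⟩
    have h1 : (Ideal.comap (algebraMap ℤ_[p] (ℤ_[p] ⊗[ℤ] 𝓞 E.H)) M).IsMaximal :=
      Ideal.isMaximal_comap_of_isIntegral_of_isMaximal M
    have h2 : (p : ℤ_[p]) ∈ Ideal.comap (algebraMap ℤ_[p] (ℤ_[p] ⊗[ℤ] 𝓞 E.H)) M := by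
      rw [IsLocalRing.eq_maximalIdeal h1, PadicInt.maximalIdeal_eq_span_p]
      exact Ideal.mem_span_singleton_self _
    rw [Ideal.mem_comap, map_natCast] at h2
    exact h2
  have h3 := Ideal.mem_jacobson_bot.mp hp (e y)
  have h4 : (p : ℤ_[p] ⊗[ℤ] 𝓞 E.H) * e y + 1 = e ((p : E.LocalInt) * y + 1) := by
    rw [map_add, map_mul, map_natCast, map_one]
  rw [h4] at h3
  exact (isUnit_map_iff e _).mp h3

/-- At the unit 1 + p^(k+1) y, divided by p^(k+1), the logarithms become linear in the limit. The
relation turns into one between the pairwise distinct embeddings ι ∘ h_i ∘ g⁻¹, which Dedekind's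
independence of characters forbids. -/
theorem eq_zero_of_sum_L {κ : Fin E.d → E.G → PadicAlgCl p}
    (h : ∀ u : E.LocalUnits, ∑ i, ∑ g : E.G, κ i g * E.L i g.1 u = 0) : κ = 0 := by
  let f : Fin E.d × E.G → (𝓞 E.H →* PadicAlgCl p) := fun ig =>
    ((E.ι.comp (algebraMap E.H Qbar)).comp ((((E.h ig.1 * ig.2.1⁻¹ : E.GalH) : E.H →+* E.H).comp
      (algebraMap (𝓞 E.H) E.H))) : 𝓞 E.H →* PadicAlgCl p)
  have hf : Function.Injective f := by
    rintro ⟨i, g⟩ ⟨j, g'⟩ hij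
    have h1 : E.h i * (g⁻¹).1 = E.h j * (g'⁻¹).1 := by
      apply AlgEquiv.ext
      intro x
      have h2 : ((E.h i * g.1⁻¹ : E.GalH) : E.H →+* E.H) =
          ((E.h j * g'.1⁻¹ : E.GalH) : E.H →+* E.H) := by
        refine IsLocalization.ringHom_ext (nonZeroDivisors (𝓞 E.H)) (RingHom.ext fun y => ?_)
        apply Subtype.ext
        exact E.ι.injective (DFunLike.congr_fun hij y)
      exact RingHom.congr_fun h2 x
    obtain ⟨rfl, h3⟩ := E.h_mul_injective h1
    rw [inv_inj] at h3
    rw [h3]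
  have hli := (linearIndependent_monoidHom (𝓞 E.H) (PadicAlgCl p)).comp f hf
  rw [Fintype.linearIndependent_iff] at hli
  have key : ∀ y : 𝓞 E.H, ∑ i, ∑ g : E.G, κ i g * f (i, g) y = 0 := by
    intro y
    have h1 : ∀ k : ℕ, ∃ u : E.LocalUnits, (u : E.LocalInt) =
        1 + (p : E.LocalInt) ^ (k + 1) * (y ⊗ₜ[ℤ] (1 : ℤ_[p])) := by
      intro k
      obtain ⟨u, hu⟩ := E.isUnit_prime_mul_add_one ((p : E.LocalInt) ^ k * (y ⊗ₜ[ℤ] (1 : ℤ_[p])))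
      exact ⟨u, by rw [hu]; ring⟩
    choose u hu using h1
    have h2 : ∀ (k : ℕ) (i : Fin E.d) (g : E.G), E.L i g.1 (u k) =
        padicLog p (1 + (p : PadicAlgCl p) ^ (k + 1) * f (i, g) y) := by
      intro k i g
      rw [L, hu, map_add, map_one, map_mul, map_pow, map_natCast, embInt_tmul, PadicInt.coe_one,
        map_one, mul_one]
      rfl
    have h3 : Tendsto (fun k : ℕ => ∑ i, ∑ g : E.G, κ i g *
        (padicLog p (1 + (p : PadicAlgCl p) ^ (k + 1) * f (i, g) y) /
          (p : PadicAlgCl p) ^ (k + 1))) atTop (𝓝 (∑ i, ∑ g : E.G, κ i g * f (i, g) y)) :=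
      tendsto_finsetSum _ fun i _ => tendsto_finsetSum _ fun g _ => Tendsto.const_mul _
        ((tendsto_padicLog_one_add (f (i, g) y)).comp (tendsto_add_atTop_nat 1))
    refine tendsto_nhds_unique h3 (tendsto_const_nhds.congr fun k => ?_)
    have h4 := h (u k)
    simp_rw [h2] at h4
    simp_rw [← mul_div_assoc, ← Finset.sum_div]
    rw [h4, zero_div]
  funext i g
  refine hli (fun ig => κ ig.1 ig.2) ?_ (i, g)
  funext y
  rw [Finset.sum_apply, Fintype.sum_prod_type]
  exact key y

/-- If a sum of elements `∑_g ρ(g) X_i ρ(g)⁻¹ L_{i,g}` vanishes, all matrices `X_i` vanish. -/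
theorem eq_zero_of_sum_orbit {X : Fin E.d → Mat p} (h : ∑ i, E.orbit i (X i) = 0) (i : Fin E.d) :
    X i = 0 := by
  have h1 : ∀ a b, (fun (i : Fin E.d) (g : E.G) => E.Ad g (X i) a b) = 0 := by
    intro a b
    refine E.eq_zero_of_sum_L fun u => ?_
    have h2 := congrFun (congrFun (congrFun h u) a) b
    rw [Finset.sum_apply, Matrix.sum_apply] at h2
    rw [Pi.zero_apply, Matrix.zero_apply] at h2
    rw [← h2]
    refine Finset.sum_congr rfl fun i _ => ?_
    rw [orbit, Matrix.sum_apply]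
    refine Finset.sum_congr rfl fun g _ => ?_
    rw [Matrix.smul_apply, smul_eq_mul, mul_comm]
  have h3 : E.Ad 1 (X i) = X i := by
    have := E.Ad_C 1 (X i)
    rw [E.psi_one, map_one, inv_one, one_mul, one_mul] at this
    refine this.trans ?_
    ext a b
    fin_cases a <;> fin_cases b <;> rfl
  rw [← h3]
  ext a b
  exact congrFun (congrFun (h1 a b) i) 1

end CMPoint

end HilbertCM

namespace HilbertCM

open NumberField Filter Topology

/-! ### Homomorphisms on ideles -/

section Ideles

variable (K : Type*) [Field K] [NumberField K]

/-- The inclusion of the infinite adeles into the adeles. -/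
def infToAdele : InfiniteAdeleRing K →* AdeleRing (𝓞 K) K where
  toFun x := (x, 1)
  map_one' := rfl
  map_mul' _ _ := Prod.ext rfl (mul_one (1 : FiniteAdeleRing (𝓞 K) K)).symm

theorem continuous_infToAdele : Continuous (infToAdele K) :=
  continuous_id.prodMk continuous_const

/-- The inclusion of the integral finite adeles into the adeles. -/
def finToAdele : (∀ v : HeightOneSpectrum (𝓞 K), v.adicCompletionIntegers K) →*
    AdeleRing (𝓞 K) K where
  toFun x := (1, (RestrictedProduct.structureMap (fun v : HeightOneSpectrum (𝓞 K) =>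
    v.adicCompletion K) (fun v => (v.adicCompletionIntegers K : Set (v.adicCompletion K)))
      cofinite x : FiniteAdeleRing (𝓞 K) K))
  map_one' := rfl
  map_mul' _ _ := Prod.ext (mul_one (1 : InfiniteAdeleRing K)).symm rfl

theorem continuous_finToAdele : Continuous (finToAdele K) :=
  continuous_const.prodMk RestrictedProduct.isEmbedding_structureMap.continuous

variable {K}

/-- The map that sends `x` to the adele with components `x` at the places in `S` and `1`
elsewhere. -/
def cut (S : Set (HeightOneSpectrum (𝓞 K))) :
    𝓞 K →* ∀ v : HeightOneSpectrum (𝓞 K), v.adicCompletionIntegers K :=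
  open Classical in
  { toFun := fun x v => if v ∈ S then algebraMap (𝓞 K) (v.adicCompletionIntegers K) x else 1
    map_one' := by
      funext v
      split_ifs <;> simp
    map_mul' := fun x y => by
      funext v
      simp only [Pi.mul_apply]
      split_ifs <;> simp }

theorem cut_of_mem {S : Set (HeightOneSpectrum (𝓞 K))} {v : HeightOneSpectrum (𝓞 K)}
    (hv : v ∈ S) (x : 𝓞 K) : cut S x v = algebraMap (𝓞 K) (v.adicCompletionIntegers K) x :=
  if_pos hv

theorem cut_of_notMem {S : Set (HeightOneSpectrum (𝓞 K))} {v : HeightOneSpectrum (𝓞 K)}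
    (hv : v ∉ S) (x : 𝓞 K) : cut S x v = 1 := if_neg hv

/-- The idele with components `u` at the places in `S` and `1` elsewhere. -/
def cutIdele (S : Set (HeightOneSpectrum (𝓞 K))) : (𝓞 K)ˣ →* (AdeleRing (𝓞 K) K)ˣ :=
  (Units.map (finToAdele K)).comp (Units.map (cut S))

/-- Applied with S the places above p: a homomorphism trivial on principal ideles will be shown to
kill the archimedean factor and the factor outside S, hence also the factor in S. -/
theorem principal_eq (S : Set (HeightOneSpectrum (𝓞 K))) (u : (𝓞 K)ˣ) :
    Units.map (algebraMap K (AdeleRing (𝓞 K) K) : K →* AdeleRing (𝓞 K) K)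
      (Units.map (algebraMap (𝓞 K) K : 𝓞 K →* K) u) =
    Units.map (infToAdele K) (Units.map (algebraMap K (InfiniteAdeleRing K) : K →* _)
      (Units.map (algebraMap (𝓞 K) K : 𝓞 K →* K) u)) * (cutIdele Sᶜ u * cutIdele S u) := by
  apply Units.ext
  refine Prod.ext ?_ (FiniteAdeleRing.ext _ fun v => ?_)
  · refine (mul_one _).symm.trans ?_
    exact congrArg _ (mul_one (1 : InfiniteAdeleRing K)).symm
  · have h : ((u : 𝓞 K) : v.adicCompletion K) =
        1 * ((cut Sᶜ (u : 𝓞 K) v : v.adicCompletion K) * (cut S (u : 𝓞 K) v)) := by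
      by_cases hv : v ∈ S
      · rw [cut_of_mem hv, cut_of_notMem (Set.notMem_compl_iff.mpr hv), one_mul]
        exact (one_mul _).symm
      · rw [cut_of_notMem hv, cut_of_mem (S := Sᶜ) hv, one_mul]
        exact (mul_one _).symm
    exact h

variable {p : ℕ} [Fact p.Prime] {Φ : Additive (AdeleRing (𝓞 K) K)ˣ →+ PadicAlgCl p}

/-- Multiplication by m preserves the p-adic norm, so the norms of the terms are constant and can
only tend to 0 if they are 0. -/
theorem eq_zero_of_tendsto_pow {A : Type*} [AddMonoid A] {f : A →+ PadicAlgCl p} {a : A}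
    {m : ℕ} (hm : ¬ p ∣ m) (h : Tendsto (fun k : ℕ => f (m ^ k • a)) atTop (𝓝 0)) : f a = 0 := by
  have h1 : ∀ k : ℕ, ‖f (m ^ k • a)‖ = ‖f a‖ := by
    intro k
    rw [map_nsmul, nsmul_eq_mul, norm_mul, Nat.cast_pow, norm_pow, norm_eq_one_of_coprime hm,
      one_pow, one_mul]
  have h2 := h.norm
  simp_rw [h1, norm_zero] at h2
  exact norm_eq_zero.mp (tendsto_nhds_unique tendsto_const_nhds h2)

/-- Through the exponential, the archimedean ideles of a totally complex field are a quotient of a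
real vector space. There f(y) = 2^n f(y/2^n) with ‖2^n‖ ≤ 1, so ‖f(y)‖ is at most ‖f(y/2^n)‖, which
tends to 0 by continuity. -/
theorem map_infToAdele (hK : IsTotallyComplex K)
    (hΦ : Continuous fun z : (AdeleRing (𝓞 K) K)ˣ => Φ (Additive.ofMul z))
    (a : (InfiniteAdeleRing K)ˣ) : Φ (Additive.ofMul (Units.map (infToAdele K) a)) = 0 := by
  have hc : ∀ v : InfinitePlace K, v.IsComplex := hK.isComplex
  let e : ∀ v : InfinitePlace K, v.Completion ≃+* ℂ := fun v =>
    InfinitePlace.Completion.ringEquivComplexOfIsComplex (hc v)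
  have he : ∀ v, Continuous (e v).symm := fun v =>
    (InfinitePlace.Completion.isometryEquivComplexOfIsComplex (hc v)).symm.continuous
  let ex : (InfinitePlace K → ℂ) → (InfiniteAdeleRing K)ˣ := fun y =>
    { val := fun v => (e v).symm (Complex.exp (y v))
      inv := fun v => (e v).symm (Complex.exp (-y v))
      val_inv := by
        funext v
        refine (map_mul (e v).symm _ _).symm.trans ?_
        rw [← Complex.exp_add, add_neg_cancel, Complex.exp_zero, map_one]
        rfl
      inv_val := by
        funext v
        refine (map_mul (e v).symm _ _).symm.trans ?_
        rw [← Complex.exp_add, neg_add_cancel, Complex.exp_zero, map_one]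
        rfl }
  have hex : Continuous ex := by
    refine Units.continuous_iff.mpr ⟨continuous_pi fun v => ?_, continuous_pi fun v => ?_⟩
    · exact (he v).comp (Complex.continuous_exp.comp (continuous_apply v))
    · exact (he v).comp (Complex.continuous_exp.comp (continuous_apply v).neg)
  have hmul : ∀ y y', ex (y + y') = ex y * ex y' := by
    intro y y'
    apply Units.ext
    funext v
    refine Eq.trans ?_ (map_mul (e v).symm _ _)
    change (e v).symm (Complex.exp (y v + y' v)) = _
    rw [Complex.exp_add]
  have hone : ex 0 = 1 := by
    have h := hmul 0 0
    rw [add_zero] at h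
    exact (left_eq_mul.mp h)
  let f : (InfinitePlace K → ℂ) →+ PadicAlgCl p :=
    { toFun := fun y => Φ (Additive.ofMul (Units.map (infToAdele K) (ex y)))
      map_zero' := by rw [hone, map_one, ofMul_one, map_zero]
      map_add' := fun y y' => by rw [hmul, map_mul, ofMul_mul, map_add] }
  have hf : Continuous f := hΦ.comp ((continuous_infToAdele K).units_map.comp hex)
  have hf0 : ∀ y, f y = 0 := by
    intro y
    have h1 : ∀ n : ℕ, ‖f y‖ ≤ ‖f (((2 : ℝ) ^ n)⁻¹ • y)‖ := by
      intro n
      have h2 : y = (2 ^ n : ℕ) • (((2 : ℝ) ^ n)⁻¹ • y) := by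
        rw [← Nat.cast_smul_eq_nsmul ℝ, smul_smul]
        push_cast
        rw [mul_inv_cancel₀ (by positivity), one_smul]
      nth_rewrite 1 [h2]
      rw [map_nsmul, nsmul_eq_mul, norm_mul]
      exact mul_le_of_le_one_left (norm_nonneg _) (norm_natCast_le_one _)
    have h3 : Tendsto (fun n : ℕ => ‖f (((2 : ℝ) ^ n)⁻¹ • y)‖) atTop (𝓝 ‖f 0‖) := by
      refine ((hf.norm.tendsto 0).comp ?_)
      have h4 : Tendsto (fun n : ℕ => ((2 : ℝ) ^ n)⁻¹) atTop (𝓝 0) := by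
        simp_rw [← inv_pow]
        exact tendsto_pow_atTop_nhds_zero_of_lt_one (by norm_num) (by norm_num)
      simpa using h4.smul_const y
    rw [map_zero, norm_zero] at h3
    exact norm_le_zero_iff.mp (ge_of_tendsto' h3 h1)
  have hsurj : ∃ y, ex y = a := by
    have h1 : ∀ v, (a : InfiniteAdeleRing K) v ≠ 0 := by
      intro v h0
      have h2 : (a : InfiniteAdeleRing K) v * ((a⁻¹ : (InfiniteAdeleRing K)ˣ) :
          InfiniteAdeleRing K) v = 1 := congrFun a.mul_inv v
      rw [h0, zero_mul] at h2
      exact zero_ne_one h2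
    refine ⟨fun v => Complex.log (e v ((a : InfiniteAdeleRing K) v)), Units.ext ?_⟩
    funext v
    change (e v).symm (Complex.exp (Complex.log (e v ((a : InfiniteAdeleRing K) v)))) = _
    rw [Complex.exp_log ((map_ne_zero_iff _ (e v).injective).mpr (h1 v)), RingEquiv.symm_apply_apply]
  obtain ⟨y, rfl⟩ := hsurj
  exact hf0 y

end Ideles

end HilbertCM

namespace HilbertCM

open NumberField Filter Topology

/-! ### Homomorphisms on ideles kill global units away from p. -/

section Ideles

variable {K : Type*} [Field K] [NumberField K]

theorem tendsto_of_forall_pow_dvd {v : HeightOneSpectrum (𝓞 K)} {m : 𝓞 K} (hm : m ∈ v.asIdeal)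
    {x : ℕ → 𝓞 K} (h : ∀ k, m ^ k ∣ x k - 1) :
    Tendsto (fun k => algebraMap (𝓞 K) (v.adicCompletionIntegers K) (x k)) atTop (𝓝 1) := by
  rw [tendsto_subtype_rng]
  have h1 : Tendsto (fun k => (((m : K) : v.adicCompletion K)) ^ k) atTop (𝓝 0) := by
    apply Valued.tendsto_zero_pow_of_v_lt_one
    rw [HeightOneSpectrum.valuedAdicCompletion_eq_valuation']
    exact (v.valuation_lt_one_iff_mem m).mpr hm
  have h2 : Tendsto (fun k => (((x k : 𝓞 K) : K) : v.adicCompletion K) - 1) atTop (𝓝 0) := by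
    rw [(Valued.hasBasis_nhds_zero _ _).tendsto_right_iff] at h1 ⊢
    intro γ _
    filter_upwards [h1 γ trivial] with k hk
    obtain ⟨c, hc⟩ := h k
    have h3 : (((x k : 𝓞 K) : K) : v.adicCompletion K) - 1 =
        (((m : K) : v.adicCompletion K)) ^ k * ((c : K) : v.adicCompletion K) := by
      have := congrArg (algebraMap (𝓞 K) (v.adicCompletion K)) hc
      rw [map_sub, map_one, map_mul, map_pow] at this
      exact this
    refine lt_of_le_of_lt ?_ hk
    rw [h3, Valuation.restrict_le_iff, map_mul]
    refine mul_le_of_le_one_right' ?_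
    rw [HeightOneSpectrum.valuedAdicCompletion_eq_valuation']
    exact v.valuation_le_one c
  have h4 := h2.add_const 1
  simp only [sub_add_cancel, zero_add] at h4
  exact h4

theorem tendsto_units_finToAdele
    {x : ℕ → (∀ v : HeightOneSpectrum (𝓞 K), v.adicCompletionIntegers K)ˣ}
    {y : (∀ v : HeightOneSpectrum (𝓞 K), v.adicCompletionIntegers K)ˣ}
    (h1 : ∀ v, Tendsto (fun k => (x k).1 v) atTop (𝓝 (y.1 v)))
    (h2 : ∀ v, Tendsto (fun k => ((x k)⁻¹).1 v) atTop (𝓝 (y⁻¹.1 v))) :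
    Tendsto (fun k => Units.map (finToAdele K) (x k)) atTop
      (𝓝 (Units.map (finToAdele K) y)) := by
  refine ((continuous_finToAdele K).units_map.tendsto y).comp ?_
  rw [Units.isInducing_embedProduct.tendsto_nhds_iff]
  refine Tendsto.prodMk_nhds (tendsto_pi_nhds.mpr h1) ?_
  exact (MulOpposite.continuous_op.tendsto _).comp (tendsto_pi_nhds.mpr h2)

theorem exists_pow_sub_one_dvd {m : ℕ} (hm : m ≠ 0) (u : (𝓞 K)ˣ) :
    ∃ n : ℕ, 0 < n ∧ ∀ a : ℤ, (m : 𝓞 K) ∣ (((u ^ a) ^ n : (𝓞 K)ˣ) : 𝓞 K) - 1 := by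
  have h1 : Ideal.span {(m : 𝓞 K)} ≠ ⊥ := by
    rw [Ne, Ideal.span_singleton_eq_bot]
    exact_mod_cast hm
  have : Finite (𝓞 K ⧸ Ideal.span {(m : 𝓞 K)}) := Ideal.finiteQuotientOfFreeOfNeBot _ h1
  let f : (𝓞 K)ˣ →* (𝓞 K ⧸ Ideal.span {(m : 𝓞 K)})ˣ :=
    Units.map (Ideal.Quotient.mk (Ideal.span {(m : 𝓞 K)}) : 𝓞 K →* _)
  obtain ⟨n, hn, h2⟩ := (isOfFinOrder_of_finite (f u)).exists_pow_eq_one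
  refine ⟨n, hn, fun a => ?_⟩
  rw [← Ideal.mem_span_singleton, ← Ideal.Quotient.eq, map_one]
  have h3 : f ((u ^ a) ^ n) = 1 := by
    rw [← zpow_natCast, zpow_comm, map_zpow, zpow_natCast, map_pow, h2, one_zpow]
  exact congrArg Units.val h3

variable {p : ℕ} [Fact p.Prime] {Φ : Additive (AdeleRing (𝓞 K) K)ˣ →+ PadicAlgCl p}

/-- Some power u^n is 1 modulo m, so u^(n m^k) is 1 modulo m^k and the corresponding ideles tend to
1. Since m is a p-adic unit, Φ must vanish on them, and n can be divided out in ℚ̄_p. -/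
theorem map_cutIdele_of_natCast
    (hΦ : Continuous fun z : (AdeleRing (𝓞 K) K)ˣ => Φ (Additive.ofMul z))
    {m : ℕ} (hm : ¬ p ∣ m) (u : (𝓞 K)ˣ) :
    Φ (Additive.ofMul (cutIdele {v | (m : 𝓞 K) ∈ v.asIdeal} u)) = 0 := by
  have hm0 : m ≠ 0 := by
    rintro rfl
    exact hm (dvd_zero p)
  set S : Set (HeightOneSpectrum (𝓞 K)) := {v | (m : 𝓞 K) ∈ v.asIdeal} with hS
  obtain ⟨n, hn, h1⟩ := exists_pow_sub_one_dvd hm0 u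
  -- The exponents a = 1 and a = -1 are both used: convergence in the topology of a unit group
  -- requires convergence of the inverses.
  have h2 : ∀ (a : ℤ) (v : HeightOneSpectrum (𝓞 K)),
      Tendsto (fun k : ℕ => (cut S ((((u ^ a) ^ n) ^ m ^ k : (𝓞 K)ˣ) : 𝓞 K)) v) atTop (𝓝 1) := by
    intro a v
    by_cases hv : v ∈ S
    · simp_rw [cut_of_mem hv]
      refine tendsto_of_forall_pow_dvd hv fun k => ?_
      have h3 := dvd_sub_pow_of_dvd_sub (h1 a) k
      rw [one_pow] at h3
      rw [Units.val_pow_eq_pow_val]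
      exact (pow_dvd_pow _ k.le_succ).trans h3
    · simp_rw [cut_of_notMem hv]
      exact tendsto_const_nhds
  have h3 : Tendsto (fun k : ℕ => Φ (m ^ k • Additive.ofMul (cutIdele S (u ^ n)))) atTop
      (𝓝 0) := by
    have h4 : Tendsto (fun k : ℕ => cutIdele S ((u ^ n) ^ m ^ k)) atTop (𝓝 1) := by
      rw [← map_one (Units.map (finToAdele K))]
      refine tendsto_units_finToAdele (fun v => ?_) fun v => ?_
      · simpa using h2 1 v
      · have h5 := h2 (-1) v
        simp only [zpow_neg, zpow_one, inv_pow] at h5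
        rw [inv_one]
        refine h5.congr fun k => ?_
        rw [← map_inv]
        rfl
    have h5 := (hΦ.tendsto 1).comp h4
    rw [ofMul_one, map_zero] at h5
    refine h5.congr fun k => ?_
    rw [Function.comp_apply, map_pow _ _ (m ^ k), ofMul_pow]
  have h6 := eq_zero_of_tendsto_pow hm h3
  rw [map_pow, ofMul_pow, map_nsmul, nsmul_eq_mul, mul_eq_zero, Nat.cast_eq_zero] at h6
  exact h6.resolve_left hn.ne'

/-- All places away from p are exhausted by the places dividing `m k`, the product of the primes
below k other than p. At each place the truncated ideles are eventually constant, so they converge,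
and continuity passes the vanishing to the limit. -/
theorem map_cutIdele
    (hΦ : Continuous fun z : (AdeleRing (𝓞 K) K)ˣ => Φ (Additive.ofMul z)) (u : (𝓞 K)ˣ) :
    Φ (Additive.ofMul (cutIdele {v | (p : 𝓞 K) ∈ v.asIdeal}ᶜ u)) = 0 := by
  have hp := (Fact.out : p.Prime)
  let m : ℕ → ℕ := fun k => ∏ ℓ ∈ (Finset.range k).filter fun ℓ => ℓ.Prime ∧ ℓ ≠ p, ℓ
  have hm : ∀ k, ¬ p ∣ m k := by
    intro k h
    obtain ⟨ℓ, hℓ, h1⟩ := (Prime.dvd_finsetProd_iff hp.prime _).mp h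
    obtain ⟨-, h2, h3⟩ := Finset.mem_filter.mp hℓ
    exact h3 ((Nat.prime_dvd_prime_iff_eq hp h2).mp h1).symm
  have key : ∀ v : HeightOneSpectrum (𝓞 K),
      ∀ᶠ k in atTop, ((m k : 𝓞 K) ∈ v.asIdeal ↔ (p : 𝓞 K) ∉ v.asIdeal) := by
    intro v
    by_cases hv : (p : 𝓞 K) ∈ v.asIdeal
    · refine Eventually.of_forall fun k => iff_of_false (fun h => ?_) (fun h => h hv)
      have h1 : IsCoprime ((p : ℤ)) (m k : ℤ) := by
        rw [Nat.isCoprime_iff_coprime]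
        exact (Nat.Prime.coprime_iff_not_dvd hp).mpr (hm k)
      obtain ⟨a, b, hab⟩ := h1
      apply v.isPrime.ne_top
      rw [Ideal.eq_top_iff_one]
      have h2 := congrArg (Int.cast : ℤ → 𝓞 K) hab
      push_cast at h2
      rw [← h2]
      exact v.asIdeal.add_mem (v.asIdeal.mul_mem_left _ hv) (v.asIdeal.mul_mem_left _ h)
    · have h0 : ∃ n : ℕ, n ≠ 0 ∧ (n : 𝓞 K) ∈ v.asIdeal := by
        refine ⟨Ideal.absNorm v.asIdeal, ?_, Ideal.absNorm_mem _⟩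
        rw [Ne, Ideal.absNorm_eq_zero_iff]
        exact v.ne_bot
      obtain ⟨n, hn0, hn⟩ := h0
      have h1 : ∃ ℓ : ℕ, ℓ.Prime ∧ (ℓ : 𝓞 K) ∈ v.asIdeal := by
        have h2 : ((n.primeFactorsList.map (fun ℓ : ℕ => (ℓ : 𝓞 K))).prod) ∈ v.asIdeal := by
          rw [← Nat.cast_list_prod, Nat.prod_primeFactorsList hn0]
          exact hn
        obtain ⟨x, hx, hxv⟩ := (v.isPrime.multiset_prod_mem_iff_exists_mem
          (n.primeFactorsList.map (fun ℓ : ℕ => (ℓ : 𝓞 K)) : Multiset (𝓞 K))).mp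
            (by rwa [Multiset.prod_coe])
        rw [Multiset.mem_coe] at hx
        obtain ⟨ℓ, hℓ, rfl⟩ := List.mem_map.mp hx
        exact ⟨ℓ, Nat.prime_of_mem_primeFactorsList hℓ, hxv⟩
      obtain ⟨ℓ, hℓ, hℓv⟩ := h1
      filter_upwards [eventually_gt_atTop ℓ] with k hk
      refine iff_of_true ?_ hv
      have h3 : ℓ ∣ m k := Finset.dvd_prod_of_mem _
        (Finset.mem_filter.mpr ⟨Finset.mem_range.mpr hk, hℓ, by rintro rfl; exact hv hℓv⟩)
      exact v.asIdeal.mem_of_dvd (Nat.cast_dvd_cast h3) hℓv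
  have h1 : ∀ (x : 𝓞 K) (v : HeightOneSpectrum (𝓞 K)),
      Tendsto (fun k => cut {v | (m k : 𝓞 K) ∈ v.asIdeal} x v) atTop
        (𝓝 (cut {v | (p : 𝓞 K) ∈ v.asIdeal}ᶜ x v)) := by
    intro x v
    refine tendsto_const_nhds.congr' ?_
    filter_upwards [key v] with k hk
    by_cases hv : (p : 𝓞 K) ∈ v.asIdeal
    · rw [cut_of_notMem (Set.notMem_compl_iff.mpr hv), cut_of_notMem (fun h => hk.mp h hv)]
    · rw [cut_of_mem (S := {v | (p : 𝓞 K) ∈ v.asIdeal}ᶜ) hv, cut_of_mem (hk.mpr hv)]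
  have h2 : Tendsto (fun k => cutIdele {v | (m k : 𝓞 K) ∈ v.asIdeal} u) atTop
      (𝓝 (cutIdele {v | (p : 𝓞 K) ∈ v.asIdeal}ᶜ u)) := by
    refine tendsto_units_finToAdele (fun v => h1 u v) fun v => ?_
    have h3 := h1 (u⁻¹ : (𝓞 K)ˣ) v
    simp_rw [← map_inv]
    exact h3
  have h3 := (hΦ.tendsto _).comp h2
  refine tendsto_nhds_unique h3 (tendsto_const_nhds.congr fun k => ?_)
  exact (map_cutIdele_of_natCast hΦ (hm k) u).symm

end Ideles

namespace CMPoint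

variable {p : ℕ} [Fact p.Prime] (E : CMPoint p)

theorem isIdeleOf_diag (u : (𝓞 E.H)ˣ) :
    E.IsIdeleOf (E.diag u) (cutIdele {v | (p : 𝓞 E.H) ∈ v.asIdeal} u) := by
  refine ⟨rfl, fun v hv => ?_, fun N => ⟨u, 0, ?_, fun v hv => ?_⟩⟩
  · exact congrArg Subtype.val (cut_of_notMem hv (u : 𝓞 E.H))
  · rw [mul_zero, add_zero]
    rfl
  · have h : ((cutIdele {v | (p : 𝓞 E.H) ∈ v.asIdeal} u : E.Ideles) :
        AdeleRing (𝓞 E.H) E.H).2 v = (((u : 𝓞 E.H) : E.H) : v.adicCompletion E.H) :=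
      congrArg Subtype.val (cut_of_mem (S := {v | (p : 𝓞 E.H) ∈ v.asIdeal}) hv (u : 𝓞 E.H))
    rw [h, sub_self, map_zero]
    exact zero_le

/-- The restriction to `(𝓞_H ⊗ ℤ_p)^×` of a homomorphism on the idele class group vanishes on
global units. -/
theorem apply_diag_of_mem_galoisHom {φ : E.LocalUnits → PadicAlgCl p} (hφ : φ ∈ E.galoisHom)
    (u : (𝓞 E.H)ˣ) : φ (E.diag u) = 0 := by
  obtain ⟨Φ, h1, h2, h3⟩ := hφ
  rw [h3 _ _ (E.isIdeleOf_diag u)]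
  have h4 := h2 (Units.map (algebraMap (𝓞 E.H) E.H : 𝓞 E.H →* E.H) u)
  rw [principal_eq {v | (p : 𝓞 E.H) ∈ v.asIdeal} u, ofMul_mul, ofMul_mul, map_add, map_add,
    map_infToAdele inferInstance h1, map_cutIdele h1, zero_add, zero_add] at h4
  exact h4

end CMPoint

end HilbertCM

namespace HilbertCM

open NumberField Filter Topology

/-! ### Extension of p-adic embeddings to completions. -/

theorem natCast_coe {K : Type*} [Field K] (n : ℕ) : ((n : 𝓞 K) : K) = n :=
  map_natCast (algebraMap (𝓞 K) K) n

theorem norm_map_int_le_one {p : ℕ} [Fact p.Prime] {K : Type*} [Field K]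
    (τ : K →+* PadicAlgCl p) (x : 𝓞 K) : ‖τ x‖ ≤ 1 :=
  norm_le_one_of_isIntegral (x.isIntegral_coe.map τ.toIntAlgHom)

section PadicEmbedding

variable {p : ℕ} [Fact p.Prime] {K : Type*} [Field K] [NumberField K] (τ : K →+* PadicAlgCl p)

/-- The prime induced by an embedding into an algebraic closure of `ℚ_[p]`. -/
def inducedPrime : HeightOneSpectrum (𝓞 K) where
  asIdeal :=
    { carrier := {x | ‖τ x‖ < 1}
      add_mem' := fun {x y} hx hy => by
        change ‖τ ((x : K) + (y : K))‖ < 1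
        rw [map_add]
        exact (IsUltrametricDist.norm_add_le_max _ _).trans_lt (max_lt hx hy)
      zero_mem' := by simp
      smul_mem' := fun c x hx => by
        change ‖τ ((c : K) * (x : K))‖ < 1
        rw [map_mul, norm_mul]
        exact mul_lt_one_of_nonneg_of_lt_one_right (norm_map_int_le_one τ c) (norm_nonneg _) hx }
  isPrime := by
    refine Ideal.isPrime_iff.mpr ⟨fun h => ?_, fun {x y} hxy => ?_⟩
    · rw [Ideal.eq_top_iff_one] at h
      change ‖τ ((1 : 𝓞 K) : K)‖ < 1 at h
      simp at h
    · by_contra! h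
      have hx : 1 ≤ ‖τ x‖ := not_lt.mp h.1
      have hy : 1 ≤ ‖τ y‖ := not_lt.mp h.2
      have h1 : ‖τ ((x : K) * (y : K))‖ < 1 := hxy
      rw [map_mul, norm_mul] at h1
      nlinarith
  ne_bot := by
    intro h
    have h1 : (p : 𝓞 K) ∈ (⊥ : Ideal (𝓞 K)) := by
      rw [← h]
      change ‖τ ((p : 𝓞 K) : K)‖ < 1
      rw [natCast_coe, map_natCast]
      exact norm_prime_lt_one
    rw [Ideal.mem_bot, Nat.cast_eq_zero] at h1
    exact (Fact.out : p.Prime).ne_zero h1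

theorem mem_inducedPrime {x : 𝓞 K} : x ∈ (inducedPrime τ).asIdeal ↔ ‖τ x‖ < 1 := Iff.rfl

theorem prime_mem_inducedPrime : (p : 𝓞 K) ∈ (inducedPrime τ).asIdeal := by
  rw [mem_inducedPrime, natCast_coe, map_natCast]
  exact norm_prime_lt_one

theorem norm_map_le_one {x : K} (hx : (inducedPrime τ).valuation K x ≤ 1) : ‖τ x‖ ≤ 1 := by
  obtain ⟨n, d, h⟩ := HeightOneSpectrum.exists_primeCompl_mul_eq_of_integer _ x hx
  have hd : ‖τ (d : 𝓞 K)‖ = 1 :=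
    le_antisymm (norm_map_int_le_one τ _) (not_lt.mp d.2)
  have h1 := congrArg (fun y => ‖τ y‖) h
  simp only [map_mul, norm_mul] at h1
  have h2 : ‖τ x‖ = ‖τ (n : K)‖ := by
    rw [← mul_one ‖τ x‖, ← hd]
    exact h1
  rw [h2]
  exact norm_map_int_le_one τ n

theorem norm_map_le_of_valuation_le {x y : K} (hy : y ≠ 0)
    (hx : (inducedPrime τ).valuation K x ≤ (inducedPrime τ).valuation K y) : ‖τ x‖ ≤ ‖τ y‖ := by
  have h1 : ‖τ (x / y)‖ ≤ 1 := by
    apply norm_map_le_one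
    rw [map_div₀]
    exact div_le_one_of_le₀ hx zero_le
  rwa [map_div₀, norm_div, div_le_one (norm_pos_iff.mpr ((map_ne_zero τ).mpr hy))] at h1

theorem continuous_map_withVal : Continuous
    (τ.comp (WithVal.equiv ((inducedPrime τ).valuation K)).toRingHom) := by
  refine continuous_of_continuousAt_zero _ ?_
  rw [ContinuousAt, map_zero, Metric.tendsto_nhds]
  intro ε hε
  obtain ⟨N, hN⟩ := exists_pow_lt_of_lt_one hε (norm_prime_lt_one (p := p))
  have hp0 : ((p : K) ^ N) ≠ 0 :=
    pow_ne_zero _ (Nat.cast_ne_zero.mpr (Fact.out : p.Prime).ne_zero)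
  have hmem : {x : WithVal ((inducedPrime τ).valuation K) |
      Valued.v x < Valued.v ((WithVal.equiv ((inducedPrime τ).valuation K)).symm ((p : K) ^ N))} ∈
      𝓝 (0 : WithVal ((inducedPrime τ).valuation K)) := by
    rw [Valued.mem_nhds_zero]
    refine ⟨Units.mk0 (Valued.v.restrict
      ((WithVal.equiv ((inducedPrime τ).valuation K)).symm ((p : K) ^ N))) ?_, fun x hx => ?_⟩
    · rw [Ne, Valuation.restrict_eq_zero_iff, map_eq_zero]
      simpa using hp0
    · exact (Valuation.restrict_lt_iff _).mp hx
  filter_upwards [hmem] with x hx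
  rw [dist_zero_right]
  refine lt_of_le_of_lt (norm_map_le_of_valuation_le τ hp0 (le_of_lt hx)) ?_
  rwa [map_pow, map_natCast, norm_pow]

theorem exists_finiteDimensional_range : ∃ L : IntermediateField ℚ_[p] (PadicAlgCl p),
    FiniteDimensional ℚ_[p] L ∧ ∀ x, τ x ∈ L := by
  let b := Module.finBasis ℚ K
  refine ⟨IntermediateField.adjoin ℚ_[p] (Set.range fun i => τ (b i)),
    IntermediateField.finiteDimensional_adjoin fun x _ => Algebra.IsIntegral.isIntegral x,
    fun x => ?_⟩
  rw [← b.sum_repr x, map_sum]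
  refine sum_mem fun i _ => ?_
  rw [Algebra.smul_def, map_mul]
  refine mul_mem ?_ (IntermediateField.subset_adjoin _ _ ⟨i, rfl⟩)
  rw [eq_ratCast, map_ratCast]
  exact SubfieldClass.ratCast_mem _ _

/-- The image of a number field generates a finite extension L of ℚ_p, which is complete. The
continuous map into L extends to the completion. -/
theorem exists_extension : ∃ f : (inducedPrime τ).adicCompletion K →+* PadicAlgCl p,
    Continuous f ∧ ∀ x : K, f (x : (inducedPrime τ).adicCompletion K) = τ x := by
  obtain ⟨L, hL, hτ⟩ := exists_finiteDimensional_range τ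
  have : CompleteSpace L := FiniteDimensional.complete ℚ_[p] L
  let τ' : WithVal ((inducedPrime τ).valuation K) →+* L :=
    (τ.comp (WithVal.equiv ((inducedPrime τ).valuation K)).toRingHom).codRestrict L
      fun x => hτ _
  have hc : Continuous τ' := (continuous_map_withVal τ).subtype_mk _
  refine ⟨(L.val : L →+* PadicAlgCl p).comp ((UniformSpace.Completion.extensionHom τ' hc).comp
    (HeightOneSpectrum.adicCompletion.equiv K (inducedPrime τ)).toRingHom), ?_, fun x => ?_⟩
  · exact continuous_subtype_val.comp (UniformSpace.Completion.continuous_extension.comp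
      (HeightOneSpectrum.adicCompletion.continuous_toCompletion K _))
  · exact congrArg Subtype.val (UniformSpace.Completion.extensionHom_coe τ' hc _)

/-- The continuous extension of an embedding to the completion. -/
def completedEmbedding : (inducedPrime τ).adicCompletion K →+* PadicAlgCl p :=
  (exists_extension τ).choose

theorem continuous_completedEmbedding : Continuous (completedEmbedding τ) :=
  (exists_extension τ).choose_spec.1

theorem completedEmbedding_coe (x : K) :
    completedEmbedding τ (x : (inducedPrime τ).adicCompletion K) = τ x :=
  (exists_extension τ).choose_spec.2 x

/-- If the image had norm greater than 1, some p·z^k would have valuation below 1 but image of norm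
above 1. Its powers tend to 0 while their images do not, against continuity. -/
theorem norm_completedEmbedding_le_one {z : (inducedPrime τ).adicCompletion K}
    (hz : Valued.v z ≤ 1) : ‖completedEmbedding τ z‖ ≤ 1 := by
  by_contra! h
  obtain ⟨k, hk⟩ := pow_unbounded_of_one_lt ‖(p : PadicAlgCl p)‖⁻¹ h
  have hp : Valued.v ((p : K) : (inducedPrime τ).adicCompletion K) < 1 := by
    rw [HeightOneSpectrum.valuedAdicCompletion_eq_valuation']
    exact ((inducedPrime τ).valuation_lt_one_iff_mem (K := K) (p : 𝓞 K)).mpr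
      (prime_mem_inducedPrime τ)
  have h1 : Valued.v (((p : K) : (inducedPrime τ).adicCompletion K) * z ^ k) < 1 := by
    rw [map_mul, map_pow]
    exact (mul_le_of_le_one_right' (pow_le_one' hz k)).trans_lt hp
  have h2 := ((continuous_completedEmbedding τ).tendsto 0).comp
    (Valued.tendsto_zero_pow_of_v_lt_one h1)
  have h3 : 1 < ‖completedEmbedding τ (((p : K) : (inducedPrime τ).adicCompletion K) * z ^ k)‖ := by
    rw [map_mul, map_pow, completedEmbedding_coe, map_natCast, norm_mul, norm_pow]
    rwa [inv_lt_iff_one_lt_mul₀' (norm_pos_iff.mpr prime_ne_zero')] at hk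
  rw [map_zero] at h2
  have h4 := h2.norm
  rw [norm_zero] at h4
  refine absurd (ge_of_tendsto' h4 fun n => ?_) (not_le.mpr zero_lt_one)
  rw [Function.comp_apply, map_pow, norm_pow]
  exact one_le_pow₀ h3.le

theorem norm_completedEmbedding_eq_one {z : (inducedPrime τ).adicCompletion K}
    (hz : Valued.v z = 1) : ‖completedEmbedding τ z‖ = 1 := by
  refine le_antisymm (norm_completedEmbedding_le_one τ hz.le) ?_
  have h1 : ‖completedEmbedding τ z⁻¹‖ ≤ 1 :=
    norm_completedEmbedding_le_one τ (by rw [map_inv₀, hz, inv_one])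
  rw [map_inv₀, norm_inv] at h1
  have h0 : z ≠ 0 := by
    rintro rfl
    rw [map_zero] at hz
    exact zero_ne_one hz
  exact (inv_le_one₀ (norm_pos_iff.mpr ((map_ne_zero _).mpr h0))).mp h1

theorem norm_completedEmbedding_le {z : (inducedPrime τ).adicCompletion K} {N : ℕ}
    (hz : Valued.v z ≤ Valued.v (((p : K) ^ N : K) : (inducedPrime τ).adicCompletion K)) :
    ‖completedEmbedding τ z‖ ≤ ‖(p : PadicAlgCl p)‖ ^ N := by
  have h1 : ‖completedEmbedding τ (z / (((p : K) ^ N : K) :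
      (inducedPrime τ).adicCompletion K))‖ ≤ 1 := by
    apply norm_completedEmbedding_le_one
    rw [map_div₀]
    exact div_le_one_of_le₀ hz zero_le
  rw [map_div₀, norm_div, completedEmbedding_coe, map_pow, map_natCast, norm_pow] at h1
  exact (div_le_one (pow_pos (norm_pos_iff.mpr prime_ne_zero') N)).mp h1

end PadicEmbedding

end HilbertCM

namespace HilbertCM

/-! ### Sums of logarithms as homomorphisms on the idele class group. -/

open NumberField Filter Topology

/-- A homomorphism from a subgroup `U` to a divisible group that vanishes on the elements of a
subgroup `P` extends to a homomorphism that vanishes on `P`. -/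
theorem exists_extension_vanishing {A Q : Type*} [AddCommGroup A] [AddCommGroup Q]
    [DivisibleBy Q ℤ] (U P : AddSubgroup A) (f : U →+ Q) (h : ∀ x : U, (x : A) ∈ P → f x = 0) :
    ∃ Φ : A →+ Q, (∀ x : U, Φ x = f x) ∧ ∀ x ∈ P, Φ x = 0 := by
  let g : U →+ A ⧸ P := (QuotientAddGroup.mk' P).comp U.subtype
  have hg : ∀ x : U, x ∈ g.ker → x ∈ f.ker := fun x hx =>
    h x ((QuotientAddGroup.eq_zero_iff (x : A)).mp hx)
  -- A divisible group is an injective ℤ-module. The map `f` factors through the image of U in A/P,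
  -- which embeds in A/P, and extends from there.
  obtain ⟨Ψ, hΨ⟩ := (Module.Baer.of_divisible Q).extension_property_addMonoidHom
    (QuotientAddGroup.kerLift g) (QuotientAddGroup.kerLift_injective g)
    (QuotientAddGroup.lift g.ker f hg)
  refine ⟨Ψ.comp (QuotientAddGroup.mk' P), fun x => ?_, fun x hx => ?_⟩
  · exact DFunLike.congr_fun hΨ (QuotientAddGroup.mk x)
  · rw [AddMonoidHom.comp_apply, QuotientAddGroup.mk'_apply,
      (QuotientAddGroup.eq_zero_iff x).mpr hx, map_zero]

theorem continuousAt_padicLog {p : ℕ} [Fact p.Prime] :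
    ContinuousAt (padicLog p) (1 : PadicAlgCl p) := by
  rw [ContinuousAt, padicLog_one, tendsto_zero_iff_norm_tendsto_zero]
  have h1 : Tendsto (fun y : PadicAlgCl p => ‖y - 1‖) (𝓝 1) (𝓝 0) := by
    have h2 : Continuous fun y : PadicAlgCl p => ‖y - 1‖ := by fun_prop
    simpa using h2.tendsto 1
  refine tendsto_of_tendsto_of_tendsto_of_le_of_le' tendsto_const_nhds h1
    (Eventually.of_forall fun y => norm_nonneg _) ?_
  filter_upwards [h1.eventually (ge_mem_nhds (show (0 : ℝ) < 1 / 4 by norm_num))] with y hy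
  exact norm_padicLog_le hy

namespace CMPoint

variable {p : ℕ} [Fact p.Prime] (E : CMPoint p)

/-- The embedding `ι ∘ h_i ∘ g⁻¹` of `H`. -/
def embH (i : Fin E.d) (g : E.GalH) : E.H →+* PadicAlgCl p :=
  E.ι.comp ((E.H.val : E.H →+* Qbar).comp ((E.h i * g⁻¹ : E.GalH) : E.H →+* E.H))

theorem embInt_tmul_one (i : Fin E.d) (g : E.GalH) (x : 𝓞 E.H) :
    E.embInt i g (x ⊗ₜ[ℤ] (1 : ℤ_[p])) = E.embH i g x := by
  rw [embInt_tmul, PadicInt.coe_one, map_one, mul_one]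
  rfl

/-- The value of `ι ∘ h_i ∘ g⁻¹` at the component of an idele. -/
def embIdele (i : Fin E.d) (g : E.GalH) : E.Ideles →* PadicAlgCl p where
  toFun z := completedEmbedding (E.embH i g)
    ((z : AdeleRing (𝓞 E.H) E.H).2 (inducedPrime (E.embH i g)))
  map_one' := map_one _
  map_mul' _ _ := map_mul (completedEmbedding (E.embH i g)) _ _

theorem continuous_finPart :
    Continuous fun z : E.Ideles => (z : AdeleRing (𝓞 E.H) E.H).2 :=
  continuous_snd.comp Units.continuous_val

theorem continuous_embIdele (i : Fin E.d) (g : E.GalH) : Continuous (E.embIdele i g) :=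
  (continuous_completedEmbedding _).comp ((RestrictedProduct.continuous_eval _).comp
    E.continuous_finPart)

theorem embIdele_principal (i : Fin E.d) (g : E.GalH) (x : E.Hˣ) : E.embIdele i g
    (Units.map (algebraMap E.H (AdeleRing (𝓞 E.H) E.H) : _ →* _) x) = E.embH i g x :=
  completedEmbedding_coe (E.embH i g) (x : E.H)

/-- The ideles that are units at all finite places. -/
def finUnits : Subgroup E.Ideles where
  carrier := {z | ∀ v : HeightOneSpectrum (𝓞 E.H),
    Valued.v ((z : AdeleRing (𝓞 E.H) E.H).2 v) = 1}
  mul_mem' := fun {z w} hz hw v => by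
    refine (map_mul (Valued.v : Valuation (v.adicCompletion E.H) _)
      ((z : AdeleRing (𝓞 E.H) E.H).2 v) ((w : AdeleRing (𝓞 E.H) E.H).2 v)).trans ?_
    rw [hz v, hw v, mul_one]
  one_mem' := fun v => map_one (Valued.v : Valuation (v.adicCompletion E.H) _)
  inv_mem' := fun {z} hz v => by
    have h1 : (z : AdeleRing (𝓞 E.H) E.H).2 v *
        ((z⁻¹ : E.Ideles) : AdeleRing (𝓞 E.H) E.H).2 v = 1 :=
      congrArg (fun y : AdeleRing (𝓞 E.H) E.H => y.2 v) z.mul_inv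
    have h2 := congrArg (Valued.v : Valuation (v.adicCompletion E.H) _) h1
    rwa [map_mul, hz v, one_mul, map_one] at h2

theorem norm_embIdele {z : E.Ideles} (hz : z ∈ E.finUnits) (i : Fin E.d) (g : E.GalH) :
    ‖E.embIdele i g z‖ = 1 :=
  norm_completedEmbedding_eq_one (E.embH i g) (hz _)

theorem finUnits_mem_nhds : (E.finUnits : Set E.Ideles) ∈ 𝓝 1 := by
  have h1 : IsOpen {x : FiniteAdeleRing (𝓞 E.H) E.H |
      ∀ v, x v ∈ (v.adicCompletionIntegers E.H : Set (v.adicCompletion E.H))} :=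
    RestrictedProduct.isOpen_forall_mem fun v => Valued.isOpen_valuationSubring _
  have h2 : IsOpen ({z : E.Ideles | ∀ v, (z : AdeleRing (𝓞 E.H) E.H).2 v ∈
      (v.adicCompletionIntegers E.H : Set (v.adicCompletion E.H))}) :=
    h1.preimage E.continuous_finPart
  have h3 := h2.preimage continuous_inv
  have hone : (1 : E.Ideles) ∈ ({z : E.Ideles | ∀ v, (z : AdeleRing (𝓞 E.H) E.H).2 v ∈
      (v.adicCompletionIntegers E.H : Set (v.adicCompletion E.H))}) := fun v => one_mem _
  refine Filter.mem_of_superset (Filter.inter_mem (h2.mem_nhds hone) (h3.mem_nhds ?_)) ?_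
  · rw [Set.mem_preimage, inv_one]
    exact hone
  · rintro z ⟨hz, hz'⟩ v
    have h4 : (z : AdeleRing (𝓞 E.H) E.H).2 v *
        ((z⁻¹ : E.Ideles) : AdeleRing (𝓞 E.H) E.H).2 v = 1 :=
      congrArg (fun y : AdeleRing (𝓞 E.H) E.H => y.2 v) z.mul_inv
    have h5 := congrArg (Valued.v : Valuation (v.adicCompletion E.H) _) h4
    rw [map_mul, map_one] at h5
    exact eq_one_of_one_le_mul_left (hz v) (hz' v) h5.ge

theorem exists_unit_of_principal_mem {x : E.Hˣ}
    (hx : Units.map (algebraMap E.H (AdeleRing (𝓞 E.H) E.H) : _ →* _) x ∈ E.finUnits) :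
    ∃ u : (𝓞 E.H)ˣ, ((u : 𝓞 E.H) : E.H) = x := by
  have h1 : ∀ v : HeightOneSpectrum (𝓞 E.H), v.valuation E.H (x : E.H) = 1 := by
    intro v
    rw [← HeightOneSpectrum.valuedAdicCompletion_eq_valuation']
    exact hx v
  obtain ⟨a, ha⟩ := HeightOneSpectrum.mem_integers_of_valuation_le_one E.H (x : E.H)
    fun v => (h1 v).le
  obtain ⟨b, hb⟩ := HeightOneSpectrum.mem_integers_of_valuation_le_one (R := 𝓞 E.H) E.H
    ((x : E.H)⁻¹) fun v => by rw [map_inv₀, h1 v, inv_one]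
  have hab : a * b = 1 := by
    apply RingOfIntegers.ext
    have : algebraMap (𝓞 E.H) E.H a * algebraMap (𝓞 E.H) E.H b = 1 := by
      rw [ha, hb, mul_inv_cancel₀ x.ne_zero]
    exact this
  exact ⟨Units.mkOfMulEqOne a b hab, ha⟩

/-- The residue field has characteristic p, so ℤ_p maps to it through ℤ/p. The map detects that an
approximation α of a local unit modulo p is prime to v, which makes the corresponding idele a unit
at v. -/
theorem exists_residue {v : HeightOneSpectrum (𝓞 E.H)} (hv : (p : 𝓞 E.H) ∈ v.asIdeal) :
    ∃ θ : E.LocalInt →+* 𝓞 E.H ⧸ v.asIdeal,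
      ∀ x : 𝓞 E.H, θ (x ⊗ₜ[ℤ] (1 : ℤ_[p])) = Ideal.Quotient.mk v.asIdeal x := by
  have hp : ((p : ℕ) : 𝓞 E.H ⧸ v.asIdeal) = 0 := by
    rw [← map_natCast (Ideal.Quotient.mk v.asIdeal)]
    exact Ideal.Quotient.eq_zero_iff_mem.mpr hv
  have : Nontrivial (𝓞 E.H ⧸ v.asIdeal) := Ideal.Quotient.nontrivial_iff.mpr v.isPrime.ne_top
  have : CharP (𝓞 E.H ⧸ v.asIdeal) p :=
    ringChar.of_eq (CharP.ringChar_of_prime_eq_zero Fact.out hp)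
  refine ⟨(Algebra.TensorProduct.productMap (Ideal.Quotient.mk v.asIdeal).toIntAlgHom
    ((ZMod.castHom (dvd_refl p) (𝓞 E.H ⧸ v.asIdeal)).comp
      PadicInt.toZMod).toIntAlgHom : E.LocalInt →ₐ[ℤ] _), fun x => ?_⟩
  refine (Algebra.TensorProduct.productMap_apply_tmul _ _ x 1).trans ?_
  rw [map_one, mul_one]
  rfl

variable {E}

theorem IsIdeleOf.mem_finUnits {u : E.LocalUnits} {z : E.Ideles} (h : E.IsIdeleOf u z) :
    z ∈ E.finUnits := by
  intro v
  by_cases hv : (p : 𝓞 E.H) ∈ v.asIdeal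
  · obtain ⟨α, y, h1, h2⟩ := h.2.2 1
    obtain ⟨θ, hθ⟩ := E.exists_residue hv
    have h3 : θ u ≠ 0 := by
      have : Nontrivial (𝓞 E.H ⧸ v.asIdeal) := Ideal.Quotient.nontrivial_iff.mpr v.isPrime.ne_top
      exact (u.isUnit.map θ).ne_zero
    have hp : ((p : ℕ) : 𝓞 E.H ⧸ v.asIdeal) = 0 := by
      rw [← map_natCast (Ideal.Quotient.mk v.asIdeal)]
      exact Ideal.Quotient.eq_zero_iff_mem.mpr hv
    rw [h1, map_add, hθ, map_mul, map_pow, map_natCast, hp, pow_one, zero_mul, add_zero, Ne,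
      Ideal.Quotient.eq_zero_iff_mem] at h3
    have h4 : Valued.v ((α : E.H) : v.adicCompletion E.H) = 1 := by
      rw [HeightOneSpectrum.valuedAdicCompletion_eq_valuation']
      exact (HeightOneSpectrum.valuation_eq_one_iff_notMem (K := E.H) v).mpr h3
    have h5 := h2 v hv
    have h6 : Valued.v (((p : E.H) ^ 1 : E.H) : v.adicCompletion E.H) < 1 := by
      rw [HeightOneSpectrum.valuedAdicCompletion_eq_valuation', pow_one]
      exact (v.valuation_lt_one_iff_mem (K := E.H) (p : 𝓞 E.H)).mpr hv
    have h7 := Valuation.map_add_eq_of_lt_left (Valued.v : Valuation (v.adicCompletion E.H) _)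
      (h4 ▸ h5.trans_lt h6)
    rwa [add_sub_cancel, h4] at h7
  · rw [h.2.1 v hv, map_one]

/-- Both sides are within ‖p‖^N of the image of the same global integer α, for every N. -/
theorem IsIdeleOf.embIdele_eq {u : E.LocalUnits} {z : E.Ideles} (h : E.IsIdeleOf u z)
    (i : Fin E.d) (g : E.GalH) : E.embIdele i g z = E.embInt i g u := by
  have h1 : ∀ N : ℕ, ‖E.embIdele i g z - E.embInt i g u‖ ≤ ‖(p : PadicAlgCl p)‖ ^ N := by
    intro N
    obtain ⟨α, y, h1, h2⟩ := h.2.2 N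
    have h3 := norm_completedEmbedding_le (E.embH i g)
      (h2 _ (prime_mem_inducedPrime (E.embH i g)))
    rw [map_sub, completedEmbedding_coe] at h3
    have h4 : ‖E.embInt i g u - E.embH i g α‖ ≤ ‖(p : PadicAlgCl p)‖ ^ N := by
      rw [h1, map_add, embInt_tmul_one, add_sub_cancel_left, map_mul, map_pow, map_natCast,
        norm_mul, norm_pow]
      exact mul_le_of_le_one_right (by positivity) (E.norm_embInt_le_one i g y)
    have h5 : E.embIdele i g z - E.embInt i g u = (E.embIdele i g z - E.embH i g α) -
        (E.embInt i g u - E.embH i g α) := by ring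
    rw [h5]
    exact (norm_sub_le_max' _ _).trans (max_le h3 h4)
  have h2 : Tendsto (fun N : ℕ => ‖(p : PadicAlgCl p)‖ ^ N) atTop (𝓝 0) :=
    tendsto_pow_atTop_nhds_zero_of_lt_one (norm_nonneg _) norm_prime_lt_one
  exact sub_eq_zero.mp (norm_le_zero_iff.mp (ge_of_tendsto' h2 h1))

/-- A linear combination of the functions `L_{i,g}` that vanishes on global units is the
restriction of a continuous homomorphism on the idele class group. -/
theorem sum_L_mem_galoisHom {κ : Fin E.d → E.G → PadicAlgCl p}
    (h : ∀ u : (𝓞 E.H)ˣ, ∑ i, ∑ g : E.G, κ i g * E.L i g.1 (E.diag u) = 0) :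
    (fun u => ∑ i, ∑ g : E.G, κ i g * E.L i g.1 u) ∈ E.galoisHom := by
  -- This is additive only on ideles that are units at all finite places, where the arguments of the
  -- logarithm have norm 1.
  let F : E.Ideles → PadicAlgCl p := fun z =>
    ∑ i, ∑ g : E.G, κ i g * padicLog p (E.embIdele i g.1 z)
  have hF1 : F 1 = 0 := by
    simp only [F, map_one, padicLog_one, mul_zero, Finset.sum_const_zero]
  have hFmul : ∀ z ∈ E.finUnits, ∀ w ∈ E.finUnits, F (z * w) = F z + F w := by
    intro z hz w hw
    simp only [F, ← Finset.sum_add_distrib, ← mul_add]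
    refine Finset.sum_congr rfl fun i _ => Finset.sum_congr rfl fun g _ => ?_
    rw [map_mul, padicLog_mul (E.norm_embIdele hz i _) (E.norm_embIdele hw i _)]
  let f : Subgroup.toAddSubgroup E.finUnits →+ PadicAlgCl p :=
    { toFun := fun z => F z.1.toMul
      map_zero' := hF1
      map_add' := fun z w => hFmul _ z.2 _ w.2 }
  let P : Subgroup E.Ideles :=
    (Units.map (algebraMap E.H (AdeleRing (𝓞 E.H) E.H) : E.H →* _)).range
  -- A principal idele that is a unit at all finite places comes from a global unit, where `F`
  -- vanishes by hypothesis. So `F` is compatible with being zero on principal ideles.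
  obtain ⟨Φ, h1, h2⟩ := exists_extension_vanishing (Subgroup.toAddSubgroup E.finUnits)
    (Subgroup.toAddSubgroup P) f (by
      rintro ⟨z, hz⟩ ⟨x, hx⟩
      change F z.toMul = 0
      have hz' : z.toMul ∈ E.finUnits := hz
      have hx' : Units.map (algebraMap E.H (AdeleRing (𝓞 E.H) E.H) : E.H →* _) x = z.toMul := hx
      rw [← hx'] at hz' ⊢
      obtain ⟨u, hu⟩ := E.exists_unit_of_principal_mem hz'
      rw [← h u]
      refine Finset.sum_congr rfl fun i _ => Finset.sum_congr rfl fun g _ => ?_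
      rw [embIdele_principal, ← hu, L, ← embInt_tmul_one]
      rfl)
  have hΦ : ∀ z ∈ E.finUnits, Φ (Additive.ofMul z) = F z := fun z hz => h1 ⟨_, hz⟩
  refine ⟨Φ, ?_, fun x => h2 _ ⟨x, rfl⟩, fun u z hz => ?_⟩
  · have h3 : ContinuousAt F 1 := by
      refine tendsto_finsetSum _ fun i _ => tendsto_finsetSum _ fun g _ =>
        Tendsto.const_mul _ ?_
      have h4 : ContinuousAt (padicLog p) (E.embIdele i g.1 1) := by
        rw [map_one]
        exact continuousAt_padicLog
      exact h4.comp (f := E.embIdele i g.1) (E.continuous_embIdele i g.1).continuousAt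
    -- The extension is not explicit outside `finUnits`, but this subgroup is a neighbourhood of 1
    -- on which it agrees with `F`. Continuity at 1 is enough for a homomorphism.
    have h5 : ContinuousAt (fun z : E.Ideles => Φ (Additive.ofMul z)) 1 := by
      refine h3.congr ?_
      filter_upwards [E.finUnits_mem_nhds] with z hz
      exact (hΦ z hz).symm
    exact continuous_of_continuousAt_one
      (AddMonoidHom.toMultiplicativeRight Φ : E.Ideles →* Multiplicative (PadicAlgCl p)) h5
  · rw [hΦ z hz.mem_finUnits]
    refine Finset.sum_congr rfl fun i _ => Finset.sum_congr rfl fun g _ => ?_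
    rw [hz.embIdele_eq, L]

end CMPoint

end HilbertCM

namespace HilbertCM

open NumberField

/-! ### Splitting in K and the partition of the indices. -/

namespace CMPair

variable (E : CMPair)

instance : NumberField E.K where
  to_charZero := inferInstance
  to_finiteDimensional := by
    convert E.finK

theorem mem_GK_iff {g : E.GF} : g ∈ E.GK ↔ ∀ x ∈ E.K, g.1 x = x :=
  IntermediateField.mem_fixingSubgroup_iff _ _

theorem mem_K_of_forall {x : Qbar} (h : ∀ c : E.GK, c.1.1 x = x) : x ∈ E.K := by
  rw [← InfiniteGalois.fixedField_fixingSubgroup E.K]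
  exact fun c => h ⟨⟨c.1, IntermediateField.fixingSubgroup_le E.le c.2⟩, c.2⟩

theorem mem_F_of_forall {x : Qbar} (h : ∀ c : E.GF, c.1 x = x) : x ∈ E.F := by
  rw [← InfiniteGalois.fixedField_fixingSubgroup E.F]
  exact fun c => h c

theorem apply_mem_K (g : E.GF) {x : Qbar} (hx : x ∈ E.K) : g.1 x ∈ E.K := by
  refine E.mem_K_of_forall fun c => ?_
  have h1 : g⁻¹ * c.1 * g ∈ E.GK := by
    have := (inferInstance : E.GK.Normal).conj_mem c.1 c.2 g⁻¹
    rwa [inv_inv] at this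
  have h2 := E.mem_GK_iff.mp h1 x hx
  have h3 : g.1 ((g⁻¹ * c.1 * g).1 x) = g.1 x := congrArg g.1 h2
  have h4 : (g * (g⁻¹ * c.1 * g)).1 x = g.1 x := h3
  rwa [← mul_assoc, ← mul_assoc, mul_inv_cancel, one_mul] at h4

/-- This is the relative norm: g induces the nontrivial automorphism of K over F. -/
theorem mul_apply_mem_F {g : E.GF} (hg : g ∉ E.GK) {x : Qbar} (hx : x ∈ E.K) :
    x * g.1 x ∈ E.F := by
  have hK : ∀ c ∈ E.GK, ∀ y ∈ E.K, c.1 y = y := fun c hc => E.mem_GK_iff.mp hc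
  have hgx := E.apply_mem_K g hx
  have h2 : g.1 (g.1 x) = x :=
    hK (g * g) ((Subgroup.mul_mem_iff_of_index_two E.GK_index).mpr Iff.rfl) x hx
  refine E.mem_F_of_forall fun c => ?_
  rw [map_mul]
  by_cases hc : c ∈ E.GK
  · rw [hK c hc x hx, hK c hc _ hgx]
  · have h3 : g⁻¹ * c ∈ E.GK := by
      rw [Subgroup.mul_mem_iff_of_index_two E.GK_index, inv_mem_iff]
      exact iff_of_false hg hc
    have h4 : ∀ y ∈ E.K, c.1 y = g.1 y := by
      intro y hy
      have h5 : g.1 ((g⁻¹ * c).1 y) = g.1 y := congrArg g.1 (hK _ h3 y hy)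
      have h6 : (g * (g⁻¹ * c)).1 y = g.1 y := h5
      rwa [mul_inv_cancel_left] at h6
    rw [h4 x hx, h4 _ hgx, h2, mul_comm]

variable {p : ℕ} [Fact p.Prime]

/-- If the prime induced by `e` splits in `K`, the decomposition group fixes `K`. -/
theorem decomp_le_GK {e : Qbar →+* PadicAlgCl p} {v : HeightOneSpectrum (𝓞 E.F)}
    (he : ∀ x : 𝓞 E.F, x ∈ v.asIdeal ↔ ‖e ((x : E.F) : Qbar)‖ < 1) (hv : E.SplitsInK v)
    {g : E.GF} (hg : g ∈ E.decomp e) : g ∈ E.GK := by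
  by_contra hgK
  let w₀ : HeightOneSpectrum (𝓞 E.K) := inducedPrime (e.comp (algebraMap E.K Qbar))
  -- Suppose g preserves the absolute value but moves K. For x in any prime w above v, the norm
  -- x·g(x) lies in v, so its absolute value ‖x‖² is below 1 and x lies in the prime w₀ induced by
  -- e. Hence w₀ would be the only prime above v.
  have key : ∀ w : HeightOneSpectrum (𝓞 E.K), w.asIdeal.comap E.inclInt = v.asIdeal →
      w = w₀ := by
    intro w hw
    have hle : w.asIdeal ≤ w₀.asIdeal := by
      intro x hx
      have h1 : ((x : E.K) : Qbar) * g.1 ((x : E.K) : Qbar) ∈ E.F :=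
        E.mul_apply_mem_F hgK (x : E.K).2
      have hint : IsIntegral ℤ (((x : E.K) : Qbar)) := 
        x.isIntegral_coe.map (algebraMap E.K Qbar).toIntAlgHom
      have hint2 : IsIntegral ℤ (g.1 ((x : E.K) : Qbar)) := 
        hint.map (g.1 : Qbar →+* Qbar).toIntAlgHom
      let n : E.F := ⟨_, h1⟩
      have hn : IsIntegral ℤ n := by
        have h2 : IsIntegral ℤ (algebraMap E.F Qbar n) := hint.mul hint2
        exact (isIntegral_algebraMap_iff (algebraMap E.F Qbar).injective).mp h2
      let n' : 𝓞 E.F := ⟨n, hn⟩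
      let y : E.K := ⟨_, E.apply_mem_K g (x : E.K).2⟩
      have hy : IsIntegral ℤ y := by
        have h2 : IsIntegral ℤ (algebraMap E.K Qbar y) := hint2
        exact (isIntegral_algebraMap_iff (algebraMap E.K Qbar).injective).mp h2
      have h3 : E.inclInt n' = x * ⟨y, hy⟩ := by
        apply RingOfIntegers.ext
        apply Subtype.ext
        rfl
      have h4 : n' ∈ v.asIdeal := by
        rw [← hw, Ideal.mem_comap, h3]
        exact w.asIdeal.mul_mem_right _ hx
      have h5 : ‖e (((x : E.K) : Qbar) * g.1 ((x : E.K) : Qbar))‖ < 1 := (he n').mp h4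
      rw [map_mul, norm_mul, hg ((x : E.K) : Qbar)] at h5
      have h6 : ‖e ((x : E.K) : Qbar)‖ < 1 := by
        by_contra! h7
        nlinarith
      exact h6
    exact HeightOneSpectrum.ext (w.isMaximal.eq_of_le w₀.isPrime.ne_top hle)
  obtain ⟨a, b, hab, hset⟩ := Set.ncard_eq_two.mp hv
  have ha : a ∈ ({a, b} : Set (HeightOneSpectrum (𝓞 E.K))) := by simp
  have hb : b ∈ ({a, b} : Set (HeightOneSpectrum (𝓞 E.K))) := by simp
  rw [← hset] at ha hb
  exact hab ((key a ha).trans (key b hb).symm)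

end CMPair

namespace CMPoint

variable {p : ℕ} [Fact p.Prime] (E : CMPoint p)

theorem decomp_mem_GK {i : Fin E.d} (hi : E.SplitsInK (E.place i).1)
    (g : E.decomp (E.emb (E.place i))) : g.1 ∈ E.GK :=
  E.decomp_le_GK (E.emb_induces (E.place i)) hi g.2

/-- The base change M intertwines diag(ψ', ψ'') with diag(χ, χ^σ). Each nonzero entry of M
identifies one of χ, χ^σ with one of ψ', ψ''. -/
theorem exists_intertwiner {i : Fin E.d} (hi : E.SplitsInK (E.place i).1) :
    ∃ (ψ' : E.decomp (E.emb (E.place i)) →* Qbarˣ) (M : GL (Fin 2) Qbar),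
      ψ' ≠ E.ψ'' (E.place i) ∧ ∀ g : E.decomp (E.emb (E.place i)),
        (E.χ ⟨g.1, E.decomp_mem_GK hi g⟩ : Qbar) * M 0 0 = M 0 0 * ψ' g ∧
        (E.χ ⟨g.1, E.decomp_mem_GK hi g⟩ : Qbar) * M 0 1 = M 0 1 * E.ψ'' (E.place i) g ∧
        (E.twist E.σ E.χ ⟨g.1, E.decomp_mem_GK hi g⟩ : Qbar) * M 1 0 = M 1 0 * ψ' g ∧
        (E.twist E.σ E.χ ⟨g.1, E.decomp_mem_GK hi g⟩ : Qbar) * M 1 1 =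
          M 1 1 * E.ψ'' (E.place i) g := by
  obtain ⟨ψ', M, hne, hM⟩ := E.local_split (E.place i)
  refine ⟨ψ', M, hne, fun g => ?_⟩
  have h1 := E.ρ_restrict ⟨g.1, E.decomp_mem_GK hi g⟩
  have h2 : (!![(E.χ ⟨g.1, E.decomp_mem_GK hi g⟩ : Qbar), 0; 0,
      (E.twist E.σ E.χ ⟨g.1, E.decomp_mem_GK hi g⟩ : Qbar)] : Matrix (Fin 2) (Fin 2) Qbar) *
      (M : Matrix (Fin 2) (Fin 2) Qbar) = (M : Matrix (Fin 2) (Fin 2) Qbar) *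
        !![(ψ' g : Qbar), 0; 0, (E.ψ'' (E.place i) g : Qbar)] := by
    rw [← h1, hM g, mul_assoc, ← Units.val_mul, inv_mul_cancel, Units.val_one, mul_one]
  have h3 : ∀ a b, _ = _ := fun a b => congrFun (congrFun h2 a) b
  refine ⟨?_, ?_, ?_, ?_⟩
  · simpa [Matrix.mul_apply, Fin.sum_univ_two] using h3 0 0
  · simpa [Matrix.mul_apply, Fin.sum_univ_two] using h3 0 1
  · simpa [Matrix.mul_apply, Fin.sum_univ_two] using h3 1 0
  · simpa [Matrix.mul_apply, Fin.sum_univ_two] using h3 1 1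

theorem mem_I₁_or_mem_I₂ {i : Fin E.d} (hi : i ∉ E.I₃) : i ∈ E.I₁ ∨ i ∈ E.I₂ := by
  have hs : E.SplitsInK (E.place i).1 := not_not.mp hi
  obtain ⟨ψ', M, -, hM⟩ := E.exists_intertwiner hs
  by_cases h01 : (M : Matrix (Fin 2) (Fin 2) Qbar) 0 1 = 0
  · have h11 : (M : Matrix (Fin 2) (Fin 2) Qbar) 1 1 ≠ 0 := by
      intro h11
      have hdet : IsUnit (M : Matrix (Fin 2) (Fin 2) Qbar).det :=
        (Matrix.isUnit_iff_isUnit_det _).mp M.isUnit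
      rw [Matrix.det_fin_two, h01, h11, mul_zero, zero_mul, sub_zero] at hdet
      exact not_isUnit_zero hdet
    refine Or.inl ⟨hs, fun g => ⟨E.decomp_mem_GK hs g, Units.ext ?_⟩⟩
    exact mul_right_cancel₀ h11 ((hM g).2.2.2.trans (mul_comm _ _))
  · refine Or.inr ⟨hs, fun g => ⟨E.decomp_mem_GK hs g, Units.ext ?_⟩⟩
    exact mul_right_cancel₀ h01 ((hM g).2.1.trans (mul_comm _ _))

/-- If χ and χ^σ both restrict to ψ'', a nonzero entry in the first column of M gives ψ' = ψ'',
against the regularity assumption. -/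
theorem notMem_I₂_of_mem_I₁ {i : Fin E.d} (hi : i ∈ E.I₁) : i ∉ E.I₂ := by
  intro hi'
  obtain ⟨ψ', M, hne, hM⟩ := E.exists_intertwiner hi.1
  have hdet : IsUnit (M : Matrix (Fin 2) (Fin 2) Qbar).det :=
    (Matrix.isUnit_iff_isUnit_det _).mp M.isUnit
  apply hne
  ext g
  obtain ⟨_, h1⟩ := hi.2 g
  obtain ⟨_, h2⟩ := hi'.2 g
  obtain ⟨h3, -, h4, -⟩ := hM g
  rw [h2] at h3
  rw [h1] at h4
  by_cases h00 : (M : Matrix (Fin 2) (Fin 2) Qbar) 0 0 = 0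
  · have h10 : (M : Matrix (Fin 2) (Fin 2) Qbar) 1 0 ≠ 0 := by
      intro h10
      rw [Matrix.det_fin_two, h00, h10, mul_zero, zero_mul, sub_zero] at hdet
      exact not_isUnit_zero hdet
    exact (mul_right_cancel₀ h10 (h4.trans (mul_comm _ _))).symm
  · exact (mul_right_cancel₀ h00 (h3.trans (mul_comm _ _))).symm

end CMPoint

end HilbertCM

namespace HilbertCM

open NumberField NumberField.Units

namespace CMPoint

variable {p : ℕ} [Fact p.Prime] (E : CMPoint p)

/-! ### Sums of logarithms of units -/

/-- A unit of absolute value 1 at all infinite places is a root of unity. Archimedean identities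
between units thus become p-adic ones. -/
theorem padicUnitLog_eq_zero_of_archLog {u : (𝓞 E.H)ˣ}
    (h : ∀ g, E.archLog g (Additive.ofMul u) = 0) : E.padicUnitLog (Additive.ofMul u) = 0 := by
  have h1 : u ∈ torsion E.H := by
    rw [mem_torsion]
    intro w
    obtain ⟨g, hg⟩ := E.cplxEmb_surjective w.embedding
    have h2 := h g
    rw [E.archLog_eq_place, hg, InfinitePlace.mk_embedding, Complex.ofReal_eq_zero] at h2
    have h3 : 0 < w ((u : 𝓞 E.H) : E.H) :=
      InfinitePlace.pos_iff.mpr (RingOfIntegers.coe_ne_zero_iff.mpr u.ne_zero)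
    exact Real.eq_one_of_pos_of_log_eq_zero h3 h2
  rw [torsion, CommGroup.mem_torsion, isOfFinOrder_iff_pow_eq_one] at h1
  obtain ⟨n, hn, hu⟩ := h1
  have h2 : n • E.padicUnitLog (Additive.ofMul u) = 0 := by
    rw [← map_nsmul, ← ofMul_pow, hu, ofMul_one, map_zero]
  exact (smul_eq_zero_iff_right hn.ne').mp h2

/-- Complex conjugation does not change absolute values, and its conjugate k by g lies in G outside
C. The substitution c ↦ cσk therefore carries one sum into the other. -/
theorem sum_archLog_mul_σ (g : E.GalH) (u : (𝓞 E.H)ˣ) :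
    ∑ c : E.C, E.archLog (g * c.1.1⁻¹) (Additive.ofMul u) =
      ∑ c : E.C, E.archLog (g * (c.1 * E.σG).1⁻¹) (Additive.ofMul u) := by
  let k : E.G := ⟨g⁻¹ * E.conj * g, E.conj_mul_mem_G g⟩
  have hk : k ∉ E.C := E.conj_mul_notMem_C g
  have hmem : ∀ c : E.C, c.1 * E.σG * k ∈ E.C := by
    intro c
    rw [E.C_mul_mem, E.C_mul_mem]
    have := E.σG_notMem
    have := c.2
    tauto
  have hinj : Function.Injective fun c : E.C => (⟨c.1 * E.σG * k, hmem c⟩ : E.C) := by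
    intro c c' h
    exact Subtype.ext (mul_right_cancel (mul_right_cancel (congrArg Subtype.val h)))
  refine (Fintype.sum_bijective _ (Finite.injective_iff_bijective.mp hinj) _ _ fun c => ?_).symm
  have h1 : E.conj * (g * ((c.1 * E.σG * k : E.G) : E.GalH)⁻¹) = g * (c.1 * E.σG).1⁻¹ := by
    change E.conj * (g * ((c.1 * E.σG).1 * (g⁻¹ * E.conj * g))⁻¹) = _
    group
  rw [← h1, E.archLog_conj_mul]

/-- On global units, the sums of logarithms over the two cosets of `C` agree. -/
theorem sum_L_diag_mul_σ (i : Fin E.d) (u : (𝓞 E.H)ˣ) :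
    ∑ c : E.C, E.L i c.1.1 (E.diag u) = ∑ c : E.C, E.L i (c.1 * E.σG).1 (E.diag u) := by
  simp_rw [L_diag, ← map_sum, ← ofMul_prod]
  rw [← sub_eq_zero, ← map_sub, ← ofMul_div]
  apply E.padicUnitLog_eq_zero_of_archLog
  intro g
  rw [ofMul_div, map_sub, ofMul_prod, ofMul_prod, map_sum, map_sum, sub_eq_zero]
  simp_rw [E.archLog_unitAct, ← mul_assoc]
  exact E.sum_archLog_mul_σ (g * E.h i) u

/-- The function on `𝓞_H^× ⊗ ℚbar` given by `log_p (ι ∘ h_i ∘ s⁻¹ (·))`, linear along `ι`. -/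
def spaceLog (i : Fin E.d) (s : E.GalH) : E.UnitSpace →ₗ[ℤ] PadicAlgCl p :=
  TensorProduct.lift (LinearMap.mk₂ ℤ
    (fun (a : Qbar) (u : Additive (𝓞 E.H)ˣ) =>
      E.ι a * E.padicUnitLog (Additive.ofMul (E.unitAct (E.h i * s⁻¹) u.toMul)))
    (fun a b u => by rw [map_add, add_mul])
    (fun n a u => by rw [map_zsmul, smul_mul_assoc])
    (fun a u v => by rw [toMul_add, map_mul, ofMul_mul, map_add, mul_add])
    (fun n a u => by rw [toMul_zsmul, map_zpow, ofMul_zpow, map_zsmul, mul_smul_comm]))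

theorem spaceLog_tmul (i : Fin E.d) (s : E.GalH) (a : Qbar) (u : (𝓞 E.H)ˣ) :
    E.spaceLog i s (a ⊗ₜ[ℤ] Additive.ofMul u) =
      E.ι a * E.padicUnitLog (Additive.ofMul (E.unitAct (E.h i * s⁻¹) u)) := rfl

theorem spaceLog_smul (i : Fin E.d) (s : E.GalH) (a : Qbar) (x : E.UnitSpace) :
    E.spaceLog i s (a • x) = E.ι a * E.spaceLog i s x := by
  induction x using TensorProduct.induction_on with
  | zero => rw [smul_zero, map_zero, mul_zero]
  | add x y hx hy => rw [smul_add, map_add, map_add, hx, hy, mul_add]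
  | tmul b u =>
    rw [TensorProduct.smul_tmul']
    refine (E.spaceLog_tmul i s (a • b) u.toMul).trans ?_
    rw [smul_eq_mul, map_mul, mul_assoc]
    rfl

/-- It shows that the twisted logarithm sum depends on u only through its isotypical projection. -/
theorem spaceLog_unitProj (i : Fin E.d) (s : E.GalH) (u : (𝓞 E.H)ˣ) :
    E.spaceLog i s (E.unitProj u) = E.psiLog i s u := by
  rw [CMRep.unitProj, map_sum, psiLog]
  refine Finset.sum_congr rfl fun c _ => ?_
  rw [spaceLog_tmul, L_diag, ← E.unitAct_mul, mul_inv_rev, mul_assoc]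

/-! ### Invariance -/

/-- The element `∑_i ∑_g ρ(g) X_i ρ(g)⁻¹ L_{i,g}`. -/
def total (X : Fin E.d → Mat p) : E.MatFun := ∑ i, E.orbit i (X i)

theorem total_apply (X : Fin E.d → Mat p) (u : E.LocalUnits) (a b : Fin 2) :
    E.total X u a b = ∑ i, ∑ g : E.G, E.Ad g (X i) a b * E.L i g.1 u := by
  rw [total, Finset.sum_apply, Matrix.sum_apply]
  refine Finset.sum_congr rfl fun i _ => ?_
  rw [orbit, Matrix.sum_apply]
  refine Finset.sum_congr rfl fun g _ => ?_
  rw [Matrix.smul_apply, smul_eq_mul, mul_comm]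

theorem trace_Ad (g : E.G) (X : Mat p) : (E.Ad g X).trace = X.trace := by
  by_cases hg : g ∈ E.C
  · rw [E.Ad_C ⟨g, hg⟩, Matrix.trace_fin_two_of, Matrix.trace_fin_two]
  · obtain ⟨c, rfl⟩ := E.exists_eq_mul_σG hg
    rw [E.Ad_C_mul_σ, Matrix.trace_fin_two_of, Matrix.trace_fin_two, add_comm]

theorem Ad_total (g : E.G) (X : Fin E.d → Mat p) (u : E.LocalUnits) :
    E.Ad g (E.total X (E.localUnitAct g.1⁻¹ u)) = E.total X u := by
  rw [total, Finset.sum_apply, Finset.sum_apply, map_sum]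
  refine Finset.sum_congr rfl fun i _ => ?_
  rw [orbit, orbit, map_sum]
  refine Fintype.sum_equiv (Equiv.mulLeft g) _ _ fun h => ?_
  rw [map_smul, L_localUnitAct, Equiv.coe_mulLeft, Ad_mul]
  rfl

theorem localUnitAct_diag (g : E.GalH) (u : (𝓞 E.H)ˣ) :
    E.localUnitAct g (E.diag u) = E.diag (E.unitAct g u) := by
  apply Units.ext
  refine (Algebra.TensorProduct.map_tmul _ _ (u : 𝓞 E.H) (1 : ℤ_[p])).trans ?_
  rw [map_one]
  rfl

theorem total_diag_zero_one (X : Fin E.d → Mat p) (u : (𝓞 E.H)ˣ) :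
    E.total X (E.diag u) 0 1 =
      ∑ i, (X i 0 1 * E.psiLog i 1 u + X i 1 0 * E.psiLog i E.σH u) := by
  rw [total_apply]
  refine Finset.sum_congr rfl fun i _ => ?_
  rw [E.sum_G, psiLog, psiLog, Finset.mul_sum, Finset.mul_sum]
  refine congrArg₂ _ (Finset.sum_congr rfl fun c _ => ?_) (Finset.sum_congr rfl fun c _ => ?_)
  · rw [E.Ad_C, mul_one, ← mul_assoc, mul_comm (X i 0 1)]
    rfl
  · rw [E.Ad_C_mul_σ, ← mul_assoc, mul_comm (X i 1 0)]
    rfl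

/-- The coefficient is X_00 on C and X_11 = -X_00 on Cσ, while on global units the logarithm sums
over the two cosets coincide. -/
theorem total_diag_zero_zero {X : Fin E.d → Mat p} (hX : ∀ i, (X i).trace = 0) (u : (𝓞 E.H)ˣ) :
    E.total X (E.diag u) 0 0 = 0 := by
  rw [total_apply]
  refine Finset.sum_eq_zero fun i _ => ?_
  have h1 := hX i
  rw [Matrix.trace_fin_two] at h1
  have h2 : ∀ c : E.C, E.Ad c.1 (X i) 0 0 = X i 0 0 := fun c => by rw [E.Ad_C]; rfl
  have h3 : ∀ c : E.C, E.Ad (c.1 * E.σG) (X i) 0 0 = X i 1 1 := fun c => by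
    rw [E.Ad_C_mul_σ]; rfl
  rw [E.sum_G]
  simp_rw [h2, h3]
  rw [← Finset.mul_sum, ← Finset.mul_sum, E.sum_L_diag_mul_σ, ← add_mul, h1, zero_mul]

theorem total_trace {X : Fin E.d → Mat p} (hX : ∀ i, (X i).trace = 0) (u : E.LocalUnits) :
    (E.total X u).trace = 0 := by
  rw [total, Finset.sum_apply, Matrix.trace_sum]
  refine Finset.sum_eq_zero fun i _ => ?_
  rw [orbit, Matrix.trace_sum]
  refine Finset.sum_eq_zero fun g _ => ?_
  rw [Matrix.trace_smul, trace_Ad, hX, smul_zero]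

/-- Equivariance and trace zero hold for every such sum, so the only condition is that the entries
vanish on global units. The diagonal entries always do, and the (1,0) entry at u is the (0,1) entry
at σ⁻¹u. -/
theorem total_mem_invariants_iff {X : Fin E.d → Mat p} (hX : ∀ i, (X i).trace = 0) :
    E.total X ∈ E.invariants ↔ ∀ u : (𝓞 E.H)ˣ,
      ∑ i, (X i 0 1 * E.psiLog i 1 u + X i 1 0 * E.psiLog i E.σH u) = 0 := by
  constructor
  · intro h u
    rw [← total_diag_zero_one]
    exact E.apply_diag_of_mem_galoisHom (h.1 0 1) u
  · intro h
    have h01 : ∀ u : (𝓞 E.H)ˣ, E.total X (E.diag u) 0 1 = 0 := fun u => by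
      rw [total_diag_zero_one, h u]
    have h10 : ∀ u : (𝓞 E.H)ˣ, E.total X (E.diag u) 1 0 = 0 := fun u => by
      rw [← E.Ad_total E.σG, localUnitAct_diag, E.Ad_σ]
      exact h01 _
    have h11 : ∀ u : (𝓞 E.H)ˣ, E.total X (E.diag u) 1 1 = 0 := fun u => by
      have h1 := E.total_trace hX (E.diag u)
      rwa [Matrix.trace_fin_two, E.total_diag_zero_zero hX, zero_add] at h1
    have hall : ∀ (a b : Fin 2) (u : (𝓞 E.H)ˣ), E.total X (E.diag u) a b = 0 := by
      intro a b u
      fin_cases a <;> fin_cases b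
      · exact E.total_diag_zero_zero hX u
      · exact h01 u
      · exact h10 u
      · exact h11 u
    refine ⟨fun a b => ?_, E.total_trace hX, fun g u => E.Ad_total g X u⟩
    have h1 : (fun u => E.total X u a b) =
        fun u => ∑ i, ∑ g : E.G, E.Ad g (X i) a b * E.L i g.1 u :=
      funext fun u => E.total_apply X u a b
    rw [h1]
    refine sum_L_mem_galoisHom fun u => ?_
    rw [← total_apply, hall]

/-- The left side is linear along ι in the projection of w, and the projections of the u_k span the
isotypical component. -/
theorem forall_sum_psiLog_iff {u : Fin E.d → (𝓞 E.H)ˣ} (hu : E.IsUnitBasis u)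
    (x y : Fin E.d → PadicAlgCl p) :
    (∀ w : (𝓞 E.H)ˣ, ∑ i, (x i * E.psiLog i 1 w + y i * E.psiLog i E.σH w) = 0) ↔
      ∀ k, ∑ i, (x i * E.psiLog i 1 (u k) + y i * E.psiLog i E.σH (u k)) = 0 := by
  refine ⟨fun h k => h (u k), fun h w => ?_⟩
  have key : ∀ z ∈ E.isotypic,
      ∑ i, (x i * E.spaceLog i 1 z + y i * E.spaceLog i E.σH z) = 0 := by
    intro z hz
    rw [← hu.2] at hz
    induction hz using Submodule.span_induction with
    | mem z hz =>
      obtain ⟨k, rfl⟩ := hz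
      simp_rw [spaceLog_unitProj]
      exact h k
    | zero => simp
    | add z w _ _ hz hw =>
      simp_rw [map_add, mul_add]
      rw [← add_zero (0 : PadicAlgCl p)]
      nth_rewrite 1 [← hz]
      rw [← hw, ← Finset.sum_add_distrib]
      exact Finset.sum_congr rfl fun i _ => by ring
    | smul a z _ hz =>
      simp_rw [spaceLog_smul]
      rw [← mul_zero (E.ι a), ← hz, Finset.mul_sum]
      exact Finset.sum_congr rfl fun i _ => by ring
  have h1 := key _ (E.unitProj_mem w)
  simp_rw [spaceLog_unitProj] at h1
  exact h1

end CMPoint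

end HilbertCM

namespace HilbertCM

namespace CMPoint

variable {p : ℕ} [Fact p.Prime] (E : CMPoint p)

/-! ### The space `V` -/

open Classical in
/-- The matrix `A_i`, `B_i` or `C_i`, according to the type of the index `i`. -/
def matX (ℋ : E.LinForms) (a b : Fin E.d → PadicAlgCl p) (i : Fin E.d) : Mat p :=
  if i ∈ E.I₃ then matC (ℋ i) (a i) (b i)
  else if i ∈ E.I₂ then matB (a i) (b i) else matA (a i) (b i)

theorem notMem_I₃_of_mem_I₂ {i : Fin E.d} (hi : i ∈ E.I₂) : i ∉ E.I₃ := fun h => h hi.1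

theorem matX_of_mem_I₁ (ℋ : E.LinForms) (a b : Fin E.d → PadicAlgCl p) {i : Fin E.d}
    (hi : i ∈ E.I₁) : E.matX ℋ a b i = matA (a i) (b i) := by
  rw [matX, if_neg (fun h => h hi.1), if_neg (E.notMem_I₂_of_mem_I₁ hi)]

theorem matX_of_mem_I₂ (ℋ : E.LinForms) (a b : Fin E.d → PadicAlgCl p) {i : Fin E.d}
    (hi : i ∈ E.I₂) : E.matX ℋ a b i = matB (a i) (b i) := by
  rw [matX, if_neg (E.notMem_I₃_of_mem_I₂ hi), if_pos hi]

theorem matX_of_mem_I₃ (ℋ : E.LinForms) (a b : Fin E.d → PadicAlgCl p) {i : Fin E.d}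
    (hi : i ∈ E.I₃) : E.matX ℋ a b i = matC (ℋ i) (a i) (b i) := if_pos hi

theorem elt_eq_total (ℋ : E.LinForms) (a b : Fin E.d → PadicAlgCl p) :
    E.elt ℋ a b = E.total (E.matX ℋ a b) := by
  classical
  rw [elt, total, Finset.sum_filter, Finset.sum_filter, Finset.sum_filter,
    ← Finset.sum_add_distrib, ← Finset.sum_add_distrib]
  refine Finset.sum_congr rfl fun i _ => ?_
  by_cases h3 : i ∈ E.I₃
  · rw [if_neg (fun h : i ∈ E.I₁ => h3 h.1), if_neg (fun h : i ∈ E.I₂ => h3 h.1), if_pos h3,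
      zero_add, zero_add, E.matX_of_mem_I₃ ℋ a b h3]
  · rcases E.mem_I₁_or_mem_I₂ h3 with h | h
    · rw [if_pos h, if_neg (E.notMem_I₂_of_mem_I₁ h), if_neg h3, add_zero, add_zero,
        E.matX_of_mem_I₁ ℋ a b h]
    · rw [if_neg (fun h1 => E.notMem_I₂_of_mem_I₁ h1 h), if_pos h, if_neg h3, add_zero, zero_add,
        E.matX_of_mem_I₂ ℋ a b h]

theorem trace_matX (ℋ : E.LinForms) (a b : Fin E.d → PadicAlgCl p) (i : Fin E.d) :
    (E.matX ℋ a b i).trace = 0 := by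
  rw [matX]
  split_ifs <;> simp [matA, matB, matC, Matrix.trace_fin_two]

theorem eq_zero_of_elt_eq_zero {ℋ : E.LinForms} {a b : Fin E.d → PadicAlgCl p}
    (h : E.elt ℋ a b = 0) : a = 0 := by
  rw [elt_eq_total] at h
  funext i
  have h1 := E.eq_zero_of_sum_orbit h i
  by_cases h3 : i ∈ E.I₃
  · rw [E.matX_of_mem_I₃ ℋ a b h3] at h1
    exact congrFun (congrFun h1 1) 0
  · rcases E.mem_I₁_or_mem_I₂ h3 with h | h
    · rw [E.matX_of_mem_I₁ ℋ a b h] at h1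
      exact congrFun (congrFun h1 0) 0
    · rw [E.matX_of_mem_I₂ ℋ a b h] at h1
      exact congrFun (congrFun h1 0) 0

/-- The element of `W` with parameters `a`, `b`, as a linear function of the parameters. -/
def eltLin (ℋ : E.LinForms) : ((Fin E.d → PadicAlgCl p) × (Fin E.d → PadicAlgCl p))
    →ₗ[PadicAlgCl p] E.MatFun where
  toFun x := E.elt ℋ x.1 x.2
  map_add' x y := E.elt_add ℋ x.1 x.2 y.1 y.2
  map_smul' c x := E.elt_smul ℋ c x.1 x.2

theorem eltLin_apply (ℋ : E.LinForms) (a b : Fin E.d → PadicAlgCl p) :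
    E.eltLin ℋ (a, b) = E.elt ℋ a b := rfl

-- The unknown b_i sits in the (0,1) entry for I₁ and I₃ and in the (1,0) entry for I₂, which is the
-- reason for the exponent δ(i) in A. Only for I₃ does a_i occupy an off-diagonal entry, and it goes
-- to the right side. Diagonal entries, in particular the forms ℋ_i, impose no condition.
open Classical in
theorem elt_mem_V_iff {u : Fin E.d → (𝓞 E.H)ˣ} (hu : E.IsUnitBasis u) (ℋ : E.LinForms)
    (a b : Fin E.d → PadicAlgCl p) : E.elt ℋ a b ∈ E.V ℋ ↔
      (E.unitLogMatrix u).mulVec b =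
        fun k => -∑ j, if j ∈ E.I₃ then a j * E.psiLog j E.σH (u k) else 0 := by
  have h1 : E.elt ℋ a b ∈ E.V ℋ ↔ E.elt ℋ a b ∈ E.invariants :=
    ⟨fun h => h.2, fun h => ⟨⟨a, b, rfl⟩, h⟩⟩
  rw [h1, elt_eq_total, E.total_mem_invariants_iff (E.trace_matX ℋ a b),
    E.forall_sum_psiLog_iff hu, funext_iff]
  refine forall_congr' fun k => ?_
  rw [eq_neg_iff_add_eq_zero, Matrix.mulVec, dotProduct, ← Finset.sum_add_distrib]
  refine Eq.congr_left (Finset.sum_congr rfl fun i _ => ?_)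
  rw [unitLogMatrix, Matrix.of_apply, σδ]
  by_cases h3 : i ∈ E.I₃
  · rw [E.matX_of_mem_I₃ ℋ a b h3, if_pos h3, if_neg (fun h : i ∈ E.I₂ => h3 h.1)]
    simp [matC, mul_comm]
  · rw [if_neg h3]
    rcases E.mem_I₁_or_mem_I₂ h3 with h | h
    · rw [E.matX_of_mem_I₁ ℋ a b h, if_neg (E.notMem_I₂_of_mem_I₁ h)]
      simp [matA, mul_comm]
    · rw [E.matX_of_mem_I₂ ℋ a b h, if_pos h]
      simp [matB, mul_comm]

theorem isUnit_det_unitLogMatrix (schanuel : PadicSchanuel p E.ι) {u : Fin E.d → (𝓞 E.H)ˣ}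
    (hu : E.IsUnitBasis u) : IsUnit (E.unitLogMatrix u).det := by
  classical
  rw [isUnit_iff_ne_zero]
  -- The free shifts s_i are now specialised to σ^{δ(i)}.
  have h := E.det_padicPsi_ne_zero (fun i => if i ∈ E.I₂ then E.σG else 1) schanuel hu
  have h1 : ∀ i, ((if i ∈ E.I₂ then E.σG else 1 : E.G) : E.GalH) = E.σδ i := by
    intro i
    rw [σδ]
    split_ifs <;> rfl
  simp_rw [h1] at h
  exact h

open Classical in
/-- The parameters `b` of the element `t_j`. -/
def paramB (b : Fin E.d → Fin E.d → PadicAlgCl p) (j : Fin E.d) : Fin E.d → PadicAlgCl p :=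
  if j ∈ E.I₃ then fun i => b i j else 0

/-- Both cases of the definition take a common form with a-parameter e_j. The coefficients of a
combination of the t_j can then be read off as its parameter a. -/
theorem t_eq_elt (ℋ : E.LinForms) (b : Fin E.d → Fin E.d → PadicAlgCl p) (j : Fin E.d) :
    E.t ℋ b j = E.elt ℋ (Pi.single j 1) (E.paramB b j) := by
  by_cases h3 : j ∈ E.I₃
  · rw [t, paramB, if_pos h3, if_pos h3]
  · rw [t, paramB, if_neg h3, if_neg h3, elt_eq_total, total, Finset.sum_eq_single j]
    · congr 1
      rcases E.mem_I₁_or_mem_I₂ h3 with h | h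
      · rw [E.matX_of_mem_I₁ ℋ _ _ h]
        simp [matA]
      · rw [E.matX_of_mem_I₂ ℋ _ _ h]
        simp [matB]
    · intro i _ hij
      have h1 : E.matX ℋ (Pi.single j 1) 0 i = 0 := by
        have h2 : (0 : Fin 2 → PadicAlgCl p) = ![0, 0] := by
          ext k
          fin_cases k <;> rfl
        rw [matX, Pi.single_eq_of_ne hij]
        split_ifs
        · ext r s
          fin_cases r <;> fin_cases s <;> simp [matC, ← h2]
        · ext r s
          fin_cases r <;> fin_cases s <;> simp [matB]
        · ext r s
          fin_cases r <;> fin_cases s <;> simp [matA]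
      rw [h1]
      have h2 := E.orbit_smul i 0 0
      rwa [zero_smul, zero_smul] at h2
    · intro h
      exact absurd (Finset.mem_univ j) h

theorem sum_smul_t (ℋ : E.LinForms) (b : Fin E.d → Fin E.d → PadicAlgCl p)
    (a : Fin E.d → PadicAlgCl p) :
    ∑ j, a j • E.t ℋ b j = E.elt ℋ a (∑ j, a j • E.paramB b j) := by
  have h1 : ∀ j, a j • E.t ℋ b j =
      E.eltLin ℋ (a j • (Pi.single j 1 : Fin E.d → PadicAlgCl p), a j • E.paramB b j) := by
    intro j
    rw [t_eq_elt, ← eltLin_apply, ← map_smul, Prod.smul_mk]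
  simp_rw [h1]
  rw [← map_sum, ← eltLin_apply]
  congr 1
  refine Prod.ext ?_ ?_
  · rw [Prod.fst_sum]
    funext i
    rw [Finset.sum_apply]
    simp [Pi.single_apply]
  · rw [Prod.snd_sum]

theorem linearIndependent_t (ℋ : E.LinForms) (b : Fin E.d → Fin E.d → PadicAlgCl p) :
    LinearIndependent (PadicAlgCl p) (E.t ℋ b) := by
  rw [Fintype.linearIndependent_iff]
  intro a ha
  rw [sum_smul_t] at ha
  exact congrFun (E.eq_zero_of_elt_eq_zero ha)

/-- Since A is injective, each a admits exactly one β, and by linearity it is the combination of the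
solutions for the unit vectors. So V is a graph over the space of all a. -/
theorem elt_mem_V_iff_of_isSolution (schanuel : PadicSchanuel p E.ι) {u : Fin E.d → (𝓞 E.H)ˣ}
    (hu : E.IsUnitBasis u) {b : Fin E.d → Fin E.d → PadicAlgCl p} (hb : E.IsSolution u b)
    (ℋ : E.LinForms) (a β : Fin E.d → PadicAlgCl p) :
    E.elt ℋ a β ∈ E.V ℋ ↔ β = ∑ j, a j • E.paramB b j := by
  classical
  have hinj : Function.Injective (E.unitLogMatrix u).mulVec :=
    Matrix.mulVec_injective_of_isUnit
      ((Matrix.isUnit_iff_isUnit_det _).mpr (E.isUnit_det_unitLogMatrix schanuel hu))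
  have h1 : (E.unitLogMatrix u).mulVec (∑ j, a j • E.paramB b j) =
      fun k => -∑ j, if j ∈ E.I₃ then a j * E.psiLog j E.σH (u k) else 0 := by
    rw [← Matrix.mulVecLin_apply, map_sum]
    funext k
    rw [Finset.sum_apply, ← Finset.sum_neg_distrib]
    refine Finset.sum_congr rfl fun j _ => ?_
    rw [map_smul, Matrix.mulVecLin_apply, paramB]
    split_ifs with h
    · rw [hb j h, Pi.smul_apply, smul_eq_mul, mul_neg]
    · rw [Matrix.mulVec_zero, smul_zero, neg_zero, Pi.zero_apply]
  rw [E.elt_mem_V_iff hu, ← h1]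
  exact hinj.eq_iff

theorem span_range_t (schanuel : PadicSchanuel p E.ι) {u : Fin E.d → (𝓞 E.H)ˣ}
    (hu : E.IsUnitBasis u) {b : Fin E.d → Fin E.d → PadicAlgCl p} (hb : E.IsSolution u b)
    (ℋ : E.LinForms) :
    Submodule.span (PadicAlgCl p) (Set.range (E.t ℋ b)) = E.V ℋ := by
  refine le_antisymm (Submodule.span_le.mpr ?_) ?_
  · rintro _ ⟨j, rfl⟩
    rw [SetLike.mem_coe, t_eq_elt, E.elt_mem_V_iff_of_isSolution schanuel hu hb,
      Finset.sum_eq_single j, Pi.single_eq_same, one_smul]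
    · intro i _ hij
      rw [Pi.single_eq_of_ne hij, zero_smul]
    · intro h
      exact absurd (Finset.mem_univ j) h
  · rintro x ⟨⟨a, β, rfl⟩, hx⟩
    have h1 := (E.elt_mem_V_iff_of_isSolution schanuel hu hb ℋ a β).mp ⟨⟨a, β, rfl⟩, hx⟩
    rw [h1, ← sum_smul_t]
    exact Submodule.sum_mem _ fun j _ =>
      Submodule.smul_mem _ _ (Submodule.subset_span ⟨j, rfl⟩)

/-- A diagonal C_j has a_j = 0, since a_j is its lower left entry, so the t_j with j ∈ I₃ do not
occur. Conversely, for j ∉ I₃ the element t_j has b = 0, and a_i = 0 for all i ∈ I₃, so all its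
matrices are diagonal. -/
theorem V₁_eq_span (schanuel : PadicSchanuel p E.ι) {u : Fin E.d → (𝓞 E.H)ˣ}
    (hu : E.IsUnitBasis u) {b : Fin E.d → Fin E.d → PadicAlgCl p} (hb : E.IsSolution u b)
    (ℋ : E.LinForms) :
    E.V₁ ℋ = Submodule.span (PadicAlgCl p) (E.t ℋ b '' E.I₃ᶜ) := by
  apply le_antisymm
  · rintro x ⟨hV, a, β, rfl, -, -, h3⟩
    rw [(E.elt_mem_V_iff_of_isSolution schanuel hu hb ℋ a β).mp hV, ← sum_smul_t]
    refine Submodule.sum_mem _ fun j _ => ?_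
    by_cases hj : j ∈ E.I₃
    · have h4 : a j = 0 := h3 j hj (show (1 : Fin 2) ≠ 0 by decide)
      rw [h4, zero_smul]
      exact Submodule.zero_mem _
    · exact Submodule.smul_mem _ _ (Submodule.subset_span ⟨j, hj, rfl⟩)
  · rw [Submodule.span_le]
    rintro _ ⟨j, hj, rfl⟩
    have hV : E.t ℋ b j ∈ E.V ℋ := by
      rw [← E.span_range_t schanuel hu hb ℋ]
      exact Submodule.subset_span ⟨j, rfl⟩
    refine ⟨hV, Pi.single j 1, 0, ?_, fun i _ => ?_, fun i _ => ?_, fun i hi => ?_⟩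
    · rw [t_eq_elt, paramB, if_neg hj]
    · intro r s hrs
      fin_cases r <;> fin_cases s <;> simp_all [matA]
    · intro r s hrs
      fin_cases r <;> fin_cases s <;> simp_all [matB]
    · have hij : i ≠ j := fun h => hj (h ▸ hi)
      rw [Pi.single_eq_of_ne hij]
      intro r s hrs
      fin_cases r <;> fin_cases s <;> simp_all [matC]

end CMPoint

end HilbertCM

end

theorem mainTheorem7 (p : ℕ) [Fact p.Prime] (E : HilbertCM.CMPoint p)
    (schanuel : HilbertCM.PadicSchanuel p E.ι)
    (split : ∃ v : E.PrimesAbove p, E.SplitsInK v.1)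
    (ℋ : E.LinForms) :
    (∃ u : Fin E.d → (𝓞 E.H)ˣ, E.IsUnitBasis u) ∧
    ∀ u : Fin E.d → (𝓞 E.H)ˣ, E.IsUnitBasis u →
      IsUnit (E.unitLogMatrix u).det ∧
      ∀ b : Fin E.d → Fin E.d → PadicAlgCl p, E.IsSolution u b →
        LinearIndependent (PadicAlgCl p) (E.t ℋ b) ∧
        Submodule.span (PadicAlgCl p) (Set.range (E.t ℋ b)) = E.V ℋ ∧
        Disjoint (E.V₁ ℋ) (E.V₂ ℋ b) ∧
        E.V₁ ℋ ⊔ E.V₂ ℋ b = E.V ℋ ∧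
        Module.finrank (PadicAlgCl p) (E.V ℋ) = E.d := by
  refine ⟨E.exists_isUnitBasis, fun u hu => ⟨E.isUnit_det_unitLogMatrix schanuel hu,
    fun b hb => ?_⟩⟩
  have hli := E.linearIndependent_t ℋ b
  have hspan := E.span_range_t schanuel hu hb ℋ
  have hV₁ := E.V₁_eq_span schanuel hu hb ℋ
  -- V₁ and V₂ are spanned by complementary parts of the basis (t_j), so both the direct sum and the
  -- dimension follow formally.
  refine ⟨hli, hspan, ?_, ?_, ?_⟩
  · rw [hV₁]
    exact hli.disjoint_span_image disjoint_compl_left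
  · rw [hV₁, HilbertCM.CMPoint.V₂, ← Submodule.span_union, ← Set.image_union,
      Set.compl_union_self, Set.image_univ, hspan]
  · rw [← hspan, finrank_span_eq_card hli, Fintype.card_fin]
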